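/- Let $0<\gamma_1<\gamma_2$ and let $W:\mathbb R\to\mathbb R$ be a Schwartz function. Put $C(p)=\sqrt{\gamma_1^2+\gamma_2^2+2\gamma_1\gamma_2\cos p}$, $G(p)=\gamma_2-\gamma_1+C(p)$, $J(p)=G(2p)^2+4\gamma_1\gamma_2\cos^2p$, $\omega_1(p)=\sqrt{\gamma_1+\gamma_2-C(2p)}$, $$\mathcal A(p)=\frac1{J(p)}\begin{pmatrix}G(2p)^2&2\gamma_1G(2p)\cos p\\2\gamma_2G(2p)\cos p&4\gamma_1\gamma_2\cos^2p\end{pmatrix},\quad c=\sqrt{\frac{2\gamma_1\gamma_2}{\gamma_1+\gamma_2}},\quad q=c\,\frac{\gamma_1^2-\gamma_1\gamma_2+\gamma_2^2}{2(\gamma_1+\gamma_2)^2},$$ $$\tilde V^0(p)=\Big(\sum_{k\in\mathbb Z}W(2k)e^{-2ikp},\ \sum_{k\in\mathbb Z}W(2k+1)e^{-i(2k+1)p}\Big)^T,\qquad I^{ac}(x,t)=\frac1\pi\int_{-\pi/2}^{\pi/2}\mathcal A(p)\tilde V^0(p)e^{\frac i\mu(px+\omega_1(p)t)}\,dp .$$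 For $z\ge0$ let $\tilde V^0_1(z)=\frac12(\tilde V^0(\sqrt z)+\tilde V^0(-\sqrt z))$ and $\tilde V^0_2(z)=\frac1{2\sqrt z}(\tilde V^0(\sqrt z)-\tilde V^0(-\sqrt z))$, with the limit value $\tilde V^0_2(0)=(\tilde V^0)'(0)$; for $z<0$ continue both by $f(z)=3f(0)-3f(-z)+f(-2z)$. Let $\mathrm{Ai}(z)=\frac1\pi\int_0^\infty\cos(zs+s^3/3)\,ds$ (improper integral) be the Airy function. Put $a=(\mu/(qt))^{1/3}$ and $$P_+=\mathcal A(0)\,\mathrm{Re}\Big(\tilde V^0_1\big(-\tfrac{x-ct}{qt}\big)\mathrm{Ai}\big(\tfrac{x-ct}{\mu^{2/3}(qt)^{1/3}}\big)-i\,a\,\tilde V^0_2\big(-\tfrac{x-ct}{qt}\big)\mathrm{Ai}'\big(\tfrac{x-ct}{\mu^{2/3}(qt)^{1/3}}\big)\Big),$$ $$P_-=\mathcal A(0)\,\mathrm{Re}\Big(\tilde V^0_1\big(\tfrac{x+ct}{qt}\big)\mathrm{Ai}\big(-\tfrac{x+ct}{\mu^{2/3}(qt)^{1/3}}\big)+i\,a\,\tilde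 V^0_2\big(\tfrac{x+ct}{qt}\big)\mathrm{Ai}'\big(-\tfrac{x+ct}{\mu^{2/3}(qt)^{1/3}}\big)\Big).$$ Then $\mathrm{Re}\,I^{ac}(x,t)=a\,P_\pm\,(1+O(\mu^{2/3}))$ in the $O(\mu^{2/3})$-vicinity of the front $x=\pm ct$, in the following sense. For all $K>0$ and $t_0>0$ there are $C>0$ and $\mu_0>0$ such that, for each sign, all $0<\mu\le\mu_0$, all $t\ge t_0$, all $x$ with $|x\mp ct|\le K\mu^{2/3}$ and each component $j\in\{1,2\}$, $$\big|\mathrm{Re}\,I^{ac}_j(x,t)-a\,(P_\pm)_j\big|\le C\,\mu^{2/3}\,a ,$$ and, for every $\kappa>0$, if $|(P_\pm)_j|\ge\kappa$ then $\mathrm{Re}\,I^{ac}_j(x,t)=a\,(P_\pm)_j(1+r)$ for some real $r$ with $|r|\le (C/\kappa)\mu^{2/3}$. -/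

import Mathlib

noncomputable section

namespace DiatomicLattice

/-- The Airy function `Ai z = (1/π) ∫₀^∞ cos (z s + s³/3) ds`. The integral converges only
conditionally, so it is taken as the improper integral `lim_{R → ∞} ∫₀^R`. -/
def airyAi (z : ℝ) : ℝ :=
  Filter.limUnder Filter.atTop
    (fun R : ℝ => (1 / Real.pi) * ∫ s in (0 : ℝ)..R, Real.cos (z * s + s ^ 3 / 3))

/-- The derivative `Ai'`. -/
def airyAiDeriv (z : ℝ) : ℝ := deriv airyAi z

/-- `C(p) = √(γ₁² + γ₂² + 2 γ₁ γ₂ cos p)`. -/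
def Cfun (γ₁ γ₂ p : ℝ) : ℝ :=
  Real.sqrt (γ₁ ^ 2 + γ₂ ^ 2 + 2 * γ₁ * γ₂ * Real.cos p)

/-- `G(p) = γ₂ - γ₁ + C(p)`. -/
def Gfun (γ₁ γ₂ p : ℝ) : ℝ := γ₂ - γ₁ + Cfun γ₁ γ₂ p

/-- `J(p) = G(2p)² + 4 γ₁ γ₂ cos² p`. -/
def Jfun (γ₁ γ₂ p : ℝ) : ℝ :=
  Gfun γ₁ γ₂ (2 * p) ^ 2 + 4 * γ₁ * γ₂ * Real.cos p ^ 2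

/-- The acoustic frequency `ω₁(p) = √(γ₁ + γ₂ - C(2p))`. -/
def omega1 (γ₁ γ₂ p : ℝ) : ℝ := Real.sqrt (γ₁ + γ₂ - Cfun γ₁ γ₂ (2 * p))

/-- The matrix `𝒜(p)` of the acoustic mode. -/
def matA (γ₁ γ₂ p : ℝ) : Matrix (Fin 2) (Fin 2) ℝ :=
  (1 / Jfun γ₁ γ₂ p) •
    !![Gfun γ₁ γ₂ (2 * p) ^ 2, 2 * γ₁ * Gfun γ₁ γ₂ (2 * p) * Real.cos p;
       2 * γ₂ * Gfun γ₁ γ₂ (2 * p) * Real.cos p, 4 * γ₁ * γ₂ * Real.cos p ^ 2]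

/-- The front velocity `c`. -/
def cVel (γ₁ γ₂ : ℝ) : ℝ := Real.sqrt (2 * γ₁ * γ₂ / (γ₁ + γ₂))

/-- The dispersion constant `q`. -/
def qDisp (γ₁ γ₂ : ℝ) : ℝ :=
  cVel γ₁ γ₂ * ((γ₁ ^ 2 - γ₁ * γ₂ + γ₂ ^ 2) / (2 * (γ₁ + γ₂) ^ 2))

/-- The vector `Ṽ⁰(p) = (W̃₁(p), W̃₂(p))` of semi-discrete Fourier transforms, over the even and
over the odd sites, of the lattice values `W n` (the case `δ = h / μ = 1`). -/
def tildeV (W : SchwartzMap ℝ ℝ) (p : ℝ) : Fin 2 → ℂ :=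
  ![∑' k : ℤ, (W (2 * (k : ℝ)) : ℂ) * Complex.exp (-Complex.I * p * (2 * (k : ℂ))),
    ∑' k : ℤ, (W (2 * (k : ℝ) + 1) : ℂ) * Complex.exp (-Complex.I * p * (2 * (k : ℂ) + 1))]

/-- The acoustic integral
`I^{ac}(x,t) = (1/π) ∫_{-π/2}^{π/2} 𝒜(p) Ṽ⁰(p) exp((i/μ)(p x + ω₁(p) t)) dp`. -/
def Iac (γ₁ γ₂ : ℝ) (W : SchwartzMap ℝ ℝ) (μ x t : ℝ) : Fin 2 → ℂ := fun j =>
  (1 / (Real.pi : ℂ)) * ∫ p in (-(Real.pi / 2))..(Real.pi / 2),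
    ((matA γ₁ γ₂ p).map Complex.ofReal).mulVec (tildeV W p) j *
      Complex.exp (Complex.I / μ * (p * x + omega1 γ₁ γ₂ p * t))

/-- `Ṽ⁰₁(z) = (Ṽ⁰(√z) + Ṽ⁰(-√z)) / 2`, meant for `z ≥ 0`. -/
def evenPart (W : SchwartzMap ℝ ℝ) (z : ℝ) : Fin 2 → ℂ := fun j =>
  (tildeV W (Real.sqrt z) j + tildeV W (-Real.sqrt z) j) / 2

/-- `Ṽ⁰₂(z) = (Ṽ⁰(√z) - Ṽ⁰(-√z)) / (2 √z)`, meant for `z ≥ 0`; at `z = 0` it takes its limit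
value, the derivative of `Ṽ⁰` at `0`. -/
def oddPart (W : SchwartzMap ℝ ℝ) (z : ℝ) : Fin 2 → ℂ := fun j =>
  if z = 0 then deriv (fun p : ℝ => tildeV W p j) 0
  else (tildeV W (Real.sqrt z) j - tildeV W (-Real.sqrt z) j) / (2 * (Real.sqrt z : ℂ))

/-- The three-point continuation to `z < 0` of a function given for `z ≥ 0`:
`f(z) = 3 f(0) - 3 f(-z) + f(-2z)` for `z < 0`. -/
def threePoint (f : ℝ → Fin 2 → ℂ) (z : ℝ) : Fin 2 → ℂ :=
  if 0 ≤ z then f z else fun j => 3 * f 0 j - 3 * f (-z) j + f (-2 * z) j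

/-- `Ṽ⁰₁` on the whole line. -/
def tildeV1 (W : SchwartzMap ℝ ℝ) : ℝ → Fin 2 → ℂ := threePoint (evenPart W)

/-- `Ṽ⁰₂` on the whole line. -/
def tildeV2 (W : SchwartzMap ℝ ℝ) : ℝ → Fin 2 → ℂ := threePoint (oddPart W)

/-- The factor `(μ / (q t))^{1/3}`. -/
def amp (γ₁ γ₂ μ t : ℝ) : ℝ := (μ / (qDisp γ₁ γ₂ * t)) ^ (1 / 3 : ℝ)

/-- The vector `𝒜(0) Re(Ṽ⁰₁(z) Ai(y) - i (μ/(qt))^{1/3} Ṽ⁰₂(z) Ai'(y))` at the front `x = ct`,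
where `z = -(x - ct)/(qt)` and `y = (x - ct)/(μ^{2/3} (qt)^{1/3})`. -/
def rightProfile (γ₁ γ₂ : ℝ) (W : SchwartzMap ℝ ℝ) (μ x t : ℝ) : Fin 2 → ℝ :=
  let c := cVel γ₁ γ₂
  let q := qDisp γ₁ γ₂
  let z := -((x - c * t) / (q * t))
  let y := (x - c * t) / (μ ^ (2 / 3 : ℝ) * (q * t) ^ (1 / 3 : ℝ))
  (matA γ₁ γ₂ 0).mulVec fun j =>
    (tildeV1 W z j * (airyAi y : ℂ)
      - Complex.I * (amp γ₁ γ₂ μ t : ℂ) * tildeV2 W z j * (airyAiDeriv y : ℂ)).re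

/-- The vector `𝒜(0) Re(Ṽ⁰₁(z) Ai(y) + i (μ/(qt))^{1/3} Ṽ⁰₂(z) Ai'(y))` at the front `x = -ct`,
where `z = (x + ct)/(qt)` and `y = -(x + ct)/(μ^{2/3} (qt)^{1/3})`. -/
def leftProfile (γ₁ γ₂ : ℝ) (W : SchwartzMap ℝ ℝ) (μ x t : ℝ) : Fin 2 → ℝ :=
  let c := cVel γ₁ γ₂
  let q := qDisp γ₁ γ₂
  let z := (x + c * t) / (q * t)
  let y := -((x + c * t) / (μ ^ (2 / 3 : ℝ) * (q * t) ^ (1 / 3 : ℝ)))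
  (matA γ₁ γ₂ 0).mulVec fun j =>
    (tildeV1 W z j * (airyAi y : ℂ)
      + Complex.I * (amp γ₁ γ₂ μ t : ℂ) * tildeV2 W z j * (airyAiDeriv y : ℂ)).re

/-- `value = a * profile * (1 + O(ε))` with constant `C`, where `a > 0` is the order of the leading
term: the error is at most `C ε a`, and wherever `|profile|` is at least `κ > 0` it is a genuine
factor `1 + r` with `|r| ≤ (C / κ) ε`. (No such factor can exist at the zeros of the profile.) -/
def LeadingOrder (C ε a profile value : ℝ) : Prop :=
  |value - a * profile| ≤ C * ε * a ∧
    ∀ κ : ℝ, 0 < κ → κ ≤ |profile| →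
      ∃ r : ℝ, |r| ≤ C / κ * ε ∧ value = a * profile * (1 + r)

end DiatomicLattice

end

noncomputable section

open scoped ContDiff Topology ComplexConjugate
open MeasureTheory Filter Set

namespace DiatomicLattice

/-! ### Parameter integrals, Hadamard quotients and cutoffs. -/

section Calculus

variable {E : Type*} [NormedAddCommGroup E] [NormedSpace ℝ E]

/-! The acoustic frequency is `ω₁ = |Ω|`, where Ω (`dispersion`) is smooth and odd, with Ω(p) = cp -
qp³/3 + O(p⁵). So ω₁ has a corner at p = 0, and the two halves of the integral behave differently
near the front x = ct. For p ≥ 0 the phase px + Ωt has derivative at least x ≥ ct/2, and one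
integration by parts gives O(μ/t) (`norm_integral_nonstationary_le`). For p ≤ 0 the phase is px -
Ωt, which degenerates to a cubic at the origin. The corner is harmless because W is real: the half
integrand extends smoothly to p > 0 with conj f(p) = f(-p), so the real part of the half integral is
half the real part of the integral over the whole symmetric interval
(`two_mul_re_integral_neg_half`).

Put ψ = (cp - Ω)/q, a³ = μ/(qt) and y = a(x - ct)/μ. The phase over μ becomes (a²yp + ψ(p))/a³,
which under p = as is ys + s³/3 plus higher terms, with y bounded. Everything is done modulo O(a³),
and a³ = O(μ^{2/3} a) for t ≥ t₀.

The main tool is `CubicPhase.norm_oscInt_le`: an amplitude p^k b contributes a^{k+1}, as scaling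
predicts, plus a³ from the endpoints when b does not vanish there. It is obtained by repeated
integration by parts, dividing not by the derivative of the phase, which may vanish, but by (1-τ)p²
+ τψ' + a² ≥ d(p² + a²). Each step keeps the scaling order and improves decay, until the integrand
is dominated by a multiple of 1/(a² + p²). The bound is uniform in |y| ≤ Y and along the segment of
phases from p³/3 to ψ.

Three consequences give the Airy asymptotics (`norm_oscInt_sub_airy_combination_le`). The amplitude
F may be replaced by a cutoff times F(0) + pF'(0), the remainder being divisible by p². The phase ψ
may be replaced by p³/3, since the derivative in τ is a⁻³ times an integral with weight p⁵. The cut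
off Airy moments converge at rate a² to limits which are, up to constants, Ai and Ai'.

Finally 𝒜 is even, so F'(0) = 𝒜(0)Ṽ⁰'(0). The argument z of the profile is O(μ^{2/3}), hence Ṽ⁰₁(z)
differs from Ṽ⁰(0) by O(μ^{2/3}) and aṼ⁰₂(z) differs from aṼ⁰'(0) by O(μ^{1/3}·μ^{1/3})
(`exists_frontProfile_bound`). The left front follows from the right one by p ↦ -p. -/

/-- Differentiation under the integral sign over a compact interval. -/
theorem hasDerivAt_intervalIntegral_param {F F' : ℝ → ℝ → E} {a b : ℝ}
    (hF : ∀ x, Continuous (F x)) (hF' : Continuous (Function.uncurry F'))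
    (hd : ∀ x s, HasDerivAt (fun x => F x s) (F' x s) x) (x₀ : ℝ) :
    HasDerivAt (fun x => ∫ s in a..b, F x s) (∫ s in a..b, F' x₀ s) x₀ := by
  have hc : IsCompact (Icc (x₀ - 1) (x₀ + 1) ×ˢ uIcc a b) := isCompact_Icc.prod isCompact_uIcc
  obtain ⟨M, hM⟩ := hc.exists_bound_of_continuousOn hF'.continuousOn
  refine (intervalIntegral.hasDerivAt_integral_of_dominated_loc_of_deriv_le
    (F := F) (F' := F') (bound := fun _ => M) (s := Icc (x₀ - 1) (x₀ + 1))
    (Icc_mem_nhds (by linarith) (by linarith)) ?_ ?_ ?_ ?_ ?_ ?_).2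
  · exact Eventually.of_forall fun x => (hF x).aestronglyMeasurable
  · exact (hF x₀).intervalIntegrable _ _
  · exact (hF'.comp (Continuous.prodMk_right x₀)).aestronglyMeasurable
  · exact Eventually.of_forall fun t ht x hx => hM (x, t) ⟨hx, uIoc_subset_uIcc ht⟩
  · exact intervalIntegrable_const
  · exact Eventually.of_forall fun t _ x _ => hd x t

/-- Each differentiation in p brings out one factor t, so the induction on n needs all weights t^k
at once. The case k = 0 with h = f' is the Hadamard quotient. -/
theorem contDiff_integral_pow_smul_comp_mul (n : ℕ) :
    ∀ (k : ℕ) {h : ℝ → E}, ContDiff ℝ ∞ h →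
      ContDiff ℝ n fun p : ℝ => ∫ t in (0 : ℝ)..1, t ^ k • h (t * p) := by
  have key : ∀ (k : ℕ) {h : ℝ → E}, ContDiff ℝ ∞ h → ∀ p : ℝ,
      HasDerivAt (fun p : ℝ => ∫ t in (0 : ℝ)..1, t ^ k • h (t * p))
        (∫ t in (0 : ℝ)..1, t ^ (k + 1) • deriv h (t * p)) p := by
    intro k h hh p
    have h1 := (contDiff_infty_iff_deriv.1 hh)
    have hc := h1.2.continuous
    have hc0 := hh.continuous
    refine hasDerivAt_intervalIntegral_param (F := fun p t => t ^ k • h (t * p))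
      (F' := fun p t => t ^ (k + 1) • deriv h (t * p)) ?_ ?_ ?_ p
    · intro x; fun_prop
    · simp only [Function.uncurry_def]; fun_prop
    · intro x s
      have := ((h1.1 (s * x)).hasDerivAt.scomp x ((hasDerivAt_id x).const_mul s)).const_smul (s ^ k)
      simpa [smul_smul, pow_succ, Function.comp_def] using! this
  induction n with
  | zero =>
    intro k h hh
    exact contDiff_zero.2 (continuous_iff_continuousAt.2 fun p => (key k hh p).continuousAt)
  | succ n ih =>
    intro k h hh
    rw [show ((n + 1 : ℕ) : ℕ∞ω) = (n : ℕ∞ω) + 1 from rfl, contDiff_succ_iff_deriv]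
    refine ⟨fun p => (key k hh p).differentiableAt, by simp, ?_⟩
    rw [show deriv (fun p : ℝ => ∫ t in (0 : ℝ)..1, t ^ k • h (t * p)) = _ from
      funext fun p => (key k hh p).deriv]
    exact ih (k + 1) (contDiff_infty_iff_deriv.1 hh).2

/-- Hadamard's lemma on the line. -/
theorem exists_contDiff_eq_add_smul [CompleteSpace E] {f : ℝ → E} (hf : ContDiff ℝ ∞ f) :
    ∃ g : ℝ → E, ContDiff ℝ ∞ g ∧ ∀ p, f p = f 0 + p • g p := by
  have h1 := contDiff_infty_iff_deriv.1 hf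
  refine ⟨fun p => ∫ t in (0 : ℝ)..1, t ^ 0 • deriv f (t * p),
    contDiff_infty.2 fun n => contDiff_integral_pow_smul_comp_mul n 0 h1.2, fun p => ?_⟩
  have hd : ∀ t ∈ uIcc (0 : ℝ) 1, HasDerivAt (fun t : ℝ => f (t * p)) (p • deriv f (t * p)) t := by
    intro t _
    have := (h1.1 (t * p)).hasDerivAt.scomp t ((hasDerivAt_id t).mul_const p)
    simpa [Function.comp_def] using! this
  have hc := h1.2.continuous
  have := intervalIntegral.integral_eq_sub_of_hasDerivAt hd
    ((by fun_prop : Continuous fun t : ℝ => p • deriv f (t * p)).intervalIntegrable _ _)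
  rw [intervalIntegral.integral_smul] at this
  simp only [pow_zero, one_smul]
  rw [this]; simp

/-- A smooth function vanishing near `0` is divisible by every power of the variable. -/
theorem exists_contDiff_eq_pow_smul_of_eventually_zero {f : ℝ → E} (hf : ContDiff ℝ ∞ f)
    (h0 : ∀ᶠ p in 𝓝 0, f p = 0) (k : ℕ) :
    ∃ g : ℝ → E, ContDiff ℝ ∞ g ∧ (∀ p, f p = 0 → g p = 0) ∧ ∀ p, f p = p ^ k • g p := by
  refine ⟨fun p => (p ^ k)⁻¹ • f p, contDiff_iff_contDiffAt.2 fun p => ?_, ?_, ?_⟩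
  · by_cases hp : p = 0
    · subst hp
      refine (contDiffAt_const (c := (0 : E))).congr_of_eventuallyEq ?_
      filter_upwards [h0] with p hp
      simp [hp]
    · exact ((contDiff_id.pow k).contDiffAt.inv (pow_ne_zero k hp)).smul hf.contDiffAt
  · intro p hp; simp [hp]
  · intro p
    by_cases hp : p = 0
    · subst hp; simp [h0.self_of_nhds]
    · rw [smul_smul, mul_inv_cancel₀ (pow_ne_zero k hp), one_smul]

theorem exists_contDiff_cutoff {L : ℝ} (hL : 0 < L) :
    ∃ χ : ℝ → ℝ, ContDiff ℝ ∞ χ ∧ (∀ᶠ p in 𝓝 0, χ p = 1) ∧ ∀ p, L ≤ |p| → χ p = 0 := by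
  let f : ContDiffBump (0 : ℝ) := ⟨L / 2, L, by linarith, by linarith⟩
  refine ⟨f, f.contDiff, f.eventuallyEq_one, fun p hp => f.zero_of_le_dist ?_⟩
  simpa [f, Real.dist_eq] using hp

end Calculus

/-! ### Oscillatory integrals with a cubically degenerate phase. -/

/-- A phase `ψ` on `[-L, L]` with at most a cubic degeneracy, situated at the origin. -/
structure CubicPhase (L d : ℝ) (ψ v : ℝ → ℝ) : Prop where
  L_pos : 0 < L
  d_pos : 0 < d
  d_le_one : d ≤ 1
  contDiff : ContDiff ℝ ∞ ψ
  contDiff_v : ContDiff ℝ ∞ v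
  deriv_deriv : ∀ p, deriv (deriv ψ) p = p * v p
  le_deriv : ∀ p, |p| ≤ L → d * p ^ 2 ≤ deriv ψ p

/-- The segment joining the phase `p ^ 3 / 3` to `ψ`. -/
def phase (ψ : ℝ → ℝ) (τ p : ℝ) : ℝ := (1 - τ) * (p ^ 3 / 3) + τ * ψ p

/-- The derivative of the phase, shifted by `a ^ 2` to stay away from zero. -/
def denom (ψ : ℝ → ℝ) (τ a p : ℝ) : ℝ := (1 - τ) * p ^ 2 + τ * deriv ψ p + a ^ 2

/-- The oscillating factor at the scale `a`, with the linear perturbation `a ^ 2 y p`. -/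
def osc (ψ : ℝ → ℝ) (τ a y p : ℝ) : ℂ :=
  Complex.exp (((a ^ 2 * y * p + phase ψ τ p) / a ^ 3 : ℝ) * Complex.I)

/-- The oscillatory integral with amplitude `p ^ k b(p) / denom(p) ^ n`. -/
def oscInt (L : ℝ) (ψ : ℝ → ℝ) (τ a y : ℝ) (k n : ℕ) (b : ℝ → ℂ) : ℂ :=
  ∫ p in (-L)..L, (p : ℂ) ^ k * b p * ((denom ψ τ a p : ℂ)⁻¹) ^ n * osc ψ τ a y p

theorem norm_osc (ψ : ℝ → ℝ) (τ a y p : ℝ) : ‖osc ψ τ a y p‖ = 1 :=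
  Complex.norm_exp_ofReal_mul_I _

namespace CubicPhase

variable {L d : ℝ} {ψ v : ℝ → ℝ}

theorem differentiable (h : CubicPhase L d ψ v) : Differentiable ℝ ψ :=
  (contDiff_infty_iff_deriv.1 h.contDiff).1

theorem contDiff_deriv (h : CubicPhase L d ψ v) : ContDiff ℝ ∞ (deriv ψ) :=
  (contDiff_infty_iff_deriv.1 h.contDiff).2

theorem hasDerivAt_deriv (h : CubicPhase L d ψ v) (p : ℝ) :
    HasDerivAt (deriv ψ) (p * v p) p := by
  rw [← h.deriv_deriv]
  exact ((contDiff_infty_iff_deriv.1 h.contDiff_deriv).1 p).hasDerivAt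

theorem continuous_osc (h : CubicPhase L d ψ v) (τ a y : ℝ) : Continuous (osc ψ τ a y) := by
  have := h.contDiff.continuous
  unfold osc phase; fun_prop

theorem continuous_denom (h : CubicPhase L d ψ v) (τ a : ℝ) : Continuous (denom ψ τ a) := by
  have := h.contDiff_deriv.continuous
  unfold denom; fun_prop

theorem le_denom (h : CubicPhase L d ψ v) {τ a p : ℝ} (h0 : 0 ≤ τ) (h1 : τ ≤ 1)
    (hp : |p| ≤ L) : d * (p ^ 2 + a ^ 2) ≤ denom ψ τ a p := by
  have e1 := h.le_deriv p hp
  have e2 := h.d_le_one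
  have e3 := h.d_pos
  have : τ * (d * p ^ 2) ≤ τ * deriv ψ p := by gcongr
  have : (1 - τ) * (d * p ^ 2) ≤ (1 - τ) * p ^ 2 := by
    apply mul_le_mul_of_nonneg_left _ (by linarith)
    nlinarith [sq_nonneg p]
  unfold denom
  nlinarith [sq_nonneg a]

theorem denom_pos (h : CubicPhase L d ψ v) {τ a p : ℝ} (h0 : 0 ≤ τ) (h1 : τ ≤ 1)
    (ha : 0 < a) (hp : |p| ≤ L) : 0 < denom ψ τ a p :=
  lt_of_lt_of_le (mul_pos h.d_pos (by positivity)) (h.le_denom h0 h1 hp)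

/-- The factor p comes from ψ'' = pv. It offsets part of the extra power of the denominator when D⁻ⁿ
is differentiated, so that such a term costs only one power of a in scaling. -/
theorem hasDerivAt_denom (h : CubicPhase L d ψ v) (τ a p : ℝ) :
    HasDerivAt (denom ψ τ a) (p * ((1 - τ) * 2 + τ * v p)) p := by
  have := ((((hasDerivAt_id p).pow 2).const_mul (1 - τ)).add
    ((h.hasDerivAt_deriv p).const_mul τ)).add_const (a ^ 2)
  refine HasDerivAt.congr_deriv this ?_
  simp; ring

/-- The true derivative of the phase contains a²y and may vanish for y < 0. Writing it as the
positive denominator plus a²(y - 1) moves the possible stationary points into a term of the same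
scaling order. -/
theorem hasDerivAt_osc (h : CubicPhase L d ψ v) (τ a y p : ℝ) :
    HasDerivAt (osc ψ τ a y)
      (osc ψ τ a y p * (Complex.I / (a : ℂ) ^ 3 * (denom ψ τ a p + (a : ℂ) ^ 2 * (y - 1)))) p := by
  have h1 : HasDerivAt (fun p => (a ^ 2 * y * p + phase ψ τ p) / a ^ 3)
      ((denom ψ τ a p + a ^ 2 * (y - 1)) / a ^ 3) p := by
    have := (((hasDerivAt_id p).const_mul (a ^ 2 * y)).add
      (((((hasDerivAt_id p).pow 3).div_const 3).const_mul (1 - τ)).add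
        ((h.differentiable p).hasDerivAt.const_mul τ))).div_const (a ^ 3)
    refine HasDerivAt.congr_deriv this ?_
    simp [denom]; ring
  have := (h1.ofReal_comp.mul_const Complex.I).cexp
  refine HasDerivAt.congr_deriv this ?_
  simp only [osc]; push_cast; ring

theorem mem_of_mem_uIcc (h : CubicPhase L d ψ v) {p : ℝ} (hp : p ∈ uIcc (-L) L) : |p| ≤ L := by
  rw [uIcc_of_le (by linarith [h.L_pos])] at hp
  exact abs_le.2 hp

theorem continuousOn_integrand (h : CubicPhase L d ψ v) {τ a y : ℝ} (h0 : 0 ≤ τ) (h1 : τ ≤ 1)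
    (ha : 0 < a) (k n : ℕ) {b : ℝ → ℂ} (hb : Continuous b) :
    ContinuousOn (fun p : ℝ => (p : ℂ) ^ k * b p * ((denom ψ τ a p : ℂ)⁻¹) ^ n * osc ψ τ a y p)
      (uIcc (-L) L) := by
  have c1 := h.continuous_osc τ a y
  have c2 := h.continuous_denom τ a
  have c3 : ContinuousOn (fun p : ℝ => ((denom ψ τ a p : ℂ)⁻¹) ^ n) (uIcc (-L) L) := by
    refine ContinuousOn.pow (ContinuousOn.inv₀ (by fun_prop) fun p hp => ?_) n
    exact_mod_cast (h.denom_pos h0 h1 ha (h.mem_of_mem_uIcc hp)).ne'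
  exact (ContinuousOn.mul (by fun_prop) c3).mul c1.continuousOn

theorem intervalIntegrable (h : CubicPhase L d ψ v) {τ a y : ℝ} (h0 : 0 ≤ τ) (h1 : τ ≤ 1)
    (ha : 0 < a) (k n : ℕ) {b : ℝ → ℂ} (hb : Continuous b) :
    IntervalIntegrable
      (fun p : ℝ => (p : ℂ) ^ k * b p * ((denom ψ τ a p : ℂ)⁻¹) ^ n * osc ψ τ a y p)
      volume (-L) L :=
  (h.continuousOn_integrand h0 h1 ha k n hb).intervalIntegrable

/-- Integration by parts against the oscillating factor. -/
theorem oscInt_eq (h : CubicPhase L d ψ v) {τ a y : ℝ} (h0 : 0 ≤ τ) (h1 : τ ≤ 1)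
    (ha : 0 < a) (k n : ℕ) {b : ℝ → ℂ} (hb : ContDiff ℝ ∞ b) :
    oscInt L ψ τ a y k n b =
      (a : ℂ) ^ 2 * (1 - y) * oscInt L ψ τ a y k (n + 1) b
      - Complex.I * (a : ℂ) ^ 3 *
        ((L : ℂ) ^ k * b L * ((denom ψ τ a L : ℂ)⁻¹) ^ (n + 1) * osc ψ τ a y L
          - ((-L : ℝ) : ℂ) ^ k * b (-L) * ((denom ψ τ a (-L) : ℂ)⁻¹) ^ (n + 1) * osc ψ τ a y (-L))
      + Complex.I * (a : ℂ) ^ 3 *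
        (k * oscInt L ψ τ a y (k - 1) (n + 1) b + oscInt L ψ τ a y k (n + 1) (deriv b)
          - (n + 1) * ((1 - τ) * oscInt L ψ τ a y (k + 1) (n + 2) (fun p => 2 * b p)
            + τ * oscInt L ψ τ a y (k + 1) (n + 2) (fun p => b p * v p))) := by
  have hb' := contDiff_infty_iff_deriv.1 hb
  have hbc := hb.continuous
  have hvc := h.contDiff_v.continuous
  have ha' : (a : ℂ) ≠ 0 := by exact_mod_cast ha.ne'
  have i1 := h.intervalIntegrable (y := y) h0 h1 ha k n hb.continuous
  have i2 := h.intervalIntegrable (y := y) h0 h1 ha k (n + 1) hb.continuous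
  have i3 := h.intervalIntegrable (y := y) h0 h1 ha (k - 1) (n + 1) hb.continuous
  have i4 := h.intervalIntegrable (y := y) h0 h1 ha k (n + 1) hb'.2.continuous
  have i5 := h.intervalIntegrable (y := y) h0 h1 ha (k + 1) (n + 2)
    (b := fun p => 2 * b p) (by fun_prop)
  have i6 := h.intervalIntegrable (y := y) h0 h1 ha (k + 1) (n + 2)
    (b := fun p => b p * v p) (by fun_prop)
  -- The primitive carries n + 1 powers of the inverse denominator; differentiating the oscillating
  -- factor restores one denominator and produces the integrand with n.
  have hD : ∀ p ∈ uIcc (-L) L, HasDerivAt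
      (fun p : ℝ => (p : ℂ) ^ k * b p * ((denom ψ τ a p : ℂ)⁻¹) ^ (n + 1) * osc ψ τ a y p)
      (((Complex.I / (a : ℂ) ^ 3 *
          ((p : ℂ) ^ k * b p * ((denom ψ τ a p : ℂ)⁻¹) ^ n * osc ψ τ a y p)
        + Complex.I / (a : ℂ) ^ 3 * ((a : ℂ) ^ 2 * (y - 1)) *
          ((p : ℂ) ^ k * b p * ((denom ψ τ a p : ℂ)⁻¹) ^ (n + 1) * osc ψ τ a y p))
        + (k * ((p : ℂ) ^ (k - 1) * b p * ((denom ψ τ a p : ℂ)⁻¹) ^ (n + 1) * osc ψ τ a y p)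
          + (p : ℂ) ^ k * deriv b p * ((denom ψ τ a p : ℂ)⁻¹) ^ (n + 1) * osc ψ τ a y p))
        - ((n + 1) * (1 - τ) * ((p : ℂ) ^ (k + 1) * (2 * b p) *
            ((denom ψ τ a p : ℂ)⁻¹) ^ (n + 2) * osc ψ τ a y p)
          + (n + 1) * τ * ((p : ℂ) ^ (k + 1) * (b p * v p) *
            ((denom ψ τ a p : ℂ)⁻¹) ^ (n + 2) * osc ψ τ a y p))) p := by
    intro p hp
    have hne : (denom ψ τ a p : ℂ) ≠ 0 := by
      exact_mod_cast (h.denom_pos h0 h1 ha (h.mem_of_mem_uIcc hp)).ne'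
    have d1 : HasDerivAt (fun p : ℝ => (p : ℂ) ^ k) (k * (p : ℂ) ^ (k - 1)) p := by
      simpa using! ((hasDerivAt_id p).ofReal_comp.pow k)
    have d2 := (((h.hasDerivAt_denom τ a p).ofReal_comp.inv hne).pow (n + 1))
    have := ((d1.mul (hb'.1 p).hasDerivAt).mul d2).mul (h.hasDerivAt_osc τ a y p)
    refine HasDerivAt.congr_deriv this ?_
    simp only [Pi.mul_apply, Pi.pow_apply, Pi.inv_apply, Nat.add_sub_cancel,
      pow_succ _ n, pow_succ _ (n + 1)]
    push_cast
    generalize ((denom ψ τ a p : ℂ)⁻¹) ^ n = E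
    field_simp
    ring
  have e := intervalIntegral.integral_eq_sub_of_hasDerivAt hD
    ((((i1.const_mul _).add (i2.const_mul _)).add ((i3.const_mul _).add i4)).sub
      ((i5.const_mul _).add (i6.const_mul _)))
  rw [intervalIntegral.integral_sub
      (((i1.const_mul _).add (i2.const_mul _)).add ((i3.const_mul _).add i4))
      ((i5.const_mul _).add (i6.const_mul _)),
    intervalIntegral.integral_add ((i1.const_mul _).add (i2.const_mul _))
      ((i3.const_mul _).add i4),
    intervalIntegral.integral_add (i1.const_mul _) (i2.const_mul _),
    intervalIntegral.integral_add (i3.const_mul _) i4,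
    intervalIntegral.integral_add (i5.const_mul _) (i6.const_mul _)] at e
  simp only [intervalIntegral.integral_const_mul] at e
  simp only [← oscInt.eq_1] at e
  -- Multiplying the integrated identity by -i a³ isolates the integral on the left.
  have hκ : Complex.I / (a : ℂ) ^ 3 * (Complex.I * (a : ℂ) ^ 3) = -1 := by
    field_simp
    exact Complex.I_sq
  linear_combination (-Complex.I * (a : ℂ) ^ 3) * e + (oscInt L ψ τ a y k n b +
    (a : ℂ) ^ 2 * (y - 1) * oscInt L ψ τ a y k (n + 1) b) * hκ

/-- When k + 2 ≤ 2n no oscillation is needed: the integrand is dominated by a multiple of 1/(a² +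
p²), whose integral is at most π/a. -/
theorem norm_oscInt_le_of_le (h : CubicPhase L d ψ v) {k n : ℕ} (hkn : k + 2 ≤ 2 * n)
    {b : ℝ → ℂ} {M : ℝ} (hM : ∀ p, |p| ≤ L → ‖b p‖ ≤ M) {τ a y : ℝ}
    (h0 : 0 ≤ τ) (h1 : τ ≤ 1) (ha : 0 < a) :
    a ^ (2 * n) * ‖oscInt L ψ τ a y k n b‖ ≤ M * (d⁻¹) ^ n * Real.pi * a ^ (k + 1) := by
  have hL := h.L_pos
  have hd := h.d_pos
  have hM0 : 0 ≤ M := (norm_nonneg _).trans (hM 0 (by simpa using hL.le))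
  have hpt : ∀ p ∈ Ioc (-L) L,
      ‖(p : ℂ) ^ k * b p * ((denom ψ τ a p : ℂ)⁻¹) ^ n * osc ψ τ a y p‖ ≤
        (M * (d⁻¹) ^ n * a ^ (k + 2)) / a ^ (2 * n) * (a ^ 2 + p ^ 2)⁻¹ := by
    intro p hp
    have hpL : |p| ≤ L := abs_le.2 ⟨hp.1.le, hp.2⟩
    have hD := h.le_denom (a := a) h0 h1 hpL
    have hDp := h.denom_pos h0 h1 ha hpL
    have hρ : 0 < p ^ 2 + a ^ 2 := by positivity
    rw [norm_mul, norm_osc, mul_one, norm_mul, norm_mul, norm_pow, norm_pow, norm_inv,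
      Complex.norm_real, Complex.norm_real, Real.norm_eq_abs, Real.norm_of_nonneg hDp.le]
    have s1 : (denom ψ τ a p)⁻¹ ≤ d⁻¹ * (p ^ 2 + a ^ 2)⁻¹ := by
      rw [← mul_inv]; exact inv_anti₀ (by positivity) hD
    -- One denominator is kept for the integrable kernel; the other e absorb |p|^k a^j with j = 2e -
    -- k.
    obtain ⟨e, rfl⟩ : ∃ e, n = e + 1 := ⟨n - 1, by omega⟩
    obtain ⟨j, hj⟩ : ∃ j, 2 * e = k + j := ⟨2 * e - k, by omega⟩
    have s2 : |p| ^ k * a ^ j ≤ (p ^ 2 + a ^ 2) ^ e := by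
      set ρ := Real.sqrt (p ^ 2 + a ^ 2) with hρdef
      have q1 : |p| ≤ ρ := Real.abs_le_sqrt (by nlinarith)
      have q2 : a ≤ ρ := Real.le_sqrt_of_sq_le (by nlinarith)
      have q3 : ρ ^ 2 = p ^ 2 + a ^ 2 := Real.sq_sqrt hρ.le
      calc |p| ^ k * a ^ j ≤ ρ ^ k * ρ ^ j := by gcongr
        _ = (ρ ^ 2) ^ e := by rw [← pow_add, ← hj, pow_mul]
        _ = _ := by rw [q3]
    calc |p| ^ k * ‖b p‖ * (denom ψ τ a p)⁻¹ ^ (e + 1)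
        ≤ |p| ^ k * M * (d⁻¹ * (p ^ 2 + a ^ 2)⁻¹) ^ (e + 1) := by
          gcongr; exact hM p hpL
      _ = M * d⁻¹ ^ (e + 1) * (|p| ^ k * a ^ j) * ((p ^ 2 + a ^ 2) ^ e)⁻¹
            * (a ^ j)⁻¹ * (a ^ 2 + p ^ 2)⁻¹ := by
          rw [mul_pow, inv_pow (p ^ 2 + a ^ 2), pow_succ (p ^ 2 + a ^ 2), add_comm (a ^ 2)]
          field_simp
      _ ≤ M * d⁻¹ ^ (e + 1) * (p ^ 2 + a ^ 2) ^ e * ((p ^ 2 + a ^ 2) ^ e)⁻¹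
            * (a ^ j)⁻¹ * (a ^ 2 + p ^ 2)⁻¹ := by gcongr
      _ = M * d⁻¹ ^ (e + 1) * a ^ (k + 2) / a ^ (2 * (e + 1)) * (a ^ 2 + p ^ 2)⁻¹ := by
          rw [show 2 * (e + 1) = j + (k + 2) by omega, pow_add a j]
          field_simp
  have hci : Continuous fun p : ℝ =>
      (M * (d⁻¹) ^ n * a ^ (k + 2)) / a ^ (2 * n) * (a ^ 2 + p ^ 2)⁻¹ := by
    refine continuous_const.mul (Continuous.inv₀ (by fun_prop) fun p => ?_)
    positivity
  have := intervalIntegral.norm_integral_le_of_norm_le (μ := volume) (by linarith : -L ≤ L)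
    (ae_of_all _ hpt) (hci.intervalIntegrable (-L) L)
  rw [intervalIntegral.integral_const_mul, integral_inv_sq_add_sq ha.ne'] at this
  have harc : Real.arctan (L / a) - Real.arctan (-L / a) ≤ Real.pi := by
    linarith [Real.arctan_lt_pi_div_two (L / a), Real.neg_pi_div_two_lt_arctan (-L / a)]
  calc a ^ (2 * n) * ‖oscInt L ψ τ a y k n b‖
      ≤ a ^ (2 * n) * (M * d⁻¹ ^ n * a ^ (k + 2) / a ^ (2 * n) * (a⁻¹ * Real.pi)) := by
        unfold oscInt
        gcongr
        refine this.trans ?_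
        gcongr
    _ = _ := by field_simp; ring

/-- The order of decay of the oscillatory integrals. Boundary terms are absent for `β = 0`, when the
amplitude vanishes outside `[-L', L']`. -/
theorem norm_oscInt_le (h : CubicPhase L d ψ v) (Y : ℝ) {L' β : ℝ} (hL' : L' < L) (hβ : 0 ≤ β)
    (m : ℕ) : ∀ (k n : ℕ), k + 2 ≤ 2 * n + 2 * m → ∀ b : ℝ → ℂ, ContDiff ℝ ∞ b →
      (1 ≤ β ∨ ∀ p, L' < |p| → b p = 0) →
      ∃ C : ℝ, 0 ≤ C ∧ ∀ τ a y : ℝ, 0 ≤ τ → τ ≤ 1 → 0 < a → a ≤ 1 → |y| ≤ Y →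
        a ^ (2 * n) * ‖oscInt L ψ τ a y k n b‖ ≤ C * (a ^ (k + 1) + β * a ^ (2 * n + 3)) := by
  have hL := h.L_pos
  have hd := h.d_pos
  induction m with
  | zero =>
    -- m counts the integrations by parts still allowed; at m = 0 the integrand already decays
    -- enough for absolute values.
    intro k n hkn b hb _
    obtain ⟨M, hM⟩ := (isCompact_Icc (a := -L) (b := L)).exists_bound_of_continuousOn
      hb.continuous.continuousOn
    have hM' : ∀ p, |p| ≤ L → ‖b p‖ ≤ M := fun p hp => hM p (abs_le.1 hp)
    have hM0 : 0 ≤ M := (norm_nonneg _).trans (hM' 0 (by simpa using hL.le))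
    refine ⟨M * (d⁻¹) ^ n * Real.pi, by positivity, fun τ a y h0 h1 ha ha1 _ => ?_⟩
    refine (h.norm_oscInt_le_of_le (by omega) hM' h0 h1 ha).trans ?_
    gcongr
    have : 0 ≤ β * a ^ (2 * n + 3) := by positivity
    linarith
  | succ m ih =>
    intro k n hkn b hb hv
    have hb' := contDiff_infty_iff_deriv.1 hb
    have hvb : 1 ≤ β ∨ ∀ p, L' < |p| → deriv b p = 0 := by
      refine hv.imp_right fun hz p hp => ?_
      have : b =ᶠ[𝓝 p] fun _ => 0 := by
        filter_upwards [(isOpen_lt continuous_const continuous_abs).mem_nhds hp] with x hx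
          using hz x hx
      rw [this.deriv_eq]; simp
    obtain ⟨C1, hC1, H1⟩ := ih k (n + 1) (by omega) b hb hv
    obtain ⟨C2, hC2, H2⟩ := ih (k - 1) (n + 1) (by omega) b hb hv
    obtain ⟨C3, hC3, H3⟩ := ih k (n + 1) (by omega) (deriv b) hb'.2 hvb
    obtain ⟨C4, hC4, H4⟩ := ih (k + 1) (n + 2) (by omega) (fun p => 2 * b p)
      (contDiff_const.mul hb) (hv.imp_right fun hz p hp => by simp [hz p hp])
    obtain ⟨C5, hC5, H5⟩ := ih (k + 1) (n + 2) (by omega) (fun p => b p * v p)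
      (hb.mul (Complex.ofRealCLM.contDiff.comp h.contDiff_v))
      (hv.imp_right fun hz p hp => by simp [hz p hp])
    -- B bounds the endpoint terms, using that the denominator is at least d L² at ±L. It vanishes
    -- when b does so near the endpoints, which is what permits β = 0.
    set B := L ^ k * (‖b L‖ + ‖b (-L)‖) * ((d * L ^ 2)⁻¹) ^ (n + 1) with hB
    have hB0 : 0 ≤ B := by positivity
    have hBβ : B ≤ B * β := by
      rcases hv with hv | hv
      · exact le_mul_of_one_le_right hB0 hv
      · have : B = 0 := by
          rw [hB, hv L (by rwa [abs_of_pos hL]), hv (-L) (by rwa [abs_neg, abs_of_pos hL])]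
          simp
        simp [this]
    refine ⟨(1 + |Y|) * C1 + B + k * C2 + C3 + (n + 1) * (C4 + C5), by positivity, ?_⟩
    intro τ a y h0 h1 ha ha1 hy
    specialize H1 τ a y h0 h1 ha ha1 hy
    specialize H2 τ a y h0 h1 ha ha1 hy
    specialize H3 τ a y h0 h1 ha ha1 hy
    specialize H4 τ a y h0 h1 ha ha1 hy
    specialize H5 τ a y h0 h1 ha ha1 hy
    have hY : |1 - y| ≤ 1 + |Y| := by
      have := abs_sub (1 : ℝ) y
      rw [abs_one] at this
      linarith [le_abs_self Y]
    set X := a ^ (k + 1) + β * a ^ (2 * n + 3) with hX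
    have hX0 : 0 ≤ X := by positivity
    have hp1 : a ^ (2 * (n + 1) + 3) ≤ a ^ (2 * n + 3) :=
      pow_le_pow_of_le_one ha.le ha1 (by omega)
    have hp2 : a ^ (2 * (n + 1) + 4) ≤ a ^ (2 * n + 3) :=
      pow_le_pow_of_le_one ha.le ha1 (by omega)
    have hp3 : a ^ (2 * n + 6) ≤ a ^ (2 * n + 3) :=
      pow_le_pow_of_le_one ha.le ha1 (by omega)
    have hp4 : a ^ (k + 2) ≤ a ^ (k + 1) :=
      pow_le_pow_of_le_one ha.le ha1 (by omega)
    have bd : ∀ p, |p| = L → ((denom ψ τ a p)⁻¹) ^ (n + 1) ≤ ((d * L ^ 2)⁻¹) ^ (n + 1) := by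
      intro p hp
      have := h.le_denom (a := a) h0 h1 hp.le
      rw [← sq_abs p, hp] at this
      have hlow : d * L ^ 2 ≤ denom ψ τ a p := by nlinarith [sq_nonneg a]
      have := h.denom_pos h0 h1 ha hp.le
      gcongr
    have t1 : a ^ (2 * n) * (a ^ 2 * |1 - y| * ‖oscInt L ψ τ a y k (n + 1) b‖) ≤
        (1 + |Y|) * C1 * X := by
      calc _ = |1 - y| * (a ^ (2 * (n + 1)) * ‖oscInt L ψ τ a y k (n + 1) b‖) := by ring
        _ ≤ (1 + |Y|) * (C1 * (a ^ (k + 1) + β * a ^ (2 * (n + 1) + 3))) := by gcongr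
        _ ≤ (1 + |Y|) * (C1 * X) := by rw [hX]; gcongr
        _ = _ := by ring
    have t2 : a ^ (2 * n) * (a ^ 3 * (k * ‖oscInt L ψ τ a y (k - 1) (n + 1) b‖)) ≤
        k * C2 * X := by
      -- For k = 0 the truncated exponent k - 1 is harmless, since the term carries the coefficient
      -- k.
      rcases Nat.eq_zero_or_pos k with hk | hk
      · simp [hk]
      · calc _ = k * (a * (a ^ (2 * (n + 1)) * ‖oscInt L ψ τ a y (k - 1) (n + 1) b‖)) := by ring
          _ ≤ k * (a * (C2 * (a ^ (k - 1 + 1) + β * a ^ (2 * (n + 1) + 3)))) := by gcongr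
          _ = k * (C2 * (a ^ (k + 1) + β * a ^ (2 * (n + 1) + 4))) := by
            rw [Nat.sub_add_cancel hk]; ring
          _ ≤ k * (C2 * X) := by rw [hX]; gcongr
          _ = _ := by ring
    have t3 : a ^ (2 * n) * (a ^ 3 * ‖oscInt L ψ τ a y k (n + 1) (deriv b)‖) ≤ C3 * X := by
      calc _ = a * (a ^ (2 * (n + 1)) * ‖oscInt L ψ τ a y k (n + 1) (deriv b)‖) := by ring
        _ ≤ a * (C3 * (a ^ (k + 1) + β * a ^ (2 * (n + 1) + 3))) := by gcongr
        _ = C3 * (a ^ (k + 2) + β * a ^ (2 * (n + 1) + 4)) := by ring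
        _ ≤ C3 * X := by rw [hX]; gcongr
    -- Passing from n to n + 2 offers a⁴ where only a³ is present; the missing a is paid by the
    -- increase of k to k + 1.
    have t45 : ∀ (Cc z : ℝ), 0 ≤ Cc →
        a ^ (2 * (n + 2)) * z ≤ Cc * (a ^ (k + 1 + 1) + β * a ^ (2 * (n + 2) + 3)) →
        a ^ (2 * n) * (a ^ 3 * z) ≤ Cc * X := by
      intro Cc z hCc hz
      have : a * (a ^ (2 * n) * (a ^ 3 * z)) ≤ a * (Cc * (a ^ (k + 1) + β * a ^ (2 * n + 6))) := by
        calc _ = a ^ (2 * (n + 2)) * z := by ring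
          _ ≤ _ := hz
          _ = _ := by ring
      refine (le_of_mul_le_mul_left this ha).trans ?_
      rw [hX]; gcongr
    have t4 := t45 C4 _ hC4 H4
    have t5 := t45 C5 _ hC5 H5
    have tb : a ^ (2 * n) * (a ^ 3 * (L ^ k * ‖b L‖ * (denom ψ τ a L)⁻¹ ^ (n + 1)
        + L ^ k * ‖b (-L)‖ * (denom ψ τ a (-L))⁻¹ ^ (n + 1))) ≤ B * X := by
      calc _ ≤ a ^ (2 * n) * (a ^ 3 * (L ^ k * ‖b L‖ * ((d * L ^ 2)⁻¹) ^ (n + 1)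
            + L ^ k * ‖b (-L)‖ * ((d * L ^ 2)⁻¹) ^ (n + 1))) := by
              have b1 := bd L (abs_of_pos hL)
              have b2 := bd (-L) (by rw [abs_neg, abs_of_pos hL])
              generalize (denom ψ τ a L)⁻¹ ^ (n + 1) = δ₁ at b1 ⊢
              generalize (denom ψ τ a (-L))⁻¹ ^ (n + 1) = δ₂ at b2 ⊢
              gcongr
        _ = a ^ (2 * n + 3) * B := by rw [hB]; ring
        _ ≤ a ^ (2 * n + 3) * (B * β) := by gcongr
        _ = B * (β * a ^ (2 * n + 3)) := by ring
        _ ≤ B * X := by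
          rw [hX]; gcongr
          linarith [pow_pos ha (k + 1)]
    rw [h.oscInt_eq h0 h1 ha k n hb]
    have hDL := h.denom_pos h0 h1 ha (abs_of_pos hL).le
    have hDL' := h.denom_pos h0 h1 ha (p := -L) (by rw [abs_neg, abs_of_pos hL])
    refine (mul_le_mul_of_nonneg_left
      ((norm_add_le _ _).trans (add_le_add (norm_sub_le _ _) le_rfl)) (by positivity)).trans ?_
    have n1 : ‖(a : ℂ) ^ 2 * (1 - y) * oscInt L ψ τ a y k (n + 1) b‖ =
        a ^ 2 * |1 - y| * ‖oscInt L ψ τ a y k (n + 1) b‖ := by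
      rw [norm_mul, norm_mul, norm_pow, Complex.norm_real, Real.norm_of_nonneg ha.le,
        show (1 - (y : ℂ)) = ((1 - y : ℝ) : ℂ) by push_cast; ring, Complex.norm_real,
        Real.norm_eq_abs]
    have n2 : ‖Complex.I * (a : ℂ) ^ 3 *
        ((L : ℂ) ^ k * b L * ((denom ψ τ a L : ℂ)⁻¹) ^ (n + 1) * osc ψ τ a y L
          - ((-L : ℝ) : ℂ) ^ k * b (-L) * ((denom ψ τ a (-L) : ℂ)⁻¹) ^ (n + 1)
            * osc ψ τ a y (-L))‖ ≤
        a ^ 3 * (L ^ k * ‖b L‖ * (denom ψ τ a L)⁻¹ ^ (n + 1)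
          + L ^ k * ‖b (-L)‖ * (denom ψ τ a (-L))⁻¹ ^ (n + 1)) := by
      rw [norm_mul, norm_mul, Complex.norm_I, one_mul, norm_pow, Complex.norm_real,
        Real.norm_of_nonneg ha.le]
      refine mul_le_mul_of_nonneg_left ((norm_sub_le _ _).trans (le_of_eq ?_)) (by positivity)
      simp only [norm_mul, norm_osc, norm_pow, norm_inv, Complex.norm_real, Real.norm_eq_abs,
        abs_neg, abs_of_pos hL, abs_of_pos hDL, abs_of_pos hDL', mul_one]
    have n3 : ‖Complex.I * (a : ℂ) ^ 3 *
        (k * oscInt L ψ τ a y (k - 1) (n + 1) b + oscInt L ψ τ a y k (n + 1) (deriv b)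
          - (n + 1) * ((1 - τ) * oscInt L ψ τ a y (k + 1) (n + 2) (fun p => 2 * b p)
            + τ * oscInt L ψ τ a y (k + 1) (n + 2) (fun p => b p * v p)))‖ ≤
        a ^ 3 * (k * ‖oscInt L ψ τ a y (k - 1) (n + 1) b‖)
          + a ^ 3 * ‖oscInt L ψ τ a y k (n + 1) (deriv b)‖
          + (n + 1) * (a ^ 3 * ‖oscInt L ψ τ a y (k + 1) (n + 2) (fun p => 2 * b p)‖
            + a ^ 3 * ‖oscInt L ψ τ a y (k + 1) (n + 2) (fun p => b p * v p)‖) := by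
      rw [norm_mul, norm_mul, Complex.norm_I, one_mul, norm_pow, Complex.norm_real,
        Real.norm_of_nonneg ha.le]
      have m1 : ∀ z : ℂ, ‖(1 - (τ : ℂ)) * z‖ ≤ ‖z‖ := by
        intro z
        rw [norm_mul, show (1 - (τ : ℂ)) = ((1 - τ : ℝ) : ℂ) by push_cast; ring,
          Complex.norm_real, Real.norm_of_nonneg (by linarith)]
        exact mul_le_of_le_one_left (norm_nonneg _) (by linarith)
      have m2 : ∀ z : ℂ, ‖(τ : ℂ) * z‖ ≤ ‖z‖ := by
        intro z
        rw [norm_mul, Complex.norm_real, Real.norm_of_nonneg h0]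
        exact mul_le_of_le_one_left (norm_nonneg _) h1
      have m3 : ‖((n : ℂ) + 1)‖ = n + 1 := by
        rw [show ((n : ℂ) + 1) = ((n + 1 : ℕ) : ℂ) by push_cast; ring, Complex.norm_natCast]
        push_cast; ring
      calc _ ≤ a ^ 3 * ((k * ‖oscInt L ψ τ a y (k - 1) (n + 1) b‖
            + ‖oscInt L ψ τ a y k (n + 1) (deriv b)‖)
            + (n + 1) * (‖oscInt L ψ τ a y (k + 1) (n + 2) (fun p => 2 * b p)‖
              + ‖oscInt L ψ τ a y (k + 1) (n + 2) (fun p => b p * v p)‖)) := by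
            gcongr
            refine (norm_sub_le _ _).trans (add_le_add ((norm_add_le _ _).trans ?_) ?_)
            · rw [norm_mul, Complex.norm_natCast]
            · rw [norm_mul, m3]
              gcongr
              exact (norm_add_le _ _).trans (add_le_add (m1 _) (m2 _))
        _ = _ := by ring
    calc _ ≤ a ^ (2 * n) * (a ^ 2 * |1 - y| * ‖oscInt L ψ τ a y k (n + 1) b‖
          + a ^ 3 * (L ^ k * ‖b L‖ * (denom ψ τ a L)⁻¹ ^ (n + 1)
            + L ^ k * ‖b (-L)‖ * (denom ψ τ a (-L))⁻¹ ^ (n + 1))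
          + (a ^ 3 * (k * ‖oscInt L ψ τ a y (k - 1) (n + 1) b‖)
          + a ^ 3 * ‖oscInt L ψ τ a y k (n + 1) (deriv b)‖
          + (n + 1) * (a ^ 3 * ‖oscInt L ψ τ a y (k + 1) (n + 2) (fun p => 2 * b p)‖
            + a ^ 3 * ‖oscInt L ψ τ a y (k + 1) (n + 2) (fun p => b p * v p)‖))) := by
          rw [n1]; gcongr
      _ ≤ (1 + |Y|) * C1 * X + B * X + k * C2 * X + C3 * X + (n + 1) * (C4 * X + C5 * X) := by
          have hn : (0 : ℝ) ≤ (n : ℝ) + 1 := by positivity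
          have := mul_le_mul_of_nonneg_left (add_le_add t4 t5) hn
          linarith
      _ = _ := by ring

end CubicPhase

theorem oscInt_zero (L : ℝ) (ψ : ℝ → ℝ) (τ a y : ℝ) (k : ℕ) (b : ℝ → ℂ) :
    oscInt L ψ τ a y k 0 b = ∫ p in (-L)..L, (p : ℂ) ^ k * b p * osc ψ τ a y p := by
  simp [oscInt]

/-- Moving powers of the variable between the monomial and the amplitude. -/
theorem oscInt_congr (L : ℝ) (ψ : ℝ → ℝ) (τ a y : ℝ) {k l : ℕ} {b c : ℝ → ℂ}
    (h : ∀ p : ℝ, (p : ℂ) ^ k * b p = (p : ℂ) ^ l * c p) :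
    oscInt L ψ τ a y k 0 b = oscInt L ψ τ a y l 0 c := by
  simp only [oscInt_zero, h]

/-! ### The Airy function as a limit of cut off integrals. -/

/-- The integrand `exp (i (y s + s³ / 3))` of the Airy function. -/
def airyExp (y s : ℝ) : ℂ := Complex.exp ((y * s + s ^ 3 / 3 : ℝ) * Complex.I)

theorem continuous_airyExp (y : ℝ) : Continuous (airyExp y) := by
  unfold airyExp; fun_prop

theorem osc_zero_mul (ψ : ℝ → ℝ) {a : ℝ} (ha : a ≠ 0) (y s : ℝ) :
    osc ψ 0 a y (a * s) = airyExp y s := by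
  have : (a ^ 2 * y * (a * s) + phase ψ 0 (a * s)) / a ^ 3 = y * s + s ^ 3 / 3 := by
    unfold phase; field_simp; ring
  rw [osc, airyExp, this]

theorem oscInt_zero_zero_eq (L : ℝ) (ψ : ℝ → ℝ) {a : ℝ} (ha : 0 < a) (y : ℝ) (k : ℕ) (b : ℝ → ℂ) :
    oscInt L ψ 0 a y k 0 b =
      (a : ℂ) ^ (k + 1) * ∫ s in (-(L / a))..(L / a), (s : ℂ) ^ k * b (a * s) * airyExp y s := by
  have h := intervalIntegral.integral_comp_mul_left (a := -(L / a)) (b := L / a)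
    (fun p : ℝ => (p : ℂ) ^ k * b p * osc ψ 0 a y p) ha.ne'
  have ha' : (a : ℂ) ≠ 0 := by exact_mod_cast ha.ne'
  rw [show a * -(L / a) = -L by field_simp, show a * (L / a) = L by field_simp,
    ← oscInt_zero] at h
  have h2 : oscInt L ψ 0 a y k 0 b = a * ∫ s in (-(L / a))..(L / a),
      ((a * s : ℝ) : ℂ) ^ k * b (a * s) * osc ψ 0 a y (a * s) := by
    rw [h, Complex.real_smul]
    push_cast
    field_simp
  rw [h2, pow_succ', mul_assoc, ← intervalIntegral.integral_const_mul ((a : ℂ) ^ k)]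
  congr 1
  refine intervalIntegral.integral_congr fun s _ => ?_
  simp only [osc_zero_mul ψ ha.ne']
  push_cast
  ring

theorem intervalIntegral_eq_of_eq_zero {f : ℝ → ℂ} (hf : Continuous f) {r R : ℝ} (hr : 0 ≤ r)
    (hrR : r ≤ R) (h : ∀ s, r ≤ |s| → f s = 0) :
    ∫ s in (-R)..R, f s = ∫ s in (-r)..r, f s := by
  have i := fun u w => hf.intervalIntegrable (μ := volume) u w
  rw [← intervalIntegral.integral_add_adjacent_intervals (i (-R) (-r)) (i (-r) R),
    ← intervalIntegral.integral_add_adjacent_intervals (i (-r) r) (i r R)]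
  have z1 : ∫ s in (-R)..(-r), f s = 0 := by
    rw [← intervalIntegral.integral_zero (a := -R) (b := -r) (μ := volume) (E := ℂ)]
    refine intervalIntegral.integral_congr fun s hs => h s ?_
    rw [uIcc_of_le (by linarith)] at hs
    rw [abs_of_nonpos (by linarith [hs.2])]; linarith [hs.2]
  have z2 : ∫ s in r..R, f s = 0 := by
    rw [← intervalIntegral.integral_zero (a := r) (b := R) (μ := volume) (E := ℂ)]
    refine intervalIntegral.integral_congr fun s hs => h s ?_
    rw [uIcc_of_le hrR] at hs
    exact hs.1.trans (le_abs_self s)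
  rw [z1, z2]; simp

/-- A smooth cutoff, equal to `1` near `0` and to `0` outside `[-L', L']`. -/
structure IsCutoff (L' : ℝ) (χ : ℝ → ℂ) : Prop where
  contDiff : ContDiff ℝ ∞ χ
  eventually_one : ∀ᶠ p in 𝓝 0, χ p = 1
  eq_zero : ∀ p, L' < |p| → χ p = 0

theorem exists_isCutoff {L' : ℝ} (h : 0 < L') : ∃ χ, IsCutoff L' χ := by
  obtain ⟨χ, h1, h2, h3⟩ := exists_contDiff_cutoff h
  refine ⟨fun p => χ p, Complex.ofRealCLM.contDiff.comp h1, ?_, fun p hp => ?_⟩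
  · filter_upwards [h2] with p hp
    simp [hp]
  · simp [h3 p hp.le]

theorem IsCutoff.deriv_eventually_zero {L' : ℝ} {χ : ℝ → ℂ} (h : IsCutoff L' χ) :
    ∀ᶠ p in 𝓝 0, deriv χ p = 0 := by
  have : χ =ᶠ[𝓝 0] fun _ => 1 := h.eventually_one
  filter_upwards [this.deriv] with p hp
  rw [hp]; simp

theorem IsCutoff.deriv_eq_zero {L' : ℝ} {χ : ℝ → ℂ} (h : IsCutoff L' χ) {p : ℝ} (hp : L' < |p|) :
    deriv χ p = 0 := by
  have : χ =ᶠ[𝓝 p] fun _ => 0 := by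
    filter_upwards [(isOpen_lt continuous_const continuous_abs).mem_nhds hp] with x hx
      using h.eq_zero x hx
  rw [this.deriv_eq]; simp

namespace CubicPhase

variable {L d L' : ℝ} {ψ v : ℝ → ℝ} {χ : ℝ → ℂ}

/-- The Airy moments with a smooth cutoff at scale `1 / a`. -/
def cutoffMoment (L : ℝ) (ψ : ℝ → ℝ) (χ : ℝ → ℂ) (k : ℕ) (y a : ℝ) : ℂ :=
  ((a : ℂ) ^ (k + 1))⁻¹ * oscInt L ψ 0 a y k 0 χ

/-- The free radius R lets moments at different scales be compared over one interval, so that they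
can be differentiated in a. -/
theorem cutoffMoment_eq (h : CubicPhase L d ψ v) (hL' : L' < L) (hχ : IsCutoff L' χ) (k : ℕ)
    (y : ℝ) {a R : ℝ} (ha : 0 < a) (hR : L / a ≤ R) :
    cutoffMoment L ψ χ k y a = ∫ s in (-R)..R, (s : ℂ) ^ k * χ (a * s) * airyExp y s := by
  have hc := hχ.contDiff.continuous
  have he := continuous_airyExp y
  have ha' : (a : ℂ) ≠ 0 := by exact_mod_cast ha.ne'
  rw [intervalIntegral_eq_of_eq_zero (by fun_prop) (div_pos h.L_pos ha).le hR, cutoffMoment,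
    oscInt_zero_zero_eq L ψ ha, inv_mul_cancel_left₀ (pow_ne_zero _ ha')]
  intro s hs
  rw [hχ.eq_zero (a * s) ?_]
  · simp
  · rw [abs_mul, abs_of_pos ha]
    rw [div_le_iff₀ ha] at hs
    linarith

/-- Differentiating in the scale replaces χ by sχ'(as). Since χ' vanishes near 0, two extra powers
of p can be extracted from it, and each power gains a factor a; the mean value inequality then gives
a² uniformly. -/
theorem norm_cutoffMoment_sub_le (h : CubicPhase L d ψ v) (hL' : L' < L) (hχ : IsCutoff L' χ)
    (k : ℕ) (Y : ℝ) : ∃ C : ℝ, 0 ≤ C ∧ ∀ a a' y : ℝ, 0 < a' → a' ≤ a → a ≤ 1 → |y| ≤ Y →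
      ‖cutoffMoment L ψ χ k y a - cutoffMoment L ψ χ k y a'‖ ≤ C * a ^ 2 := by
  have hχ' := contDiff_infty_iff_deriv.1 hχ.contDiff
  obtain ⟨b, hb, hb0, hbe⟩ := exists_contDiff_eq_pow_smul_of_eventually_zero hχ'.2
    hχ.deriv_eventually_zero 2
  obtain ⟨C, hC, H⟩ := h.norm_oscInt_le Y hL' (β := 0) le_rfl (k + 5) (k + 3) 0 (by omega) b hb
    (Or.inr fun p hp => hb0 p (hχ.deriv_eq_zero hp))
  refine ⟨C, hC, fun a a' y ha' haa ha1 hy => ?_⟩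
  set R := L / a' with hR
  have hc := hχ.contDiff.continuous
  have hc' := hχ'.2.continuous
  have he := continuous_airyExp y
  have hder : ∀ α : ℝ, HasDerivAt
      (fun α : ℝ => ∫ s in (-R)..R, (s : ℂ) ^ k * χ (α * s) * airyExp y s)
      (∫ s in (-R)..R, (s : ℂ) ^ (k + 1) * deriv χ (α * s) * airyExp y s) α := by
    intro α
    refine hasDerivAt_intervalIntegral_param
      (F := fun α s : ℝ => (s : ℂ) ^ k * χ (α * s) * airyExp y s)
      (F' := fun α s : ℝ => (s : ℂ) ^ (k + 1) * deriv χ (α * s) * airyExp y s) ?_ ?_ ?_ α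
    · intro x; fun_prop
    · simp only [Function.uncurry_def]; fun_prop
    · intro x s
      have := (((hχ'.1 (x * s)).hasDerivAt.scomp x
        ((hasDerivAt_id x).mul_const s)).const_mul ((s : ℂ) ^ k)).mul_const (airyExp y s)
      refine HasDerivAt.congr_deriv this ?_
      simp only [one_mul, Complex.real_smul]
      ring
  have hbound : ∀ α ∈ Icc a' a,
      ‖∫ s in (-R)..R, (s : ℂ) ^ (k + 1) * deriv χ (α * s) * airyExp y s‖ ≤ C * a ^ 2 := by
    intro α hα
    have hα0 : 0 < α := ha'.trans_le hα.1
    have hα' : (α : ℂ) ≠ 0 := by exact_mod_cast hα0.ne'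
    have e1 := oscInt_zero_zero_eq L ψ hα0 y (k + 1) (deriv χ)
    rw [← intervalIntegral_eq_of_eq_zero (R := R) (by fun_prop) (div_pos h.L_pos hα0).le
      (by rw [hR]; exact div_le_div_of_nonneg_left h.L_pos.le ha' hα.1)] at e1
    · have e2 : oscInt L ψ 0 α y (k + 1) 0 (deriv χ) = oscInt L ψ 0 α y (k + 3) 0 b := by
        refine oscInt_congr _ _ _ _ _ fun p => ?_
        rw [hbe p, Complex.real_smul]; push_cast; ring
      have e3 := H 0 α y le_rfl zero_le_one hα0 (hα.2.trans ha1) hy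
      rw [← e2, e1] at e3
      simp only [mul_zero, pow_zero, one_mul, zero_mul, add_zero, norm_mul, norm_pow,
        Complex.norm_real, Real.norm_of_nonneg hα0.le] at e3
      have e4 : α ^ (k + 2) * ‖∫ s in (-R)..R, (s : ℂ) ^ (k + 1) * deriv χ (α * s) * airyExp y s‖
          ≤ α ^ (k + 2) * (C * α ^ 2) := by
        refine e3.trans (le_of_eq (by ring))
      refine (le_of_mul_le_mul_left e4 (by positivity)).trans ?_
      gcongr
      exact hα.2
    · intro s hs
      rw [hχ.deriv_eq_zero (p := α * s)]
      · simp
      · rw [abs_mul, abs_of_pos hα0]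
        rw [div_le_iff₀ hα0] at hs
        linarith
  have hmv := (convex_Icc a' a).norm_image_sub_le_of_norm_hasDerivWithin_le
    (fun α _ => (hder α).hasDerivWithinAt) hbound (left_mem_Icc.2 haa) (right_mem_Icc.2 haa)
  have ha0 := ha'.trans_le haa
  rw [h.cutoffMoment_eq hL' hχ k y ha0 (R := R)
      (by rw [hR]; exact div_le_div_of_nonneg_left h.L_pos.le ha' haa),
    h.cutoffMoment_eq hL' hχ k y ha' (R := R) le_rfl]
  refine hmv.trans ?_
  rw [Real.norm_of_nonneg (by linarith)]
  exact mul_le_of_le_one_right (by positivity) (by linarith)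

theorem tendsto_inv_succ : Tendsto (fun n : ℕ => ((n : ℝ) + 1)⁻¹) atTop (𝓝 0) := by
  simpa [one_div] using tendsto_one_div_add_atTop_nhds_zero_nat (𝕜 := ℝ)

theorem inv_succ_le_one (n : ℕ) : ((n : ℝ) + 1)⁻¹ ≤ 1 :=
  inv_le_one_of_one_le₀ (by linarith [n.cast_nonneg (α := ℝ)])

/-- The moments are Cauchy as the scale tends to 0. The limit Λ is chosen before Y, so only the
constant depends on the range of y. -/
theorem exists_moment_limit (h : CubicPhase L d ψ v) (hL' : L' < L) (hχ : IsCutoff L' χ) (k : ℕ) :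
    ∃ Λ : ℝ → ℂ, ∀ Y : ℝ, ∃ C : ℝ, 0 ≤ C ∧ ∀ a y : ℝ, 0 < a → a ≤ 1 → |y| ≤ Y →
      ‖cutoffMoment L ψ χ k y a - Λ y‖ ≤ C * a ^ 2 := by
  have hlim : ∀ y : ℝ, ∃ z : ℂ,
      Tendsto (fun n : ℕ => cutoffMoment L ψ χ k y ((n : ℝ) + 1)⁻¹) atTop (𝓝 z) := by
    intro y
    obtain ⟨C, hC, H⟩ := h.norm_cutoffMoment_sub_le hL' hχ k |y|
    refine cauchySeq_tendsto_of_complete (cauchySeq_of_le_tendsto_0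
      (fun n : ℕ => 2 * (C * (((n : ℝ) + 1)⁻¹) ^ 2)) ?_ ?_)
    · intro n m N hn hm
      have key : ∀ n, N ≤ n → ‖cutoffMoment L ψ χ k y ((N : ℝ) + 1)⁻¹
          - cutoffMoment L ψ χ k y ((n : ℝ) + 1)⁻¹‖ ≤ C * (((N : ℝ) + 1)⁻¹) ^ 2 := by
        intro n hn
        refine H _ _ y (by positivity) ?_ (inv_succ_le_one N) le_rfl
        gcongr
      have e := dist_triangle_left (cutoffMoment L ψ χ k y ((n : ℝ) + 1)⁻¹)
        (cutoffMoment L ψ χ k y ((m : ℝ) + 1)⁻¹) (cutoffMoment L ψ χ k y ((N : ℝ) + 1)⁻¹)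
      simp only [dist_eq_norm] at e ⊢
      linarith [key n hn, key m hm]
    · simpa using ((tendsto_inv_succ.pow 2).const_mul C).const_mul 2
  choose Λ hΛ using hlim
  refine ⟨Λ, fun Y => ?_⟩
  obtain ⟨C, hC, H⟩ := h.norm_cutoffMoment_sub_le hL' hχ k Y
  refine ⟨C, hC, fun a y ha ha1 hy => ?_⟩
  refine le_of_tendsto ((tendsto_const_nhds.sub (hΛ y)).norm) ?_
  filter_upwards [tendsto_inv_succ.eventually (gt_mem_nhds ha)] with n hn
  exact H a _ y (by positivity) hn.le ha1 hy

theorem tendsto_moment {k : ℕ} {Λ : ℝ → ℂ} (hΛ : ∀ Y : ℝ, ∃ C : ℝ, 0 ≤ C ∧ ∀ a y : ℝ, 0 < a →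
    a ≤ 1 → |y| ≤ Y → ‖cutoffMoment L ψ χ k y a - Λ y‖ ≤ C * a ^ 2) (y : ℝ) :
    Tendsto (cutoffMoment L ψ χ k y) (𝓝[>] 0) (𝓝 (Λ y)) := by
  obtain ⟨C, hC, H⟩ := hΛ |y|
  rw [tendsto_iff_norm_sub_tendsto_zero]
  refine squeeze_zero' (g := fun a : ℝ => C * a ^ 2) (Eventually.of_forall fun _ => norm_nonneg _)
    ?_ ?_
  · filter_upwards [Ioc_mem_nhdsGT (zero_lt_one' ℝ)] with a ha
    exact H a y ha.1 ha.2 le_rfl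
  · have : Tendsto (fun a : ℝ => C * a ^ 2) (𝓝 0) (𝓝 (C * 0 ^ 2)) :=
      (by fun_prop : Continuous fun a : ℝ => C * a ^ 2).tendsto 0
    simpa using this.mono_left nhdsWithin_le_nhds

theorem oscInt_sub (h : CubicPhase L d ψ v) {τ a y : ℝ} (h0 : 0 ≤ τ) (h1 : τ ≤ 1) (ha : 0 < a)
    (k : ℕ) {b c : ℝ → ℂ} (hb : Continuous b) (hc : Continuous c) :
    oscInt L ψ τ a y k 0 b - oscInt L ψ τ a y k 0 c =
      oscInt L ψ τ a y k 0 (fun p => b p - c p) := by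
  unfold oscInt
  rw [← intervalIntegral.integral_sub (h.intervalIntegrable h0 h1 ha k 0 hb)
    (h.intervalIntegrable h0 h1 ha k 0 hc)]
  congr 1; ext p; ring

/-- The sharply cut off Airy integrals have the same limit as the smoothly cut off ones. -/
theorem tendsto_integral_airyExp (h : CubicPhase L d ψ v) (hL' : L' < L) (hχ : IsCutoff L' χ)
    {y : ℝ} {z : ℂ} (hz : Tendsto (cutoffMoment L ψ χ 0 y) (𝓝[>] 0) (𝓝 z)) :
    Tendsto (fun R : ℝ => ∫ s in (-R)..R, airyExp y s) atTop (𝓝 z) := by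
  have hL := h.L_pos
  have h1χ : ContDiff ℝ ∞ fun p => 1 - χ p := contDiff_const.sub hχ.contDiff
  -- The difference between sharp and smooth truncation has amplitude 1 - χ = p²b. It survives at
  -- the endpoints, hence β = 1; both contributions are of order a³, and dividing by a leaves a²
  -- with a = L/R.
  obtain ⟨b, hb, -, hbe⟩ := exists_contDiff_eq_pow_smul_of_eventually_zero h1χ
    (by filter_upwards [hχ.eventually_one] with p hp; simp [hp]) 2
  obtain ⟨C, hC, H⟩ := h.norm_oscInt_le |y| hL' (β := 1) zero_le_one 2 2 0 (by omega) b hb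
    (Or.inl le_rfl)
  have hdiv : Tendsto (fun R : ℝ => L / R) atTop (𝓝[>] 0) := by
    refine tendsto_nhdsWithin_iff.2 ⟨tendsto_const_nhds.div_atTop tendsto_id, ?_⟩
    filter_upwards [eventually_gt_atTop 0] with R hR
    exact div_pos hL hR
  have hdiff : Tendsto (fun R : ℝ => (∫ s in (-R)..R, airyExp y s) - cutoffMoment L ψ χ 0 y (L / R))
      atTop (𝓝 0) := by
    rw [tendsto_zero_iff_norm_tendsto_zero]
    refine squeeze_zero' (g := fun R : ℝ => 2 * C * (L / R) ^ 2)
      (Eventually.of_forall fun _ => norm_nonneg _) ?_ ?_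
    · filter_upwards [eventually_gt_atTop 0, eventually_ge_atTop L] with R hR hRL
      have ha : 0 < L / R := div_pos hL hR
      have ha1 : L / R ≤ 1 := (div_le_one hR).2 hRL
      have ha' : ((L / R : ℝ) : ℂ) ≠ 0 := by exact_mod_cast ha.ne'
      have e1 := oscInt_zero_zero_eq L ψ ha y 0 (fun _ => 1)
      rw [show L / (L / R) = R by field_simp] at e1
      simp only [pow_zero, one_mul, zero_add, pow_one] at e1
      have e2 : (∫ s in (-R)..R, airyExp y s) - cutoffMoment L ψ χ 0 y (L / R) =
          ((L / R : ℝ) : ℂ)⁻¹ * oscInt L ψ 0 (L / R) y 2 0 b := by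
        have e3 : oscInt L ψ 0 (L / R) y 0 0 (fun p => 1 - χ p) =
            oscInt L ψ 0 (L / R) y 2 0 b := by
          refine oscInt_congr _ _ _ _ _ fun p => ?_
          rw [hbe p, Complex.real_smul]; push_cast; ring
        rw [← e3, ← h.oscInt_sub le_rfl zero_le_one ha 0 continuous_const hχ.contDiff.continuous,
          e1, mul_sub, inv_mul_cancel_left₀ ha', cutoffMoment]
        simp
      have e4 := H 0 (L / R) y le_rfl zero_le_one ha ha1 le_rfl
      rw [e2, norm_mul, norm_inv, Complex.norm_real, Real.norm_of_nonneg ha.le,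
        inv_mul_le_iff₀ ha]
      simp only [mul_zero, pow_zero, one_mul] at e4
      refine e4.trans (le_of_eq (by ring))
    · simpa using ((tendsto_nhdsWithin_iff.1 hdiv).1.pow 2).const_mul (2 * C)
  simpa using hdiff.add (hz.comp hdiv)

end CubicPhase

theorem integral_cos_eq (y R : ℝ) :
    (((1 / Real.pi) * ∫ s in (0 : ℝ)..R, Real.cos (y * s + s ^ 3 / 3) : ℝ) : ℂ) =
      (2 * Real.pi : ℂ)⁻¹ * ∫ s in (-R)..R, airyExp y s := by
  have hc := continuous_airyExp y
  have i := fun u w => hc.intervalIntegrable (μ := volume) u w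
  have hc' : Continuous fun s => airyExp y (-s) := by fun_prop
  have e1 : ∫ s in (-R)..0, airyExp y s = ∫ s in (0 : ℝ)..R, airyExp y (-s) := by
    rw [intervalIntegral.integral_comp_neg]; simp
  have hpi : (Real.pi : ℂ) ≠ 0 := by exact_mod_cast Real.pi_ne_zero
  rw [← intervalIntegral.integral_add_adjacent_intervals (i (-R) 0) (i 0 R), e1,
    ← intervalIntegral.integral_add (hc'.intervalIntegrable _ _) (i 0 R)]
  push_cast
  rw [← intervalIntegral.integral_ofReal]
  have e2 : ∀ s : ℝ, airyExp y (-s) + airyExp y s =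
      2 * ((Real.cos (y * s + s ^ 3 / 3) : ℝ) : ℂ) := by
    intro s
    rw [airyExp, airyExp, Complex.ofReal_cos, Complex.cos]
    push_cast
    rw [show ((y : ℂ) * -s + (-s) ^ 3 / 3) * Complex.I
      = -((y * s + (s : ℂ) ^ 3 / 3)) * Complex.I by ring]
    ring
  simp only [e2]
  rw [intervalIntegral.integral_const_mul]
  field_simp

/-- Ai is known through a complex limit; this reads the real derivative `airyAiDeriv` off the
complex formula. -/
theorem HasDerivAt.ofReal_deriv_eq {f : ℝ → ℝ} {w : ℂ} {x : ℝ}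
    (h : HasDerivAt (fun y => (f y : ℂ)) w x) : ((deriv f x : ℝ) : ℂ) = w := by
  have h1 : HasDerivAt f w.re x := by
    have := Complex.reCLM.hasFDerivAt.comp_hasDerivAt x h
    simpa [Function.comp_def] using! this
  rw [h1.deriv]
  exact h1.ofReal_comp.unique h

namespace CubicPhase

variable {L d L' : ℝ} {ψ v : ℝ → ℝ} {χ : ℝ → ℂ}

theorem hasDerivAt_cutoffMoment_zero (h : CubicPhase L d ψ v) (hχ : IsCutoff L' χ) {a : ℝ}
    (ha : 0 < a) (y : ℝ) :
    HasDerivAt (fun y => cutoffMoment L ψ χ 0 y a)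
      (Complex.I * cutoffMoment L ψ χ 1 y a) y := by
  have hc := hχ.contDiff.continuous
  have hψ := h.contDiff.continuous
  have ha' : (a : ℂ) ≠ 0 := by exact_mod_cast ha.ne'
  have key := hasDerivAt_intervalIntegral_param (a := -L) (b := L)
    (F := fun y p : ℝ => (p : ℂ) ^ 0 * χ p * osc ψ 0 a y p)
    (F' := fun y p : ℝ => Complex.I / a * ((p : ℂ) ^ 1 * χ p * osc ψ 0 a y p)) ?_ ?_ ?_ y
  · rw [intervalIntegral.integral_const_mul] at key
    simp only [← oscInt_zero] at key
    refine HasDerivAt.congr_deriv (key.const_mul (((a : ℂ) ^ (0 + 1))⁻¹)) ?_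
    rw [cutoffMoment]
    field_simp
    ring
  · intro y
    have := h.continuous_osc 0 a y
    fun_prop
  · simp only [Function.uncurry_def, osc, phase]
    fun_prop
  · intro y p
    have h1 : HasDerivAt (fun y => (a ^ 2 * y * p + phase ψ 0 p) / a ^ 3) (p / a) y := by
      have := (((hasDerivAt_id y).const_mul (a ^ 2)).mul_const p |>.add_const (phase ψ 0 p)
        |>.div_const (a ^ 3))
      refine HasDerivAt.congr_deriv this ?_
      field_simp
    have := ((h1.ofReal_comp.mul_const Complex.I).cexp).const_mul ((p : ℂ) ^ 0 * χ p)
    refine HasDerivAt.congr_deriv this ?_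
    simp only [osc]
    push_cast
    ring

/-- The smoothly cut off oscillatory integrals in terms of the Airy function. -/
theorem norm_oscInt_sub_airy_le (h : CubicPhase L d ψ v) (hL' : L' < L) (hχ : IsCutoff L' χ)
    (Y : ℝ) : ∃ C : ℝ, 0 ≤ C ∧ ∀ a y : ℝ, 0 < a → a ≤ 1 → |y| ≤ Y →
      ‖oscInt L ψ 0 a y 0 0 χ - 2 * Real.pi * a * airyAi y‖ ≤ C * a ^ 3 ∧
      ‖oscInt L ψ 0 a y 1 0 χ + 2 * Real.pi * Complex.I * a ^ 2 * airyAiDeriv y‖ ≤ C * a ^ 3 := by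
  obtain ⟨Λ₀, hΛ₀⟩ := h.exists_moment_limit hL' hχ 0
  obtain ⟨Λ₁, hΛ₁⟩ := h.exists_moment_limit hL' hχ 1
  have hpi : (Real.pi : ℂ) ≠ 0 := by exact_mod_cast Real.pi_ne_zero
  have hAi : ∀ y, (airyAi y : ℂ) = (2 * Real.pi : ℂ)⁻¹ * Λ₀ y := by
    intro y
    have t := (h.tendsto_integral_airyExp hL' hχ (tendsto_moment hΛ₀ y)).const_mul
      ((2 * Real.pi : ℂ)⁻¹)
    simp only [← integral_cos_eq] at t
    have t2 := Complex.continuous_re.continuousAt.tendsto.comp t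
    simp only [Function.comp_def, Complex.ofReal_re] at t2
    rw [airyAi, t2.limUnder_eq]
    exact tendsto_nhds_unique (Complex.continuous_ofReal.continuousAt.tendsto.comp t2) t
  have hder : ∀ y, HasDerivAt Λ₀ (Complex.I * Λ₁ y) y := by
    intro y
    -- The differentiated moments converge uniformly on the unit ball about y, where |w| ≤ |y| + 1;
    -- hence limit and derivative commute.
    obtain ⟨C, hC, H⟩ := hΛ₁ (|y| + 1)
    refine hasDerivAt_of_tendstoUniformlyOn (l := atTop) (Metric.isOpen_ball (x := y) (ε := 1))
      (f := fun n : ℕ => fun y => cutoffMoment L ψ χ 0 y ((n : ℝ) + 1)⁻¹)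
      (f' := fun n : ℕ => fun y => Complex.I * cutoffMoment L ψ χ 1 y ((n : ℝ) + 1)⁻¹)
      (g' := fun y => Complex.I * Λ₁ y) ?_ ?_ ?_ (Metric.mem_ball_self one_pos)
    · rw [Metric.tendstoUniformlyOn_iff]
      intro ε hε
      have : Tendsto (fun n : ℕ => C * (((n : ℝ) + 1)⁻¹) ^ 2) atTop (𝓝 0) := by
        simpa using (tendsto_inv_succ.pow 2).const_mul C
      filter_upwards [this.eventually (gt_mem_nhds hε)] with n hn w hw
      rw [dist_comm, dist_eq_norm, ← mul_sub, norm_mul, Complex.norm_I, one_mul]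
      refine (H _ w (by positivity) (inv_succ_le_one n) ?_).trans_lt hn
      rw [Metric.mem_ball, Real.dist_eq] at hw
      linarith [abs_sub_abs_le_abs_sub w y]
    · exact Eventually.of_forall fun n w _ =>
        h.hasDerivAt_cutoffMoment_zero hχ (by positivity) w
    · intro w _
      refine (tendsto_moment hΛ₀ w).comp (tendsto_nhdsWithin_iff.2 ⟨tendsto_inv_succ, ?_⟩)
      exact Eventually.of_forall fun n => (by positivity : (0 : ℝ) < ((n : ℝ) + 1)⁻¹)
  have hAi' : ∀ y, (airyAiDeriv y : ℂ) = (2 * Real.pi : ℂ)⁻¹ * (Complex.I * Λ₁ y) := by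
    intro y
    refine HasDerivAt.ofReal_deriv_eq ?_
    simp only [hAi]
    exact (hder y).const_mul _
  obtain ⟨C₀, hC₀, H₀⟩ := hΛ₀ Y
  obtain ⟨C₁, hC₁, H₁⟩ := hΛ₁ Y
  refine ⟨C₀ + C₁, by positivity, fun a y ha ha1 hy => ⟨?_, ?_⟩⟩
  · have ha' : (a : ℂ) ≠ 0 := by exact_mod_cast ha.ne'
    have e : oscInt L ψ 0 a y 0 0 χ - 2 * Real.pi * a * airyAi y =
        a * (cutoffMoment L ψ χ 0 y a - Λ₀ y) := by
      rw [hAi, cutoffMoment]; field_simp; ring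
    rw [e, norm_mul, Complex.norm_real, Real.norm_of_nonneg ha.le]
    calc a * ‖cutoffMoment L ψ χ 0 y a - Λ₀ y‖ ≤ a * (C₀ * a ^ 2) := by
          gcongr; exact H₀ a y ha ha1 hy
      _ = C₀ * a ^ 3 := by ring
      _ ≤ _ := by gcongr; linarith
  · have ha' : (a : ℂ) ≠ 0 := by exact_mod_cast ha.ne'
    have e : oscInt L ψ 0 a y 1 0 χ + 2 * Real.pi * Complex.I * a ^ 2 * airyAiDeriv y =
        a ^ 2 * (cutoffMoment L ψ χ 1 y a - Λ₁ y) := by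
      rw [hAi', cutoffMoment]; field_simp; rw [Complex.I_sq]; ring
    rw [e, norm_mul, norm_pow, Complex.norm_real, Real.norm_of_nonneg ha.le]
    calc a ^ 2 * ‖cutoffMoment L ψ χ 1 y a - Λ₁ y‖ ≤ a ^ 2 * (C₁ * a ^ 2) := by
          gcongr; exact H₁ a y ha ha1 hy
      _ = C₁ * a ^ 4 := by ring
      _ ≤ C₁ * a ^ 3 := mul_le_mul_of_nonneg_left
        (pow_le_pow_of_le_one ha.le ha1 (by norm_num)) hC₁
      _ ≤ _ := by gcongr; linarith

end CubicPhase

/-! ### Airy asymptotics for general amplitude and phase. -/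

theorem eq_deriv_zero_of_eq_add_smul {E : Type*} [NormedAddCommGroup E] [NormedSpace ℝ E]
    {f g : ℝ → E} (hg : ContDiff ℝ ∞ g) (h : ∀ p, f p = f 0 + p • g p) : g 0 = deriv f 0 := by
  have h1 := ((contDiff_infty_iff_deriv.1 hg).1 0).hasDerivAt
  have h2 := ((hasDerivAt_id (0 : ℝ)).smul h1).const_add (f 0)
  have h3 := h2.congr_of_eventuallyEq (f₁ := f) (Eventually.of_forall h)
  rw [h3.deriv]
  simp

namespace CubicPhase

variable {L d L' : ℝ} {ψ v : ℝ → ℝ} {χ : ℝ → ℂ}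

/-- The phase is affine in τ with slope ψ - p³/3 = p⁵e, which the exponential divides by a³. -/
theorem hasDerivAt_oscInt_param (h : CubicPhase L d ψ v) {e : ℝ → ℝ}
    (he : ∀ p, ψ p = p ^ 3 / 3 + p ^ 5 * e p) (hec : Continuous e) {m : ℝ → ℂ}
    (hm : Continuous m) (a y τ : ℝ) :
    HasDerivAt (fun τ => oscInt L ψ τ a y 0 0 m)
      (Complex.I / (a : ℂ) ^ 3 * oscInt L ψ τ a y 5 0 (fun p => m p * e p)) τ := by
  have hψ := h.contDiff.continuous
  have key := hasDerivAt_intervalIntegral_param (a := -L) (b := L)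
    (F := fun τ p : ℝ => (p : ℂ) ^ 0 * m p * osc ψ τ a y p)
    (F' := fun τ p : ℝ => Complex.I / (a : ℂ) ^ 3 *
      ((p : ℂ) ^ 5 * (m p * e p) * osc ψ τ a y p)) ?_ ?_ ?_ τ
  · rw [intervalIntegral.integral_const_mul] at key
    simp only [oscInt_zero]
    exact key
  · intro τ
    have := h.continuous_osc τ a y
    fun_prop
  · simp only [Function.uncurry_def, osc, phase]
    fun_prop
  · intro τ p
    have h1 : HasDerivAt (fun τ => (a ^ 2 * y * p + phase ψ τ p) / a ^ 3) (p ^ 5 * e p / a ^ 3) τ := by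
      have := ((((hasDerivAt_id τ).const_sub 1).mul_const (p ^ 3 / 3)).add
        ((hasDerivAt_id τ).mul_const (ψ p))).const_add (a ^ 2 * y * p) |>.div_const (a ^ 3)
      refine HasDerivAt.congr_deriv this ?_
      rw [he p]; ring
    have := ((h1.ofReal_comp.mul_const Complex.I).cexp).const_mul ((p : ℂ) ^ 0 * m p)
    refine HasDerivAt.congr_deriv this ?_
    simp only [osc]
    push_cast
    ring

/-- The Airy asymptotics of an oscillatory integral with a cubically degenerate phase. -/
theorem norm_oscInt_sub_airy_combination_le (h : CubicPhase L d ψ v) {e : ℝ → ℝ}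
    (hec : ContDiff ℝ ∞ e) (he : ∀ p, ψ p = p ^ 3 / 3 + p ^ 5 * e p) {F : ℝ → ℂ}
    (hF : ContDiff ℝ ∞ F) (Y : ℝ) : ∃ C : ℝ, 0 ≤ C ∧ ∀ a y : ℝ, 0 < a → a ≤ 1 → |y| ≤ Y →
      ‖oscInt L ψ 1 a y 0 0 F
        - 2 * Real.pi * (a * F 0 * airyAi y - Complex.I * a ^ 2 * deriv F 0 * airyAiDeriv y)‖
        ≤ C * a ^ 3 := by
  have hL := h.L_pos
  have hL' : L / 2 < L := by linarith
  obtain ⟨χ, hχ⟩ := exists_isCutoff (half_pos hL)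
  obtain ⟨g, hg, hFg⟩ := exists_contDiff_eq_add_smul hF
  obtain ⟨g₂, hg₂, hgg⟩ := exists_contDiff_eq_add_smul hg
  have hg0 := eq_deriv_zero_of_eq_add_smul hg hFg
  obtain ⟨w, hw, -, hwe⟩ := exists_contDiff_eq_pow_smul_of_eventually_zero
    (contDiff_const.sub hχ.contDiff : ContDiff ℝ ∞ fun p => 1 - χ p)
    (by filter_upwards [hχ.eventually_one] with p hp; simp [hp]) 2
  set F₁ := deriv F 0 with hF₁
  have hof : ContDiff ℝ ∞ (fun p : ℝ => (p : ℂ)) := Complex.ofRealCLM.contDiff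
  have hlin : ContDiff ℝ ∞ fun p : ℝ => F 0 + (p : ℂ) * F₁ :=
    contDiff_const.add (hof.mul contDiff_const)
  have hm : ContDiff ℝ ∞ fun p : ℝ => χ p * (F 0 + (p : ℂ) * F₁) := hχ.contDiff.mul hlin
  -- This amplitude times p² is F - χ(F(0) + pF'(0)): the second order Taylor remainder plus what
  -- the cutoff removes.
  obtain ⟨C₁, hC₁, H₁⟩ := h.norm_oscInt_le Y hL' (β := 1) zero_le_one 2 2 0 (by omega)
    (fun p => g₂ p + w p * (F 0 + (p : ℂ) * F₁)) (hg₂.add (hw.mul hlin)) (Or.inl le_rfl)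
  -- Weight p⁵ gives a⁶, hence a³ after the factor a⁻³. An endpoint term of order a³ would leave
  -- only O(1), so the cutoff and β = 0 are essential here.
  obtain ⟨C₂, hC₂, H₂⟩ := h.norm_oscInt_le Y hL' (β := 0) le_rfl 4 5 0 (by omega)
    (fun p => χ p * (F 0 + (p : ℂ) * F₁) * e p) (hm.mul (Complex.ofRealCLM.contDiff.comp hec))
    (Or.inr fun p hp => by simp [hχ.eq_zero p hp])
  obtain ⟨C₃, hC₃, H₃⟩ := h.norm_oscInt_sub_airy_le hL' hχ Y
  refine ⟨2 * C₁ + C₂ + (‖F 0‖ + ‖F₁‖) * C₃, by positivity, fun a y ha ha1 hy => ?_⟩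
  have ha' : (a : ℂ) ≠ 0 := by exact_mod_cast ha.ne'
  have s1 : ‖oscInt L ψ 1 a y 0 0 F
      - oscInt L ψ 1 a y 0 0 (fun p => χ p * (F 0 + (p : ℂ) * F₁))‖ ≤ 2 * C₁ * a ^ 3 := by
    rw [h.oscInt_sub zero_le_one le_rfl ha 0 hF.continuous hm.continuous,
      oscInt_congr (l := 2) (c := fun p => g₂ p + w p * (F 0 + (p : ℂ) * F₁))]
    · have := H₁ 1 a y zero_le_one le_rfl ha ha1 hy
      simp only [mul_zero, pow_zero, one_mul] at this
      exact this.trans (le_of_eq (by ring))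
    · intro p
      have q1 := hFg p
      have q2 := hgg p
      have q3 := hwe p
      simp only [Complex.real_smul, Complex.ofReal_pow, hg0] at q1 q2 q3
      rw [q2] at q1
      linear_combination q1 + (F 0 + (p : ℂ) * F₁) * q3
  have s2 : ‖oscInt L ψ 1 a y 0 0 (fun p => χ p * (F 0 + (p : ℂ) * F₁))
      - oscInt L ψ 0 a y 0 0 (fun p => χ p * (F 0 + (p : ℂ) * F₁))‖ ≤ C₂ * a ^ 3 := by
    have := (convex_Icc (0 : ℝ) 1).norm_image_sub_le_of_norm_hasDerivWithin_le
      (f := fun τ => oscInt L ψ τ a y 0 0 (fun p => χ p * (F 0 + (p : ℂ) * F₁)))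
      (C := C₂ * a ^ 3) (fun τ _ => (h.hasDerivAt_oscInt_param he hec.continuous hm.continuous
        a y τ).hasDerivWithinAt) ?_ (left_mem_Icc.2 zero_le_one) (right_mem_Icc.2 zero_le_one)
    · simpa using this
    · intro τ hτ
      have := H₂ τ a y hτ.1 hτ.2 ha ha1 hy
      simp only [mul_zero, pow_zero, one_mul, zero_mul, add_zero] at this
      rw [norm_mul, norm_div, Complex.norm_I, norm_pow, Complex.norm_real,
        Real.norm_of_nonneg ha.le, one_div, inv_mul_le_iff₀ (by positivity)]
      exact this.trans (le_of_eq (by ring))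
  have s3 : oscInt L ψ 0 a y 0 0 (fun p => χ p * (F 0 + (p : ℂ) * F₁)) =
      F 0 * oscInt L ψ 0 a y 0 0 χ + F₁ * oscInt L ψ 0 a y 1 0 χ := by
    have i0 := h.intervalIntegrable (y := y) le_rfl zero_le_one ha 0 0 hχ.contDiff.continuous
    have i1 := h.intervalIntegrable (y := y) le_rfl zero_le_one ha 1 0 hχ.contDiff.continuous
    unfold oscInt
    rw [← intervalIntegral.integral_const_mul, ← intervalIntegral.integral_const_mul,
      ← intervalIntegral.integral_add (i0.const_mul _) (i1.const_mul _)]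
    congr 1; ext p; ring
  obtain ⟨k0, k1⟩ := H₃ a y ha ha1 hy
  calc ‖oscInt L ψ 1 a y 0 0 F
        - 2 * Real.pi * (a * F 0 * airyAi y - Complex.I * a ^ 2 * F₁ * airyAiDeriv y)‖
      = ‖(oscInt L ψ 1 a y 0 0 F
          - oscInt L ψ 1 a y 0 0 (fun p => χ p * (F 0 + (p : ℂ) * F₁)))
        + (oscInt L ψ 1 a y 0 0 (fun p => χ p * (F 0 + (p : ℂ) * F₁))
          - oscInt L ψ 0 a y 0 0 (fun p => χ p * (F 0 + (p : ℂ) * F₁)))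
        + (F 0 * (oscInt L ψ 0 a y 0 0 χ - 2 * Real.pi * a * airyAi y)
          + F₁ * (oscInt L ψ 0 a y 1 0 χ
            + 2 * Real.pi * Complex.I * a ^ 2 * airyAiDeriv y))‖ := by
        congr 1; rw [s3]; ring
    _ ≤ 2 * C₁ * a ^ 3 + C₂ * a ^ 3 + (‖F 0‖ * (C₃ * a ^ 3) + ‖F₁‖ * (C₃ * a ^ 3)) := by
        refine norm_add₃_le.trans (add_le_add (add_le_add s1 s2) ((norm_add_le _ _).trans ?_))
        rw [norm_mul, norm_mul]
        gcongr
    _ = _ := by ring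

end CubicPhase

/-- The comparison with cut off integrals at the fixed scale a = 1, with the model phase p³/3,
already bounds both functions on compact sets. -/
theorem exists_airy_bound (Y : ℝ) : ∃ B : ℝ, 0 ≤ B ∧ ∀ y : ℝ, |y| ≤ Y →
    |airyAi y| ≤ B ∧ |airyAiDeriv y| ≤ B := by
  have h : CubicPhase 1 1 (fun p => p ^ 3 / 3) (fun _ => 2) := by
    have hd : deriv (fun p : ℝ => p ^ 3 / 3) = fun p => p ^ 2 := by
      ext p
      have := ((hasDerivAt_id p).pow 3).div_const 3
      refine (HasDerivAt.congr_deriv this ?_ : HasDerivAt (fun p : ℝ => p ^ 3 / 3) _ p).deriv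
      simp
    refine ⟨one_pos, one_pos, le_rfl, by fun_prop, by fun_prop, fun p => ?_, fun p _ => ?_⟩
    · rw [hd]; simp; ring
    · rw [hd]; simp
  obtain ⟨χ, hχ⟩ := exists_isCutoff (half_pos (zero_lt_one' ℝ))
  obtain ⟨C, hC, H⟩ := h.norm_oscInt_sub_airy_le (by norm_num) hχ Y
  obtain ⟨C₀, hC₀, H₀⟩ := h.norm_oscInt_le Y (L' := 1 / 2) (by norm_num) (β := 0) le_rfl 2 0 0
    (by omega) χ hχ.contDiff (Or.inr hχ.eq_zero)
  obtain ⟨C₁, hC₁, H₁⟩ := h.norm_oscInt_le Y (L' := 1 / 2) (by norm_num) (β := 0) le_rfl 2 1 0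
    (by omega) χ hχ.contDiff (Or.inr hχ.eq_zero)
  refine ⟨C + C₀ + C₁, by positivity, fun y hy => ?_⟩
  obtain ⟨k0, k1⟩ := H 1 y one_pos le_rfl hy
  have b0 := H₀ 0 1 y le_rfl zero_le_one one_pos le_rfl hy
  have b1 := H₁ 0 1 y le_rfl zero_le_one one_pos le_rfl hy
  simp only [one_pow, mul_one, one_mul, add_zero] at b0 b1
  simp only [Complex.ofReal_one, mul_one, one_pow] at k0 k1
  have hpi : (1 : ℝ) ≤ 2 * Real.pi := by linarith [Real.pi_gt_three]
  have n0 : ‖(2 * Real.pi : ℂ) * airyAi y‖ = 2 * Real.pi * |airyAi y| := by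
    simp [abs_of_pos Real.pi_pos]
  have n1 : ‖(2 * Real.pi : ℂ) * Complex.I * airyAiDeriv y‖ = 2 * Real.pi * |airyAiDeriv y| := by
    simp [abs_of_pos Real.pi_pos]
  constructor
  · have := norm_sub_norm_le ((2 * Real.pi : ℂ) * airyAi y)
      (oscInt 1 (fun p => p ^ 3 / 3) 0 1 y 0 0 χ)
    rw [norm_sub_rev, n0] at this
    have := le_mul_of_one_le_left (abs_nonneg (airyAi y)) hpi
    linarith
  · have := norm_sub_le (oscInt 1 (fun p => p ^ 3 / 3) 0 1 y 1 0 χ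
      + (2 * Real.pi : ℂ) * Complex.I * airyAiDeriv y) (oscInt 1 (fun p => p ^ 3 / 3) 0 1 y 1 0 χ)
    rw [add_sub_cancel_left, n1] at this
    have := le_mul_of_one_le_left (abs_nonneg (airyAiDeriv y)) hpi
    linarith

/-! ### Taylor quotients of odd and even functions. -/

/-- Lets parity pass from a function to its Hadamard quotients: the identity is cancelled away from
0 and extended by density. -/
theorem eq_of_mul_left_of_continuous {f g : ℝ → ℝ} (hf : Continuous f) (hg : Continuous g)
    (h : ∀ p, p * f p = p * g p) (p : ℝ) : f p = g p := by
  have hd : Dense ({0}ᶜ : Set ℝ) := dense_compl_singleton 0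
  refine congrFun (Continuous.ext_on hd hf hg fun p hp => ?_) p
  exact mul_left_cancel₀ hp (h p)

/-- A smooth odd function with vanishing derivative at `0` is `p³` times a smooth even function. -/
theorem exists_eq_cube_mul {ψ : ℝ → ℝ} (hψ : ContDiff ℝ ∞ ψ) (hodd : ∀ p, ψ (-p) = -ψ p)
    (h0 : deriv ψ 0 = 0) :
    ∃ w : ℝ → ℝ, ContDiff ℝ ∞ w ∧ (∀ p, w (-p) = w p) ∧ ∀ p, ψ p = p ^ 3 * w p := by
  have hz : ψ 0 = 0 := by have := hodd 0; simp at this; linarith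
  obtain ⟨f, hf, e1⟩ := exists_contDiff_eq_add_smul hψ
  have hf0 : f 0 = 0 := (eq_deriv_zero_of_eq_add_smul hf e1).trans h0
  obtain ⟨g, hg, e2⟩ := exists_contDiff_eq_add_smul hf
  obtain ⟨w, hw, e3⟩ := exists_contDiff_eq_add_smul hg
  simp only [hz, hf0, smul_eq_mul, zero_add] at e1 e2 e3
  have cf := hf.continuous
  have cg := hg.continuous
  have cw := hw.continuous
  have f_even : ∀ p, f (-p) = f p := eq_of_mul_left_of_continuous (by fun_prop) cf fun p => by
    have := hodd p; rw [e1 (-p), e1 p] at this; linarith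
  have g_odd : ∀ p, g (-p) = -g p := eq_of_mul_left_of_continuous (by fun_prop) (by fun_prop)
    fun p => by have := f_even p; rw [e2 (-p), e2 p] at this; linarith
  have hg0 : g 0 = 0 := by have := g_odd 0; simp at this; linarith
  simp only [hg0, zero_add] at e3
  have w_even : ∀ p, w (-p) = w p := eq_of_mul_left_of_continuous (by fun_prop) cw fun p => by
    have := g_odd p; rw [e3 (-p), e3 p] at this; linarith
  refine ⟨w, hw, w_even, fun p => ?_⟩
  rw [e1 p, e2 p, e3 p]; ring

theorem exists_eq_add_sq_mul {w : ℝ → ℝ} (hw : ContDiff ℝ ∞ w) (heven : ∀ p, w (-p) = w p) :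
    ∃ e : ℝ → ℝ, ContDiff ℝ ∞ e ∧ ∀ p, w p = w 0 + p ^ 2 * e p := by
  obtain ⟨f, hf, e1⟩ := exists_contDiff_eq_add_smul hw
  obtain ⟨e, he, e2⟩ := exists_contDiff_eq_add_smul hf
  have cf := hf.continuous
  simp only [smul_eq_mul] at e1 e2
  have f_odd : ∀ p, f (-p) = -f p := eq_of_mul_left_of_continuous (by fun_prop) (by fun_prop)
    fun p => by have := heven p; rw [e1 (-p), e1 p] at this; linarith
  have hf0 : f 0 = 0 := by have := f_odd 0; simp at this; linarith
  refine ⟨e, he, fun p => ?_⟩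
  rw [e1 p, e2 p, hf0]; ring

theorem exists_deriv_deriv_eq {ψ w : ℝ → ℝ} (hw : ContDiff ℝ ∞ w) (h : ∀ p, ψ p = p ^ 3 * w p) :
    ∃ v : ℝ → ℝ, ContDiff ℝ ∞ v ∧ ∀ p, deriv (deriv ψ) p = p * v p := by
  have hw1 := contDiff_infty_iff_deriv.1 hw
  have hw2 := contDiff_infty_iff_deriv.1 hw1.2
  have d1 : deriv ψ = fun p => 3 * p ^ 2 * w p + p ^ 3 * deriv w p := by
    ext p
    rw [show ψ = fun p => p ^ 3 * w p from funext h]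
    have := ((hasDerivAt_id p).pow 3).mul (hw1.1 p).hasDerivAt
    refine (HasDerivAt.congr_deriv this ?_ : HasDerivAt (fun p => p ^ 3 * w p) _ p).deriv
    simp
  refine ⟨fun p => 6 * w p + 6 * p * deriv w p + p ^ 2 * deriv (deriv w) p, ?_, fun p => ?_⟩
  · have a1 := hw1.2
    have a2 := hw2.2
    fun_prop
  · rw [d1]
    have := ((((hasDerivAt_id p).pow 2).const_mul 3).mul (hw1.1 p).hasDerivAt).add
      (((hasDerivAt_id p).pow 3).mul (hw2.1 p).hasDerivAt)
    refine (HasDerivAt.congr_deriv this ?_ :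
      HasDerivAt (fun p => 3 * p ^ 2 * w p + p ^ 3 * deriv w p) _ p).deriv.trans rfl
    simp
    ring

/-- The value 1/6 feeds the comparison of p⁴ coefficients that identifies q. -/
theorem exists_sin_eq : ∃ u : ℝ → ℝ, Continuous u ∧ u 0 = 1 / 6 ∧
    ∀ p, Real.sin p = p - p ^ 3 * u p := by
  have hc : ContDiff ℝ ∞ fun p => p - Real.sin p := contDiff_id.sub Real.contDiff_sin
  obtain ⟨u, hu, -, he⟩ := exists_eq_cube_mul hc (fun p => by simp; ring) (by
    have := (hasDerivAt_id (0 : ℝ)).sub (Real.hasDerivAt_sin 0)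
    exact (HasDerivAt.congr_deriv this (by simp) :
      HasDerivAt (fun p => p - Real.sin p) 0 0).deriv)
  refine ⟨u, hu.continuous, ?_, fun p => by linarith [he p]⟩
  have t1 : Tendsto u (𝓝[≠] 0) (𝓝 (u 0)) := hu.continuous.continuousAt.mono_left nhdsWithin_le_nhds
  have t2 : Tendsto u (𝓝[≠] 0) (𝓝 (1 / 6)) := by
    rw [tendsto_iff_norm_sub_tendsto_zero]
    refine squeeze_zero' (g := fun p => |p| ^ 2 * (1 / 100)) (Eventually.of_forall fun _ => norm_nonneg _)
      ?_ ?_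
    · have hmem : Ioo (-1 : ℝ) 1 ∈ 𝓝[≠] (0 : ℝ) :=
        nhdsWithin_le_nhds (Ioo_mem_nhds (by norm_num) (by norm_num))
      filter_upwards [hmem, self_mem_nhdsWithin] with p hp hp0
      have hb := Real.sin_bound (abs_le.2 ⟨hp.1.le, hp.2.le⟩)
      have hp3 : 0 < |p| ^ 3 := pow_pos (abs_pos.2 hp0) 3
      rw [show Real.sin p - (p - p ^ 3 / 6) = -(p ^ 3 * (u p - 1 / 6)) by linarith [he p],
        abs_neg, abs_mul, abs_pow] at hb
      rw [Real.norm_eq_abs]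
      refine le_of_mul_le_mul_left (hb.trans (le_of_eq ?_)) hp3
      ring
    · have : Tendsto (fun p : ℝ => |p| ^ 2 * (1 / 100)) (𝓝 0) (𝓝 (|0| ^ 2 * (1 / 100))) :=
        (by fun_prop : Continuous fun p : ℝ => |p| ^ 2 * (1 / 100)).tendsto 0
      simpa using this.mono_left nhdsWithin_le_nhds
  exact tendsto_nhds_unique t1 t2

/-! ### The acoustic dispersion relation. -/

/-- The odd smooth branch of the acoustic frequency: `ω₁ = |dispersion|`. -/
def dispersion (γ₁ γ₂ p : ℝ) : ℝ :=
  (Real.sqrt (γ₁ + γ₂ + 2 * Real.sqrt (γ₁ * γ₂) * Real.sin p)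
    - Real.sqrt (γ₁ + γ₂ - 2 * Real.sqrt (γ₁ * γ₂) * Real.sin p)) / Real.sqrt 2

section Dispersion

variable {γ₁ γ₂ : ℝ}

/-- Strict since γ₁ ≠ γ₂. It keeps both radicands of `dispersion` positive, so Ω is smooth on the
whole line, the band edge included. -/
theorem two_sqrt_lt (hγ₁ : 0 < γ₁) (hγ : γ₁ < γ₂) : 2 * Real.sqrt (γ₁ * γ₂) < γ₁ + γ₂ := by
  have h : 0 < γ₁ * γ₂ := mul_pos hγ₁ (hγ₁.trans hγ)
  have := Real.sq_sqrt h.le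
  nlinarith [Real.sqrt_nonneg (γ₁ * γ₂), sq_pos_of_pos (sub_pos.2 hγ)]

theorem abs_two_sqrt_mul_sin_lt (hγ₁ : 0 < γ₁) (hγ : γ₁ < γ₂) (p : ℝ) :
    |2 * Real.sqrt (γ₁ * γ₂) * Real.sin p| < γ₁ + γ₂ := by
  rw [abs_mul, abs_of_nonneg (by positivity : 0 ≤ 2 * Real.sqrt (γ₁ * γ₂))]
  refine lt_of_le_of_lt ?_ (two_sqrt_lt hγ₁ hγ)
  exact mul_le_of_le_one_right (by positivity) (Real.abs_sin_le_one p)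

theorem radicand_add_pos (hγ₁ : 0 < γ₁) (hγ : γ₁ < γ₂) (p : ℝ) :
    0 < γ₁ + γ₂ + 2 * Real.sqrt (γ₁ * γ₂) * Real.sin p := by
  linarith [(abs_lt.1 (abs_two_sqrt_mul_sin_lt hγ₁ hγ p)).1]

theorem radicand_sub_pos (hγ₁ : 0 < γ₁) (hγ : γ₁ < γ₂) (p : ℝ) :
    0 < γ₁ + γ₂ - 2 * Real.sqrt (γ₁ * γ₂) * Real.sin p := by
  linarith [(abs_lt.1 (abs_two_sqrt_mul_sin_lt hγ₁ hγ p)).2]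

theorem contDiff_dispersion (hγ₁ : 0 < γ₁) (hγ : γ₁ < γ₂) : ContDiff ℝ ∞ (dispersion γ₁ γ₂) := by
  have hs : ContDiff ℝ ∞ Real.sin := Real.contDiff_sin
  unfold dispersion
  refine ContDiff.div_const (ContDiff.sub (ContDiff.sqrt ?_ fun p => ?_)
    (ContDiff.sqrt ?_ fun p => ?_)) _
  · exact contDiff_const.add (contDiff_const.mul hs)
  · exact (radicand_add_pos hγ₁ hγ p).ne'
  · exact contDiff_const.sub (contDiff_const.mul hs)
  · exact (radicand_sub_pos hγ₁ hγ p).ne'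

theorem dispersion_neg (p : ℝ) : dispersion γ₁ γ₂ (-p) = -dispersion γ₁ γ₂ p := by
  simp only [dispersion, Real.sin_neg, mul_neg, sub_neg_eq_add, ← sub_eq_add_neg]
  ring

/-- C(2p)² = (γ₁+γ₂)² - 4γ₁γ₂ sin² p is a difference of squares. This makes γ₁ + γ₂ - C(2p) half a
perfect square and so resolves the corner of ω₁. -/
theorem Cfun_two_mul (hγ₁ : 0 < γ₁) (hγ : γ₁ < γ₂) (p : ℝ) :
    Cfun γ₁ γ₂ (2 * p) = Real.sqrt (γ₁ + γ₂ + 2 * Real.sqrt (γ₁ * γ₂) * Real.sin p) *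
      Real.sqrt (γ₁ + γ₂ - 2 * Real.sqrt (γ₁ * γ₂) * Real.sin p) := by
  rw [← Real.sqrt_mul (radicand_add_pos hγ₁ hγ p).le, Cfun]
  congr 1
  have h := Real.sq_sqrt (mul_pos hγ₁ (hγ₁.trans hγ)).le
  rw [Real.cos_two_mul]
  have := Real.sin_sq_add_cos_sq p
  linear_combination (4 * γ₁ * γ₂) * this + 4 * Real.sin p ^ 2 * h

theorem dispersion_sq (hγ₁ : 0 < γ₁) (hγ : γ₁ < γ₂) (p : ℝ) :
    dispersion γ₁ γ₂ p ^ 2 = γ₁ + γ₂ - Cfun γ₁ γ₂ (2 * p) := by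
  rw [Cfun_two_mul hγ₁ hγ, dispersion, div_pow, Real.sq_sqrt zero_le_two]
  have h1 := Real.sq_sqrt (radicand_add_pos hγ₁ hγ p).le
  have h2 := Real.sq_sqrt (radicand_sub_pos hγ₁ hγ p).le
  linear_combination (h1 + h2) / 2

theorem omega1_eq_abs (hγ₁ : 0 < γ₁) (hγ : γ₁ < γ₂) (p : ℝ) :
    omega1 γ₁ γ₂ p = |dispersion γ₁ γ₂ p| := by
  rw [omega1, ← dispersion_sq hγ₁ hγ, Real.sqrt_sq_eq_abs]

theorem dispersion_nonneg {p : ℝ} (h0 : 0 ≤ p) (h1 : p ≤ Real.pi / 2) :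
    0 ≤ dispersion γ₁ γ₂ p := by
  have hs : 0 ≤ Real.sin p := Real.sin_nonneg_of_nonneg_of_le_pi h0 (by linarith)
  have : 0 ≤ 2 * Real.sqrt (γ₁ * γ₂) * Real.sin p := by positivity
  refine div_nonneg (sub_nonneg.2 (Real.sqrt_le_sqrt ?_)) (Real.sqrt_nonneg _)
  linarith

theorem omega1_of_nonneg (hγ₁ : 0 < γ₁) (hγ : γ₁ < γ₂) {p : ℝ} (h0 : 0 ≤ p)
    (h1 : p ≤ Real.pi / 2) : omega1 γ₁ γ₂ p = dispersion γ₁ γ₂ p := by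
  rw [omega1_eq_abs hγ₁ hγ, abs_of_nonneg (dispersion_nonneg h0 h1)]

theorem omega1_of_nonpos (hγ₁ : 0 < γ₁) (hγ : γ₁ < γ₂) {p : ℝ} (h0 : p ≤ 0)
    (h1 : -(Real.pi / 2) ≤ p) : omega1 γ₁ γ₂ p = -dispersion γ₁ γ₂ p := by
  rw [omega1_eq_abs hγ₁ hγ, ← dispersion_neg, ← abs_neg, ← dispersion_neg,
    abs_of_nonneg (dispersion_nonneg (by linarith) (by linarith))]

theorem hasDerivAt_dispersion (hγ₁ : 0 < γ₁) (hγ : γ₁ < γ₂) (p : ℝ) :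
    HasDerivAt (dispersion γ₁ γ₂)
      (2 * Real.sqrt (γ₁ * γ₂) * Real.cos p / (2 * Real.sqrt 2) *
        ((Real.sqrt (γ₁ + γ₂ + 2 * Real.sqrt (γ₁ * γ₂) * Real.sin p))⁻¹ +
          (Real.sqrt (γ₁ + γ₂ - 2 * Real.sqrt (γ₁ * γ₂) * Real.sin p))⁻¹)) p := by
  have h := (Real.hasDerivAt_sin p).const_mul (2 * Real.sqrt (γ₁ * γ₂))
  have h1 := (h.const_add (γ₁ + γ₂)).sqrt (radicand_add_pos hγ₁ hγ p).ne'
  have h2 := (h.const_sub (γ₁ + γ₂)).sqrt (radicand_sub_pos hγ₁ hγ p).ne'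
  refine HasDerivAt.congr_deriv ((h1.sub h2).div_const (Real.sqrt 2)) ?_
  have n1 := (Real.sqrt_pos.2 (radicand_add_pos hγ₁ hγ p)).ne'
  have n2 := (Real.sqrt_pos.2 (radicand_sub_pos hγ₁ hγ p)).ne'
  field_simp
  ring

theorem cVel_pos (hγ₁ : 0 < γ₁) (hγ : γ₁ < γ₂) : 0 < cVel γ₁ γ₂ := by
  have := hγ₁.trans hγ
  exact Real.sqrt_pos.2 (by positivity)

theorem cVel_sq (hγ₁ : 0 < γ₁) (hγ : γ₁ < γ₂) :
    cVel γ₁ γ₂ ^ 2 = 2 * γ₁ * γ₂ / (γ₁ + γ₂) := by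
  have := hγ₁.trans hγ
  exact Real.sq_sqrt (by positivity)

theorem qDisp_pos (hγ₁ : 0 < γ₁) (hγ : γ₁ < γ₂) : 0 < qDisp γ₁ γ₂ := by
  have := hγ₁.trans hγ
  have h : 0 < γ₁ ^ 2 - γ₁ * γ₂ + γ₂ ^ 2 := by nlinarith
  have := cVel_pos hγ₁ hγ
  unfold qDisp
  positivity

theorem deriv_dispersion_nonneg (hγ₁ : 0 < γ₁) (hγ : γ₁ < γ₂) {p : ℝ}
    (hp : |p| ≤ Real.pi / 2) : 0 ≤ deriv (dispersion γ₁ γ₂) p := by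
  rw [(hasDerivAt_dispersion hγ₁ hγ p).deriv]
  have := Real.cos_nonneg_of_mem_Icc (abs_le.1 hp)
  positivity

theorem deriv_dispersion_zero (hγ₁ : 0 < γ₁) (hγ : γ₁ < γ₂) :
    deriv (dispersion γ₁ γ₂) 0 = cVel γ₁ γ₂ := by
  have hs : 0 < γ₁ + γ₂ := by linarith
  have hm : 0 < γ₁ * γ₂ := mul_pos hγ₁ (hγ₁.trans hγ)
  rw [(hasDerivAt_dispersion hγ₁ hγ 0).deriv, cVel, Real.sqrt_div' _ hs.le, mul_assoc 2 γ₁ γ₂,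
    Real.sqrt_mul zero_le_two]
  simp only [Real.sin_zero, Real.cos_zero, mul_zero, add_zero, sub_zero]
  have n1 := (Real.sqrt_pos.2 hs).ne'
  have n2 := Real.sq_sqrt (zero_le_two (α := ℝ))
  field_simp
  linear_combination -n2

/-- The two inverse roots A and B in Ω' enter through (A+B)² ≤ 2(A²+B²), which makes the bound
rational; it then rests on (γ₁+γ₂)² - 4γ₁γ₂ = (γ₂-γ₁)². -/
theorem deriv_dispersion_sq_le (hγ₁ : 0 < γ₁) (hγ : γ₁ < γ₂) (p : ℝ) :
    deriv (dispersion γ₁ γ₂) p ^ 2 ≤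
      cVel γ₁ γ₂ ^ 2 * (1 - (γ₂ - γ₁) ^ 2 / (γ₁ + γ₂) ^ 2 * Real.sin p ^ 2) := by
  have hs : 0 < γ₁ + γ₂ := by linarith
  have hγ₂ := hγ₁.trans hγ
  have hm : 0 < γ₁ * γ₂ := mul_pos hγ₁ hγ₂
  have p1 := radicand_add_pos hγ₁ hγ p
  have p2 := radicand_sub_pos hγ₁ hγ p
  have hr := Real.sq_sqrt hm.le
  have hr0 := Real.sqrt_nonneg (γ₁ * γ₂)
  rw [(hasDerivAt_dispersion hγ₁ hγ p).deriv, cVel_sq hγ₁ hγ]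
  set r := Real.sqrt (γ₁ * γ₂) with hrdef
  set σ := Real.sin p with hσ
  have hcos : Real.cos p ^ 2 = 1 - σ ^ 2 := by
    have := Real.sin_sq_add_cos_sq p; rw [← hσ] at this; linarith
  have hσ1 : σ ^ 2 ≤ 1 := by nlinarith [sq_nonneg (Real.cos p)]
  have q1 : (Real.sqrt (γ₁ + γ₂ + 2 * r * σ))⁻¹ ^ 2 = (γ₁ + γ₂ + 2 * r * σ)⁻¹ := by
    rw [inv_pow, Real.sq_sqrt p1.le]
  have q2 : (Real.sqrt (γ₁ + γ₂ - 2 * r * σ))⁻¹ ^ 2 = (γ₁ + γ₂ - 2 * r * σ)⁻¹ := by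
    rw [inv_pow, Real.sq_sqrt p2.le]
  set A := (Real.sqrt (γ₁ + γ₂ + 2 * r * σ))⁻¹
  set B := (Real.sqrt (γ₁ + γ₂ - 2 * r * σ))⁻¹
  have hAB : (A + B) ^ 2 ≤ 4 * (γ₁ + γ₂) / ((γ₁ + γ₂) ^ 2 - 4 * (γ₁ * γ₂) * σ ^ 2) := by
    have e : (γ₁ + γ₂ + 2 * r * σ)⁻¹ + (γ₁ + γ₂ - 2 * r * σ)⁻¹
        = 2 * (γ₁ + γ₂) / ((γ₁ + γ₂) ^ 2 - 4 * (γ₁ * γ₂) * σ ^ 2) := by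
      rw [← hr, show (γ₁ + γ₂) ^ 2 - 4 * r ^ 2 * σ ^ 2
        = (γ₁ + γ₂ + 2 * r * σ) * (γ₁ + γ₂ - 2 * r * σ) by ring]
      field_simp
      ring
    calc (A + B) ^ 2 ≤ 2 * (A ^ 2 + B ^ 2) := by nlinarith [sq_nonneg (A - B)]
      _ = _ := by rw [q1, q2, e]; ring
  have hden : 0 < (γ₁ + γ₂) ^ 2 - 4 * (γ₁ * γ₂) * σ ^ 2 := by
    rw [← hr]; nlinarith [mul_pos p1 p2]
  have h2 : Real.sqrt 2 ^ 2 = 2 := Real.sq_sqrt zero_le_two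
  calc (2 * r * Real.cos p / (2 * Real.sqrt 2) * (A + B)) ^ 2
      = γ₁ * γ₂ * (1 - σ ^ 2) / 2 * (A + B) ^ 2 := by
        rw [mul_pow, div_pow, mul_pow, mul_pow, mul_pow, h2, hr, hcos]; ring
    _ ≤ γ₁ * γ₂ * (1 - σ ^ 2) / 2 *
        (4 * (γ₁ + γ₂) / ((γ₁ + γ₂) ^ 2 - 4 * (γ₁ * γ₂) * σ ^ 2)) := by
        have : 0 ≤ 1 - σ ^ 2 := by linarith
        gcongr
    _ = 2 * γ₁ * γ₂ / (γ₁ + γ₂) *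
        ((γ₁ + γ₂) ^ 2 * (1 - σ ^ 2) / ((γ₁ + γ₂) ^ 2 - 4 * (γ₁ * γ₂) * σ ^ 2)) := by
        field_simp; ring
    _ ≤ _ := by
        refine mul_le_mul_of_nonneg_left ?_ (by positivity)
        rw [div_le_iff₀ hden]
        have : 0 ≤ (γ₂ - γ₁) ^ 2 / (γ₁ + γ₂) ^ 2 * σ ^ 2 * (4 * (γ₁ * γ₂) * σ ^ 2) := by positivity
        have e : (γ₂ - γ₁) ^ 2 / (γ₁ + γ₂) ^ 2 * (γ₁ + γ₂) ^ 2 = (γ₂ - γ₁) ^ 2 := by field_simp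
        linear_combination this + σ ^ 2 * e

/-- c² - Ω'² ≥ c²δ sin² p with δ > 0 because γ₁ < γ₂. Dividing by c + Ω' ≤ 2c and using Jordan's
inequality gives a quadratic lower bound up to the ends of the zone: no stationary point other than
0. -/
theorem exists_le_cVel_sub_deriv (hγ₁ : 0 < γ₁) (hγ : γ₁ < γ₂) :
    ∃ d : ℝ, 0 < d ∧ ∀ p, |p| ≤ Real.pi / 2 →
      d * p ^ 2 ≤ cVel γ₁ γ₂ - deriv (dispersion γ₁ γ₂) p := by
  have hc := cVel_pos hγ₁ hγ
  have hs : 0 < γ₁ + γ₂ := by linarith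
  have hδ : 0 < γ₂ - γ₁ := by linarith
  have hπ := Real.pi_pos
  set δ := (γ₂ - γ₁) ^ 2 / (γ₁ + γ₂) ^ 2 with hδdef
  have hδ0 : 0 < δ := by positivity
  refine ⟨cVel γ₁ γ₂ * δ / 2 * (2 / Real.pi) ^ 2, by positivity, fun p hp => ?_⟩
  have h1 := deriv_dispersion_sq_le hγ₁ hγ p
  have h2 := deriv_dispersion_nonneg hγ₁ hγ hp
  rw [← hδdef] at h1
  set D := deriv (dispersion γ₁ γ₂) p
  set c := cVel γ₁ γ₂
  have hj : (2 / Real.pi) ^ 2 * p ^ 2 ≤ Real.sin p ^ 2 := by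
    have := Real.mul_le_sin (abs_nonneg p) hp
    have h3 : Real.sin |p| ^ 2 = Real.sin p ^ 2 := by
      rcases abs_choice p with h | h <;> rw [h]
      rw [Real.sin_neg, neg_sq]
    rw [← h3, ← sq_abs p, ← mul_pow]
    gcongr
  have hDc : D ≤ c := by
    refine abs_le_of_sq_le_sq' ?_ hc.le |>.2
    refine h1.trans (mul_le_of_le_one_right (by positivity) ?_)
    have : 0 ≤ δ * Real.sin p ^ 2 := by positivity
    linarith
  have h4 : c * (δ * Real.sin p ^ 2) ≤ 2 * (c - D) := by
    have : c * (c * (δ * Real.sin p ^ 2)) ≤ c * (2 * (c - D)) := by nlinarith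
    exact le_of_mul_le_mul_left this hc
  have h5 : c * δ / 2 * ((2 / Real.pi) ^ 2 * p ^ 2) ≤ c * δ / 2 * Real.sin p ^ 2 := by gcongr
  linarith

/-- The deviation of the acoustic branch from the linear one, normalized to `p³ / 3 + O(p⁵)`. -/
def frontPhase (γ₁ γ₂ p : ℝ) : ℝ := (cVel γ₁ γ₂ * p - dispersion γ₁ γ₂ p) / qDisp γ₁ γ₂

theorem contDiff_frontPhase (hγ₁ : 0 < γ₁) (hγ : γ₁ < γ₂) : ContDiff ℝ ∞ (frontPhase γ₁ γ₂) :=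
  ((contDiff_const.mul contDiff_id).sub (contDiff_dispersion hγ₁ hγ)).div_const _

theorem frontPhase_neg (p : ℝ) : frontPhase γ₁ γ₂ (-p) = -frontPhase γ₁ γ₂ p := by
  simp only [frontPhase, dispersion_neg]; ring

theorem deriv_frontPhase (hγ₁ : 0 < γ₁) (hγ : γ₁ < γ₂) (p : ℝ) :
    deriv (frontPhase γ₁ γ₂) p =
      (cVel γ₁ γ₂ - deriv (dispersion γ₁ γ₂) p) / qDisp γ₁ γ₂ := by
  have h := ((contDiff_infty_iff_deriv.1 (contDiff_dispersion hγ₁ hγ)).1 p).hasDerivAt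
  have := (((hasDerivAt_id p).const_mul (cVel γ₁ γ₂)).sub h).div_const (qDisp γ₁ γ₂)
  rw [mul_one] at this
  exact this.deriv

theorem exists_frontPhase (hγ₁ : 0 < γ₁) (hγ : γ₁ < γ₂) :
    ∃ (d : ℝ) (v e : ℝ → ℝ), CubicPhase (Real.pi / 2) d (frontPhase γ₁ γ₂) v ∧ ContDiff ℝ ∞ e ∧
      ∀ p, frontPhase γ₁ γ₂ p = p ^ 3 / 3 + p ^ 5 * e p := by
  have hq := qDisp_pos hγ₁ hγ
  have hc := cVel_pos hγ₁ hγ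
  have hs : 0 < γ₁ + γ₂ := by linarith
  have hγ₂ := hγ₁.trans hγ
  obtain ⟨w, hw, heven, hψ⟩ := exists_eq_cube_mul (contDiff_frontPhase hγ₁ hγ)
    frontPhase_neg (by rw [deriv_frontPhase hγ₁ hγ, deriv_dispersion_zero hγ₁ hγ]; simp)
  obtain ⟨e, he, hwe⟩ := exists_eq_add_sq_mul hw heven
  obtain ⟨v, hv, hdd⟩ := exists_deriv_deriv_eq hw hψ
  obtain ⟨d, hd, hle⟩ := exists_le_cVel_sub_deriv hγ₁ hγ
  -- The normalization by q: eliminating C gives 2(γ₁+γ₂)Ω² - Ω⁴ = 4γ₁γ₂ sin² p. The p² terms cancel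
  -- by the value of c², and dividing by p⁴ and letting p = 0 determines w(0).
  have hw0 : w 0 = 1 / 3 := by
    obtain ⟨u, hu, hu0, hsin⟩ := exists_sin_eq
    have hwc := hw.continuous
    set c := cVel γ₁ γ₂ with hcdef
    set q := qDisp γ₁ γ₂ with hqdef
    have hΩ : ∀ p, dispersion γ₁ γ₂ p = p * (c - p ^ 2 * (q * w p)) := by
      intro p
      have := hψ p
      rw [frontPhase, div_eq_iff hq.ne'] at this
      linear_combination -this
    have hc2 : (γ₁ + γ₂) * c ^ 2 = 2 * γ₁ * γ₂ := by
      rw [cVel_sq hγ₁ hγ]; field_simp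
    have key : ∀ p, 2 * (γ₁ + γ₂) * (-2 * c * (q * w p) + p ^ 2 * (q * w p) ^ 2)
        - (c - p ^ 2 * (q * w p)) ^ 4 = 4 * (γ₁ * γ₂) * (-2 * u p + p ^ 2 * u p ^ 2) := by
      have hmul : ∀ p, p ^ 4 * (2 * (γ₁ + γ₂) * (-2 * c * (q * w p) + p ^ 2 * (q * w p) ^ 2)
          - (c - p ^ 2 * (q * w p)) ^ 4) =
          p ^ 4 * (4 * (γ₁ * γ₂) * (-2 * u p + p ^ 2 * u p ^ 2)) := by
        intro p
        have h1 := dispersion_sq hγ₁ hγ p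
        have h2 : Cfun γ₁ γ₂ (2 * p) ^ 2 = (γ₁ + γ₂) ^ 2 - 4 * (γ₁ * γ₂) * Real.sin p ^ 2 := by
          rw [Cfun_two_mul hγ₁ hγ, mul_pow, Real.sq_sqrt (radicand_add_pos hγ₁ hγ p).le,
            Real.sq_sqrt (radicand_sub_pos hγ₁ hγ p).le]
          have := Real.sq_sqrt (mul_pos hγ₁ hγ₂).le
          linear_combination -4 * Real.sin p ^ 2 * this
        have h3 : Cfun γ₁ γ₂ (2 * p) = γ₁ + γ₂ - dispersion γ₁ γ₂ p ^ 2 := by linarith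
        rw [h3, hΩ, hsin] at h2
        linear_combination -h2 - 2 * p ^ 2 * hc2
      have hf : Continuous fun p => 2 * (γ₁ + γ₂) * (-2 * c * (q * w p) + p ^ 2 * (q * w p) ^ 2)
        - (c - p ^ 2 * (q * w p)) ^ 4 := by fun_prop
      have hg : Continuous fun p => 4 * (γ₁ * γ₂) * (-2 * u p + p ^ 2 * u p ^ 2) := by fun_prop
      refine fun p => congrFun (Continuous.ext_on (dense_compl_singleton (0 : ℝ)) hf hg ?_) p
      exact fun p hp => mul_left_cancel₀ (pow_ne_zero 4 hp) (hmul p)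
    have k0 := key 0
    rw [hu0] at k0
    have hqc : 2 * (γ₁ + γ₂) ^ 2 * q = c * (γ₁ ^ 2 - γ₁ * γ₂ + γ₂ ^ 2) := by
      rw [hqdef, qDisp, ← hcdef]; field_simp
    have k1 : 4 * (γ₁ + γ₂) * c * q * (w 0 - 1 / 3) = 0 := by
      have hsne := hs.ne'
      have : (γ₁ + γ₂) ^ 2 * (4 * (γ₁ + γ₂) * c * q * (w 0 - 1 / 3)) = 0 := by
        have hc4 : (γ₁ + γ₂) ^ 2 * c ^ 4 = (2 * γ₁ * γ₂) ^ 2 := by rw [← hc2]; ring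
        linear_combination (-(γ₁ + γ₂) ^ 2) * k0 - hc4
          - (2 / 3) * (γ₁ + γ₂) * c * hqc
          - (2 / 3) * (γ₁ ^ 2 - γ₁ * γ₂ + γ₂ ^ 2) * hc2
      rcases mul_eq_zero.1 this with h | h
      · exact absurd h (by positivity)
      · exact h
    have : w 0 - 1 / 3 = 0 := by
      rcases mul_eq_zero.1 k1 with h | h
      · exact absurd h (by positivity)
      · exact h
    linarith
  -- The minimum with 1 makes the same d serve for the model phase, whose derivative is exactly p².
  refine ⟨min 1 (d / qDisp γ₁ γ₂), v, e, ⟨by positivity, lt_min one_pos (by positivity),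
    min_le_left _ _, contDiff_frontPhase hγ₁ hγ, hv, hdd, fun p hp => ?_⟩, he, fun p => ?_⟩
  · rw [deriv_frontPhase hγ₁ hγ]
    calc min 1 (d / qDisp γ₁ γ₂) * p ^ 2 ≤ d / qDisp γ₁ γ₂ * p ^ 2 := by
          gcongr; exact min_le_right _ _
      _ = d * p ^ 2 / qDisp γ₁ γ₂ := by ring
      _ ≤ _ := by gcongr; exact hle p hp
  · rw [hψ p, hwe p, hw0]; ring

end Dispersion

/-! ### Smoothness and symmetry of the amplitude. -/

theorem iteratedDeriv_const_mul_cexp (A c : ℂ) (n : ℕ) :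
    iteratedDeriv n (fun p : ℝ => A * Complex.exp (c * p)) =
      fun p : ℝ => A * c ^ n * Complex.exp (c * p) := by
  induction n with
  | zero => simp
  | succ n ih =>
    rw [iteratedDeriv_succ, ih]
    ext p
    have h := (((hasDerivAt_id p).ofReal_comp.const_mul c).cexp).const_mul (A * c ^ n)
    refine (HasDerivAt.congr_deriv h ?_ :
      HasDerivAt (fun p : ℝ => A * c ^ n * Complex.exp (c * p)) _ p).deriv
    simp
    ring

/-- Fourier series of Schwartz samples along a sequence growing linearly are smooth. -/
theorem contDiff_tsum_schwartz (W : SchwartzMap ℝ ℝ) (x : ℤ → ℝ) (hx : ∀ k : ℤ, |(k : ℝ)| ≤ |x k|) :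
    ContDiff ℝ ∞ fun p : ℝ => ∑' k : ℤ, (W (x k) : ℂ) * Complex.exp ((-Complex.I * x k) * p) := by
  refine contDiff_tsum (𝕜 := ℝ) (N := ⊤) (v := fun n k => |W (x k)| * |x k| ^ n) ?_ ?_ ?_
  · intro k
    have : ContDiff ℝ ∞ (fun p : ℝ => (p : ℂ)) := Complex.ofRealCLM.contDiff
    fun_prop
  · intro n _
    -- Two powers beyond the n from differentiation give summability against 1/k²; k = 0 is left
    -- out, the bound being needed only for almost all k.
    obtain ⟨C, hC⟩ := W.decay' (n + 2) 0
    refine Summable.of_norm_bounded_eventually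
      ((Real.summable_one_div_int_pow (p := 2).2 one_lt_two).mul_left C) ?_
    filter_upwards [(finite_singleton (0 : ℤ)).compl_mem_cofinite] with k hk
    have hk0 : (0 : ℝ) < (k : ℝ) ^ 2 := by
      have : (k : ℝ) ≠ 0 := by exact_mod_cast hk
      positivity
    have h1 := hC (x k)
    rw [norm_iteratedFDeriv_zero, Real.norm_eq_abs, pow_add, sq_abs] at h1
    have h2 : (k : ℝ) ^ 2 ≤ x k ^ 2 := sq_le_sq.2 (hx k)
    rw [Real.norm_of_nonneg (by positivity), mul_one_div, le_div_iff₀ hk0]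
    calc |W (x k)| * |x k| ^ n * (k : ℝ) ^ 2 ≤ |W (x k)| * |x k| ^ n * x k ^ 2 := by gcongr
      _ = |x k| ^ n * x k ^ 2 * |W (x k)| := by ring
      _ ≤ C := h1
  · intro n k p _
    rw [norm_iteratedFDeriv_eq_norm_iteratedDeriv, iteratedDeriv_const_mul_cexp]
    have : ‖Complex.exp (-Complex.I * x k * p)‖ = 1 := by
      rw [show -Complex.I * x k * p = ((-(x k * p) : ℝ) : ℂ) * Complex.I by push_cast; ring]
      exact Complex.norm_exp_ofReal_mul_I _
    rw [norm_mul, this]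
    simp

theorem tildeV_zero (W : SchwartzMap ℝ ℝ) (p : ℝ) : tildeV W p 0 =
    ∑' k : ℤ, (W (2 * k) : ℂ) * Complex.exp ((-Complex.I * (2 * k : ℝ)) * p) := by
  simp only [tildeV, Matrix.cons_val_zero]
  refine tsum_congr fun k => ?_
  push_cast
  ring_nf

theorem tildeV_one (W : SchwartzMap ℝ ℝ) (p : ℝ) : tildeV W p 1 =
    ∑' k : ℤ, (W (2 * k + 1) : ℂ) * Complex.exp ((-Complex.I * (2 * k + 1 : ℝ)) * p) := by
  simp only [tildeV, Matrix.cons_val_one]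
  refine tsum_congr fun k => ?_
  push_cast
  ring_nf

theorem abs_int_le_abs_two_mul_add_one (k : ℤ) : |(k : ℝ)| ≤ |2 * (k : ℝ) + 1| := by
  have : |k| ≤ |2 * k + 1| := by
    rcases abs_cases k with h | h <;> rcases abs_cases (2 * k + 1) with h' | h' <;> omega
  exact_mod_cast this

theorem contDiff_tildeV (W : SchwartzMap ℝ ℝ) (j : Fin 2) :
    ContDiff ℝ ∞ fun p => tildeV W p j := by
  fin_cases j
  · simp only [Fin.zero_eta, tildeV_zero]
    refine contDiff_tsum_schwartz W (fun k => 2 * k) fun k => ?_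
    rw [abs_mul, abs_two]; linarith [abs_nonneg (k : ℝ)]
  · simp only [Fin.mk_one, tildeV_one]
    exact contDiff_tsum_schwartz W (fun k => 2 * k + 1) abs_int_le_abs_two_mul_add_one

/-- Reality of W. This is the symmetry that trades the half integral for a full one. -/
theorem conj_tildeV (W : SchwartzMap ℝ ℝ) (p : ℝ) (j : Fin 2) :
    conj (tildeV W p j) = tildeV W (-p) j := by
  have key : ∀ w x : ℝ, conj ((w : ℂ) * Complex.exp (-Complex.I * x * p)) =
      (w : ℂ) * Complex.exp (-Complex.I * x * (-p : ℝ)) := by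
    intro w x
    rw [map_mul, Complex.conj_ofReal, ← Complex.exp_conj]
    simp
  fin_cases j
  · simp only [Fin.zero_eta, tildeV_zero, Complex.conj_tsum, key]
  · simp only [Fin.mk_one, tildeV_one, Complex.conj_tsum, key]

section Matrix

variable {γ₁ γ₂ : ℝ}

theorem Cfun_radicand_pos (hγ₁ : 0 < γ₁) (hγ : γ₁ < γ₂) (p : ℝ) :
    0 < γ₁ ^ 2 + γ₂ ^ 2 + 2 * γ₁ * γ₂ * Real.cos p := by
  have h := Real.neg_one_le_cos p
  have hm : 0 < γ₁ * γ₂ := mul_pos hγ₁ (hγ₁.trans hγ)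
  nlinarith [sq_pos_of_pos (sub_pos.2 hγ)]

theorem contDiff_Gfun (hγ₁ : 0 < γ₁) (hγ : γ₁ < γ₂) :
    ContDiff ℝ ∞ fun p => Gfun γ₁ γ₂ (2 * p) := by
  unfold Gfun Cfun
  refine contDiff_const.add (ContDiff.sqrt ?_ fun p => (Cfun_radicand_pos hγ₁ hγ _).ne')
  fun_prop

theorem Gfun_pos (hγ : γ₁ < γ₂) (p : ℝ) : 0 < Gfun γ₁ γ₂ p := by
  have : 0 ≤ Cfun γ₁ γ₂ p := Real.sqrt_nonneg _
  unfold Gfun; linarith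

theorem Jfun_pos (hγ₁ : 0 < γ₁) (hγ : γ₁ < γ₂) (p : ℝ) : 0 < Jfun γ₁ γ₂ p := by
  have h := Gfun_pos hγ (2 * p)
  have := hγ₁.trans hγ
  unfold Jfun; positivity

theorem contDiff_matA (hγ₁ : 0 < γ₁) (hγ : γ₁ < γ₂) (j l : Fin 2) :
    ContDiff ℝ ∞ fun p => matA γ₁ γ₂ p j l := by
  have hG := contDiff_Gfun hγ₁ hγ
  have hJ : ContDiff ℝ ∞ fun p => 1 / Jfun γ₁ γ₂ p := by
    refine contDiff_const.div ?_ fun p => (Jfun_pos hγ₁ hγ p).ne'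
    unfold Jfun; fun_prop
  fin_cases j <;> fin_cases l <;> simp [matA] <;> simp only [one_div] at hJ <;> fun_prop

theorem matA_neg (p : ℝ) : matA γ₁ γ₂ (-p) = matA γ₁ γ₂ p := by
  simp [matA, Jfun, Gfun, Cfun]

theorem deriv_zero_of_even {f : ℝ → ℝ} (h : ∀ p, f (-p) = f p) : deriv f 0 = 0 := by
  have h1 := deriv_comp_neg f 0
  rw [show (fun x => f (-x)) = f from funext h, neg_zero] at h1
  linarith

end Matrix

/-- The amplitude `𝒜(p) Ṽ⁰(p)` of the acoustic integral. -/
def amplitude (γ₁ γ₂ : ℝ) (W : SchwartzMap ℝ ℝ) (j : Fin 2) (p : ℝ) : ℂ :=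
  ((matA γ₁ γ₂ p).map Complex.ofReal).mulVec (tildeV W p) j

theorem amplitude_eq (γ₁ γ₂ : ℝ) (W : SchwartzMap ℝ ℝ) (j : Fin 2) (p : ℝ) :
    amplitude γ₁ γ₂ W j p = ∑ l, (matA γ₁ γ₂ p j l : ℂ) * tildeV W p l := by
  simp [amplitude, Matrix.mulVec, dotProduct]

section Amplitude

variable {γ₁ γ₂ : ℝ} (W : SchwartzMap ℝ ℝ) (j : Fin 2)

theorem contDiff_amplitude (hγ₁ : 0 < γ₁) (hγ : γ₁ < γ₂) :
    ContDiff ℝ ∞ (amplitude γ₁ γ₂ W j) := by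
  rw [show amplitude γ₁ γ₂ W j = _ from funext (amplitude_eq γ₁ γ₂ W j)]
  exact ContDiff.sum fun l _ =>
    (Complex.ofRealCLM.contDiff.comp (contDiff_matA hγ₁ hγ j l)).mul (contDiff_tildeV W l)

theorem conj_amplitude (p : ℝ) :
    conj (amplitude γ₁ γ₂ W j p) = amplitude γ₁ γ₂ W j (-p) := by
  simp only [amplitude_eq, map_sum, map_mul, Complex.conj_ofReal, conj_tildeV, matA_neg]

/-- 𝒜 is even, so its derivative at 0 vanishes and only Ṽ⁰ is differentiated. -/
theorem deriv_amplitude_zero (hγ₁ : 0 < γ₁) (hγ : γ₁ < γ₂) :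
    deriv (amplitude γ₁ γ₂ W j) 0 =
      ∑ l, (matA γ₁ γ₂ 0 j l : ℂ) * deriv (fun p => tildeV W p l) 0 := by
  have h : ∀ l ∈ Finset.univ, HasDerivAt (fun p => (matA γ₁ γ₂ p j l : ℂ) * tildeV W p l)
      ((matA γ₁ γ₂ 0 j l : ℂ) * deriv (fun p => tildeV W p l) 0) 0 := by
    intro l _
    have h1 := ((contDiff_infty_iff_deriv.1 (contDiff_matA hγ₁ hγ j l)).1 0).hasDerivAt
    rw [deriv_zero_of_even fun p => by rw [matA_neg]] at h1
    have h2 := ((contDiff_infty_iff_deriv.1 (contDiff_tildeV W l)).1 0).hasDerivAt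
    refine HasDerivAt.congr_deriv (h1.ofReal_comp.mul h2) ?_
    simp
  rw [show amplitude γ₁ γ₂ W j = _ from funext (amplitude_eq γ₁ γ₂ W j)]
  exact (HasDerivAt.fun_sum h).deriv

end Amplitude

/-! ### The nonstationary half. -/

/-- Integration by parts without stationary points, uniformly in the large parameters. -/
theorem norm_integral_nonstationary_le {F : ℝ → ℂ} {Ω : ℝ → ℝ} {b c : ℝ} (hF : ContDiff ℝ ∞ F)
    (hΩ : ContDiff ℝ ∞ Ω) (hb : 0 ≤ b) (hc : 0 < c) (hΩ' : ∀ p ∈ Icc 0 b, 0 ≤ deriv Ω p) :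
    ∃ C : ℝ, 0 ≤ C ∧ ∀ μ t x : ℝ, 0 < μ → 0 < t → c * t ≤ x →
      ‖∫ p in (0 : ℝ)..b, F p * Complex.exp (Complex.I / μ * (p * x + Ω p * t))‖ ≤ C * (μ / t) := by
  have hF1 := contDiff_infty_iff_deriv.1 hF
  have hΩ1 := contDiff_infty_iff_deriv.1 hΩ
  have hΩ2 := contDiff_infty_iff_deriv.1 hΩ1.2
  have hcomp : IsCompact (Icc 0 b) := isCompact_Icc
  obtain ⟨M₀, hM₀⟩ := hcomp.exists_bound_of_continuousOn hF.continuous.continuousOn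
  obtain ⟨M₁, hM₁⟩ := hcomp.exists_bound_of_continuousOn hF1.2.continuous.continuousOn
  obtain ⟨M₂, hM₂⟩ := hcomp.exists_bound_of_continuousOn hΩ2.2.continuous.continuousOn
  have m0 : (0 : ℝ) ∈ Icc 0 b := ⟨le_rfl, hb⟩
  have p0 : 0 ≤ M₀ := (norm_nonneg _).trans (hM₀ 0 m0)
  have p1 : 0 ≤ M₁ := (norm_nonneg _).trans (hM₁ 0 m0)
  have p2 : 0 ≤ M₂ := (norm_nonneg _).trans (hM₂ 0 m0)
  refine ⟨2 * M₀ / c + (M₁ / c + M₀ * M₂ / c ^ 2) * b, by positivity, fun μ t x hμ ht hx => ?_⟩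
  have hμ' : (μ : ℂ) ≠ 0 := by exact_mod_cast hμ.ne'
  -- D is at least ct and D' = Ω''t, so both 1/D and D'/D² are O(1/t); this is why the bound is
  -- uniform in x and in large t.
  set D : ℝ → ℝ := fun p => x + deriv Ω p * t with hD
  set e : ℝ → ℂ := fun p => Complex.exp (Complex.I / μ * (p * x + Ω p * t)) with he
  have hDle : ∀ p ∈ Icc 0 b, c * t ≤ D p := fun p hp => by
    have := mul_nonneg (hΩ' p hp) ht.le
    simp only [hD]; linarith
  have hct : 0 < c * t := mul_pos hc ht
  have hDpos : ∀ p ∈ Icc 0 b, 0 < D p := fun p hp => hct.trans_le (hDle p hp)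
  have hen : ∀ p, ‖e p‖ = 1 := by
    intro p
    simp only [he]
    rw [show Complex.I / μ * (p * x + Ω p * t) = (((p * x + Ω p * t) / μ : ℝ) : ℂ) * Complex.I by
      push_cast; ring]
    exact Complex.norm_exp_ofReal_mul_I _
  have hDc : Continuous D := by
    have := hΩ1.2.continuous
    fun_prop
  have hec : Continuous e := by
    have := hΩ.continuous
    fun_prop
  have hderD : ∀ p, HasDerivAt D (deriv (deriv Ω) p * t) p := fun p =>
    ((hΩ2.1 p).hasDerivAt.mul_const t).const_add x
  have hdere : ∀ p, HasDerivAt e (e p * (Complex.I / μ * D p)) p := by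
    intro p
    have h1 := (hasDerivAt_id p).ofReal_comp.mul_const (x : ℂ)
    have h2 := (hΩ1.1 p).hasDerivAt.ofReal_comp.mul_const (t : ℂ)
    refine HasDerivAt.congr_deriv ((h1.add h2).const_mul (Complex.I / μ)).cexp ?_
    simp [he, hD]
  set g' : ℝ → ℂ := fun p => deriv F p * (D p : ℂ)⁻¹
    - F p * ((deriv (deriv Ω) p * t : ℝ) : ℂ) * ((D p : ℂ)⁻¹) ^ 2 with hg'
  have hinv : ContinuousOn (fun p => (D p : ℂ)⁻¹) (Icc 0 b) :=
    ContinuousOn.inv₀ (by fun_prop) fun p hp => by exact_mod_cast (hDpos p hp).ne'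
  have hg'c : ContinuousOn g' (Icc 0 b) := by
    have a1 := hF.continuous
    have a2 := hF1.2.continuous
    have a3 := hΩ2.2.continuous
    exact (a2.continuousOn.mul hinv).sub
      (ContinuousOn.mul (by fun_prop) (hinv.pow 2))
  have i1 : IntervalIntegrable (fun p => g' p * e p) volume 0 b := by
    refine ContinuousOn.intervalIntegrable ?_
    rw [uIcc_of_le hb]
    exact hg'c.mul hec.continuousOn
  have i2 : IntervalIntegrable (fun p => F p * e p) volume 0 b :=
    (hF.continuous.mul hec).intervalIntegrable _ _
  have hparts := intervalIntegral.integral_eq_sub_of_hasDerivAt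
    (f := fun p => F p * (D p : ℂ)⁻¹ * e p)
    (f' := fun p => g' p * e p + Complex.I / μ * (F p * e p)) (a := 0) (b := b) ?_
    (i1.add (i2.const_mul _))
  swap
  · intro p hp
    rw [uIcc_of_le hb] at hp
    have hne : (D p : ℂ) ≠ 0 := by exact_mod_cast (hDpos p hp).ne'
    have := ((hF1.1 p).hasDerivAt.mul ((hderD p).ofReal_comp.inv hne)).mul (hdere p)
    refine HasDerivAt.congr_deriv this ?_
    simp only [hg', Pi.mul_apply, Pi.inv_apply]
    field_simp
    ring
  rw [intervalIntegral.integral_add i1 (i2.const_mul _),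
    intervalIntegral.integral_const_mul] at hparts
  have hsol : ∫ p in (0 : ℝ)..b, F p * e p = -Complex.I * μ *
      ((F b * (D b : ℂ)⁻¹ * e b - F 0 * (D 0 : ℂ)⁻¹ * e 0) - ∫ p in (0 : ℝ)..b, g' p * e p) := by
    rw [← hparts]
    field_simp
    rw [add_sub_cancel_left]
    linear_combination (∫ p in (0 : ℝ)..b, F p * e p) * Complex.I_sq
  have hDinv : ∀ p ∈ Icc 0 b, ‖(D p : ℂ)⁻¹‖ ≤ (c * t)⁻¹ := by
    intro p hp
    rw [norm_inv, Complex.norm_real, Real.norm_of_nonneg (hDpos p hp).le]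
    exact inv_anti₀ hct (hDle p hp)
  have hend : ∀ p ∈ Icc 0 b, ‖F p * (D p : ℂ)⁻¹ * e p‖ ≤ M₀ * (c * t)⁻¹ := by
    intro p hp
    rw [norm_mul, hen, mul_one, norm_mul]
    exact mul_le_mul (hM₀ p hp) (hDinv p hp) (norm_nonneg _) p0
  have hint : ‖∫ p in (0 : ℝ)..b, g' p * e p‖ ≤
      (M₁ * (c * t)⁻¹ + M₀ * (M₂ * t) * ((c * t)⁻¹) ^ 2) * |b - 0| := by
    refine intervalIntegral.norm_integral_le_of_norm_le_const fun p hp => ?_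
    rw [uIoc_of_le hb] at hp
    have hp' : p ∈ Icc 0 b := ⟨hp.1.le, hp.2⟩
    rw [norm_mul, hen, mul_one]
    refine (norm_sub_le _ _).trans ?_
    rw [norm_mul, norm_mul, norm_mul, norm_pow, Complex.norm_real, norm_mul,
      Real.norm_of_nonneg ht.le]
    have q1 := hM₀ p hp'
    have q2 := hM₁ p hp'
    have q3 := hM₂ p hp'
    have q4 := hDinv p hp'
    gcongr
  rw [hsol, norm_mul, norm_mul, norm_neg, Complex.norm_I, one_mul, Complex.norm_real,
    Real.norm_of_nonneg hμ.le]
  calc μ * ‖(F b * (D b : ℂ)⁻¹ * e b - F 0 * (D 0 : ℂ)⁻¹ * e 0) - ∫ p in (0 : ℝ)..b, g' p * e p‖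
      ≤ μ * ((M₀ * (c * t)⁻¹ + M₀ * (c * t)⁻¹)
        + (M₁ * (c * t)⁻¹ + M₀ * (M₂ * t) * ((c * t)⁻¹) ^ 2) * b) := by
        gcongr
        refine (norm_sub_le _ _).trans (add_le_add ((norm_sub_le _ _).trans
          (add_le_add (hend b ⟨hb, le_rfl⟩) (hend 0 m0))) ?_)
        rwa [sub_zero, abs_of_nonneg hb] at hint
    _ = _ := by field_simp; ring

/-! ### The scale a and the Airy variable. -/

section Scaling

variable {γ₁ γ₂ : ℝ}

theorem rpow_third_pow_three {x : ℝ} (hx : 0 ≤ x) : (x ^ (1 / 3 : ℝ)) ^ 3 = x := by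
  rw [← Real.rpow_natCast, ← Real.rpow_mul hx]; norm_num

theorem rpow_two_thirds {x : ℝ} (hx : 0 ≤ x) : x ^ (2 / 3 : ℝ) = (x ^ (1 / 3 : ℝ)) ^ 2 := by
  rw [← Real.rpow_natCast, ← Real.rpow_mul hx]; norm_num

theorem amp_pos (hγ₁ : 0 < γ₁) (hγ : γ₁ < γ₂) {μ t : ℝ} (hμ : 0 < μ) (ht : 0 < t) :
    0 < amp γ₁ γ₂ μ t :=
  Real.rpow_pos_of_pos (div_pos hμ (mul_pos (qDisp_pos hγ₁ hγ) ht)) _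

theorem amp_pow_three (hγ₁ : 0 < γ₁) (hγ : γ₁ < γ₂) {μ t : ℝ} (hμ : 0 < μ) (ht : 0 < t) :
    amp γ₁ γ₂ μ t ^ 3 = μ / (qDisp γ₁ γ₂ * t) :=
  rpow_third_pow_three (div_pos hμ (mul_pos (qDisp_pos hγ₁ hγ) ht)).le

theorem amp_le (hγ₁ : 0 < γ₁) (hγ : γ₁ < γ₂) {μ t t₀ : ℝ} (hμ : 0 < μ) (ht₀ : 0 < t₀)
    (ht : t₀ ≤ t) :
    amp γ₁ γ₂ μ t ≤ ((qDisp γ₁ γ₂ * t₀) ^ (1 / 3 : ℝ))⁻¹ * μ ^ (1 / 3 : ℝ) := by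
  have hq := qDisp_pos hγ₁ hγ
  have h0 : 0 < qDisp γ₁ γ₂ * t₀ := mul_pos hq ht₀
  rw [amp, mul_comm _ (μ ^ (1 / 3 : ℝ)), ← div_eq_mul_inv, ← Real.div_rpow hμ.le h0.le]
  have : 0 < t := ht₀.trans_le ht
  gcongr

/-- The argument of the Airy function is `a (x - c t) / μ`. -/
theorem airy_argument_eq (hγ₁ : 0 < γ₁) (hγ : γ₁ < γ₂) {μ t : ℝ} (hμ : 0 < μ) (ht : 0 < t) (ξ : ℝ) :
    ξ / (μ ^ (2 / 3 : ℝ) * (qDisp γ₁ γ₂ * t) ^ (1 / 3 : ℝ)) = amp γ₁ γ₂ μ t * ξ / μ := by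
  have hqt : 0 < qDisp γ₁ γ₂ * t := mul_pos (qDisp_pos hγ₁ hγ) ht
  have hm : 0 < μ ^ (1 / 3 : ℝ) := Real.rpow_pos_of_pos hμ _
  have hn : 0 < (qDisp γ₁ γ₂ * t) ^ (1 / 3 : ℝ) := Real.rpow_pos_of_pos hqt _
  rw [rpow_two_thirds hμ.le, amp, Real.div_rpow hμ.le hqt.le]
  have h3 := rpow_third_pow_three hμ.le
  generalize μ ^ (1 / 3 : ℝ) = m at *
  subst h3
  field_simp

end Scaling

/-! ### Front asymptotics with scalar amplitude. -/

/-- The acoustic integral with scalar amplitude `F`. -/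
def acousticIntegral (γ₁ γ₂ : ℝ) (F : ℝ → ℂ) (μ x t : ℝ) : ℂ :=
  (1 / (Real.pi : ℂ)) * ∫ p in (-(Real.pi / 2))..(Real.pi / 2),
    F p * Complex.exp (Complex.I / μ * (p * x + omega1 γ₁ γ₂ p * t))

section Core

variable {γ₁ γ₂ : ℝ}

/-- Reflection p ↦ -p, under which ω₁ is invariant; it carries the left front to the right one. -/
theorem acousticIntegral_neg (hγ₁ : 0 < γ₁) (hγ : γ₁ < γ₂) (F : ℝ → ℂ) (μ x t : ℝ) :
    acousticIntegral γ₁ γ₂ (fun p => F (-p)) μ (-x) t = acousticIntegral γ₁ γ₂ F μ x t := by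
  unfold acousticIntegral
  congr 1
  have h := intervalIntegral.integral_comp_neg (a := -(Real.pi / 2)) (b := Real.pi / 2)
    (fun p : ℝ => F p * Complex.exp (Complex.I / μ * (p * x + omega1 γ₁ γ₂ p * t)))
  rw [neg_neg] at h
  rw [← h]
  refine intervalIntegral.integral_congr fun p _ => ?_
  simp only [omega1_eq_abs hγ₁ hγ, dispersion_neg, abs_neg]
  push_cast
  ring_nf

theorem two_mul_re_integral_neg_half {f : ℝ → ℂ} (hf : Continuous f)
    (hconj : ∀ p, conj (f p) = f (-p)) (L : ℝ) :
    2 * (∫ p in (-L)..0, f p).re = (∫ p in (-L)..L, f p).re := by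
  have i := fun u w => hf.intervalIntegrable (μ := volume) u w
  have h : ∫ p in (0 : ℝ)..L, f p = conj (∫ p in (-L)..0, f p) := by
    rw [← intervalIntegral.intervalIntegral_conj]
    simp only [hconj]
    rw [intervalIntegral.integral_comp_neg]
    simp
  rw [← intervalIntegral.integral_add_adjacent_intervals (i (-L) 0) (i 0 L), h]
  simp
  ring

/-- The acoustic integral near the front `x = c t`, with scalar amplitude. -/
theorem abs_re_acousticIntegral_sub_le (hγ₁ : 0 < γ₁) (hγ : γ₁ < γ₂) {F : ℝ → ℂ}
    (hF : ContDiff ℝ ∞ F) (hconj : ∀ p, conj (F p) = F (-p)) {K t₀ : ℝ} (hK : 0 < K)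
    (ht₀ : 0 < t₀) : ∃ C : ℝ, 0 ≤ C ∧ ∀ μ t x y : ℝ, 0 < μ → μ ≤ qDisp γ₁ γ₂ * t₀ →
      K * μ ^ (2 / 3 : ℝ) ≤ cVel γ₁ γ₂ / 2 * t₀ → t₀ ≤ t →
      |x - cVel γ₁ γ₂ * t| ≤ K * μ ^ (2 / 3 : ℝ) →
      y = (x - cVel γ₁ γ₂ * t) / (μ ^ (2 / 3 : ℝ) * (qDisp γ₁ γ₂ * t) ^ (1 / 3 : ℝ)) →
      |(acousticIntegral γ₁ γ₂ F μ x t).re - amp γ₁ γ₂ μ t *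
        (F 0 * airyAi y - Complex.I * amp γ₁ γ₂ μ t * deriv F 0 * airyAiDeriv y).re| ≤
        C * (μ / t) := by
  have hq := qDisp_pos hγ₁ hγ
  have hc := cVel_pos hγ₁ hγ
  have hπ := Real.pi_pos
  obtain ⟨d, v, e, hψ, he, hψe⟩ := exists_frontPhase hγ₁ hγ
  obtain ⟨C₁, hC₁, H₁⟩ := norm_integral_nonstationary_le hF (contDiff_dispersion hγ₁ hγ)
    (b := Real.pi / 2) (by positivity) (half_pos hc) (fun p hp =>
      deriv_dispersion_nonneg hγ₁ hγ (abs_le.2 ⟨by linarith [hp.1], hp.2⟩))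
  obtain ⟨C₂, hC₂, H₂⟩ := hψ.norm_oscInt_sub_airy_combination_le he hψe hF
    (K / (qDisp γ₁ γ₂ * t₀) ^ (1 / 3 : ℝ))
  refine ⟨C₁ / Real.pi + C₂ / (2 * Real.pi * qDisp γ₁ γ₂), by positivity, ?_⟩
  intro μ t x y hμ hμ₁ hμ₂ ht hx hy
  have ht0 : 0 < t := ht₀.trans_le ht
  have ha := amp_pos hγ₁ hγ hμ ht0
  have ha3 := amp_pow_three hγ₁ hγ hμ ht0
  have hy' := hy.trans (airy_argument_eq hγ₁ hγ hμ ht0 _)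
  have hyb : |y| ≤ K / (qDisp γ₁ γ₂ * t₀) ^ (1 / 3 : ℝ) := by
    have hM : 0 < μ ^ (2 / 3 : ℝ) := Real.rpow_pos_of_pos hμ _
    have hn : 0 < (qDisp γ₁ γ₂ * t) ^ (1 / 3 : ℝ) := Real.rpow_pos_of_pos (by positivity) _
    have hn0 : 0 < (qDisp γ₁ γ₂ * t₀) ^ (1 / 3 : ℝ) := Real.rpow_pos_of_pos (by positivity) _
    rw [hy, abs_div, abs_of_pos (mul_pos hM hn), div_le_iff₀ (mul_pos hM hn)]
    refine hx.trans ?_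
    have : (qDisp γ₁ γ₂ * t₀) ^ (1 / 3 : ℝ) ≤ (qDisp γ₁ γ₂ * t) ^ (1 / 3 : ℝ) := by gcongr
    rw [div_mul_eq_mul_div, le_div_iff₀ hn0]
    calc K * μ ^ (2 / 3 : ℝ) * (qDisp γ₁ γ₂ * t₀) ^ (1 / 3 : ℝ)
        ≤ K * μ ^ (2 / 3 : ℝ) * (qDisp γ₁ γ₂ * t) ^ (1 / 3 : ℝ) := by gcongr
      _ = _ := by ring
  set a := amp γ₁ γ₂ μ t with hadef
  have ha1 : a ≤ 1 := by
    rw [hadef, amp]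
    refine Real.rpow_le_one (by positivity) ?_ (by norm_num)
    rw [div_le_one (by positivity)]
    exact hμ₁.trans (by gcongr)
  -- The linear part of the phase supplies a²y and the rest supplies ψ, both through a³ = μ/(qt).
  have hosc : ∀ p, osc (frontPhase γ₁ γ₂) 1 a y p =
      Complex.exp (Complex.I / μ * (p * x - dispersion γ₁ γ₂ p * t)) := by
    intro p
    have : (a ^ 2 * y * p + phase (frontPhase γ₁ γ₂) 1 p) / a ^ 3 =
        (p * x - dispersion γ₁ γ₂ p * t) / μ := by
      have e1 : a ^ 2 * y * p = a ^ 3 * ((x - cVel γ₁ γ₂ * t) / μ) * p := by rw [hy']; ring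
      rw [phase, frontPhase, e1, ha3]
      field_simp
      ring
    rw [osc, this]
    push_cast
    ring_nf
  have hoscc := hψ.continuous_osc 1 a y
  have hFc := hF.continuous
  have hoscI : oscInt (Real.pi / 2) (frontPhase γ₁ γ₂) 1 a y 0 0 F =
      ∫ p in (-(Real.pi / 2))..(Real.pi / 2), F p * osc (frontPhase γ₁ γ₂) 1 a y p := by
    simp [oscInt_zero]
  -- The integrand of the half p ≤ 0, continued to p > 0 with Ω in place of |Ω|, has the conjugation
  -- symmetry because Ω is odd.
  have hre := two_mul_re_integral_neg_half (f := fun p => F p * osc (frontPhase γ₁ γ₂) 1 a y p)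
    (by fun_prop) (fun p => by
      rw [map_mul, hconj, hosc, hosc, ← Complex.exp_conj, dispersion_neg]
      simp
      ring_nf
      simp) (Real.pi / 2)
  rw [← hoscI] at hre
  set N := ∫ p in (0 : ℝ)..(Real.pi / 2),
    F p * Complex.exp (Complex.I / μ * (p * x + dispersion γ₁ γ₂ p * t)) with hN
  have hsplit : acousticIntegral γ₁ γ₂ F μ x t = (1 / (Real.pi : ℂ)) *
      ((∫ p in (-(Real.pi / 2))..0, F p * osc (frontPhase γ₁ γ₂) 1 a y p) + N) := by
    have hcω : Continuous (omega1 γ₁ γ₂) := by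
      rw [show omega1 γ₁ γ₂ = _ from funext (omega1_eq_abs hγ₁ hγ)]
      exact (contDiff_dispersion hγ₁ hγ).continuous.abs
    have hcont : Continuous fun p : ℝ =>
        F p * Complex.exp (Complex.I / μ * (p * x + omega1 γ₁ γ₂ p * t)) := by fun_prop
    rw [acousticIntegral, ← intervalIntegral.integral_add_adjacent_intervals
      (hcont.intervalIntegrable (-(Real.pi / 2)) 0) (hcont.intervalIntegrable 0 (Real.pi / 2))]
    congr 2
    · refine intervalIntegral.integral_congr fun p hp => ?_
      rw [uIcc_of_le (by linarith)] at hp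
      simp only [hosc, omega1_of_nonpos hγ₁ hγ hp.2 hp.1]
      push_cast
      ring_nf
    · refine intervalIntegral.integral_congr fun p hp => ?_
      rw [uIcc_of_le (by positivity)] at hp
      simp only [omega1_of_nonneg hγ₁ hγ hp.1 hp.2]
  have hxc : cVel γ₁ γ₂ / 2 * t ≤ x := by
    have h1 := (abs_le.1 (hx.trans hμ₂)).1
    have h2 : cVel γ₁ γ₂ / 2 * t₀ ≤ cVel γ₁ γ₂ / 2 * t := by gcongr
    linarith
  have hNle := H₁ μ t x hμ ht0 hxc
  have hOle := H₂ a y ha ha1 hyb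
  set P := F 0 * airyAi y - Complex.I * a * deriv F 0 * airyAiDeriv y with hP
  have hP2 : (2 * Real.pi * (a * F 0 * airyAi y
      - Complex.I * a ^ 2 * deriv F 0 * airyAiDeriv y) : ℂ) = ((2 * Real.pi * a : ℝ) : ℂ) * P := by
    rw [hP]; push_cast; ring
  rw [hP2] at hOle
  have hOre := (Complex.abs_re_le_norm _).trans hOle
  rw [Complex.sub_re, Complex.re_ofReal_mul, ← hre, ha3] at hOre
  have hNre := (Complex.abs_re_le_norm _).trans hNle
  rw [hsplit, show (1 / (Real.pi : ℂ)) = ((1 / Real.pi : ℝ) : ℂ) by push_cast; ring,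
    Complex.re_ofReal_mul, Complex.add_re]
  set U := (∫ p in (-(Real.pi / 2))..0, F p * osc (frontPhase γ₁ γ₂) 1 a y p).re
  calc |1 / Real.pi * (U + N.re) - a * P.re|
      = |(1 / (2 * Real.pi)) * (2 * U - 2 * Real.pi * a * P.re) + (1 / Real.pi) * N.re| := by
        congr 1; field_simp; ring
    _ ≤ (1 / (2 * Real.pi)) * (C₂ * (μ / (qDisp γ₁ γ₂ * t))) + (1 / Real.pi) * (C₁ * (μ / t)) := by
        refine (abs_add_le _ _).trans ?_
        rw [abs_mul, abs_mul, abs_of_pos (by positivity : 0 < 1 / (2 * Real.pi)),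
          abs_of_pos (by positivity : 0 < 1 / Real.pi)]
        gcongr
    _ = _ := by field_simp; ring

end Core

/-! ### From values at the origin to the continued profile. -/

/-- Symmetrized values and symmetric difference quotients of a smooth function. -/
theorem exists_symmetric_bounds {f : ℝ → ℂ} (hf : ContDiff ℝ ∞ f) :
    ∃ M : ℝ, 0 ≤ M ∧ ∀ h : ℝ, 0 ≤ h → h ≤ 1 →
      ‖(f h + f (-h)) / 2 - f 0‖ ≤ M * h ^ 2 ∧
      (h ≠ 0 → ‖(f h - f (-h)) / (2 * (h : ℂ)) - deriv f 0‖ ≤ M * h) := by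
  obtain ⟨g, hg, e1⟩ := exists_contDiff_eq_add_smul hf
  obtain ⟨k, hk, e2⟩ := exists_contDiff_eq_add_smul hg
  have hg0 := eq_deriv_zero_of_eq_add_smul hg e1
  obtain ⟨M, hM⟩ := (isCompact_Icc (a := (-1 : ℝ)) (b := 1)).exists_bound_of_continuousOn
    hk.continuous.continuousOn
  have hM0 : 0 ≤ M := (norm_nonneg _).trans (hM 0 (by norm_num))
  simp only [Complex.real_smul, hg0] at e1 e2
  have hf' : ∀ p : ℝ, f p = f 0 + p * deriv f 0 + (p : ℂ) ^ 2 * k p := fun p => by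
    rw [e1 p, e2 p]; ring
  refine ⟨M, hM0, fun h h0 h1 => ?_⟩
  have b1 := hM h ⟨by linarith, h1⟩
  have b2 := hM (-h) ⟨by linarith, by linarith⟩
  have key : ∀ z : ℂ, ‖z‖ ≤ ‖k h‖ + ‖k (-h)‖ → ‖z / 2‖ ≤ M := by
    intro z hz
    rw [norm_div, Complex.norm_ofNat]
    linarith
  constructor
  · have : (f h + f (-h)) / 2 - f 0 = (h : ℂ) ^ 2 * ((k h + k (-h)) / 2) := by
      rw [hf' h, hf' (-h)]; push_cast; ring
    rw [this, norm_mul, norm_pow, Complex.norm_real, Real.norm_of_nonneg h0, mul_comm]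
    gcongr
    exact key _ (norm_add_le _ _)
  · intro hne
    have hne' : (h : ℂ) ≠ 0 := by exact_mod_cast hne
    have : (f h - f (-h)) / (2 * (h : ℂ)) - deriv f 0 = (h : ℂ) * ((k h - k (-h)) / 2) := by
      rw [hf' h, hf' (-h)]; push_cast; field_simp; ring
    rw [this, norm_mul, Complex.norm_real, Real.norm_of_nonneg h0, mul_comm]
    gcongr
    exact key _ (norm_sub_le _ _)

theorem exists_tildeV_bounds (W : SchwartzMap ℝ ℝ) (j : Fin 2) :
    ∃ M : ℝ, 0 ≤ M ∧ ∀ z : ℝ, |z| ≤ 1 / 2 →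
      ‖tildeV1 W z j - tildeV W 0 j‖ ≤ M * |z| ∧
      ‖tildeV2 W z j - deriv (fun p => tildeV W p j) 0‖ ≤ M * Real.sqrt |z| := by
  obtain ⟨M, hM, H⟩ := exists_symmetric_bounds (contDiff_tildeV W j)
  have he : ∀ z, 0 ≤ z → z ≤ 1 → ‖evenPart W z j - tildeV W 0 j‖ ≤ M * z := by
    intro z h0 h1
    have := (H (Real.sqrt z) (Real.sqrt_nonneg z) (Real.sqrt_le_one.2 h1)).1
    rwa [Real.sq_sqrt h0] at this
  have ho : ∀ z, 0 ≤ z → z ≤ 1 →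
      ‖oddPart W z j - deriv (fun p => tildeV W p j) 0‖ ≤ M * Real.sqrt z := by
    intro z h0 h1
    by_cases hz : z = 0
    · simp [oddPart, hz]
    · simp only [oddPart, if_neg hz]
      exact (H (Real.sqrt z) (Real.sqrt_nonneg z) (Real.sqrt_le_one.2 h1)).2
        (Real.sqrt_ne_zero'.2 (lt_of_le_of_ne h0 (Ne.symm hz)))
  have he0 : evenPart W 0 j = tildeV W 0 j := by simp [evenPart]
  have ho0 : oddPart W 0 j = deriv (fun p => tildeV W p j) 0 := by simp [oddPart]
  have tri : ∀ u w z : ℂ, ‖3 * z - 3 * u + w - z‖ ≤ 3 * ‖u - z‖ + ‖w - z‖ := by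
    intro u w z
    rw [show 3 * z - 3 * u + w - z = (w - z) - 3 * (u - z) by ring]
    refine (norm_sub_le _ _).trans ?_
    rw [norm_mul, Complex.norm_ofNat]
    linarith
  -- The coefficients 3, -3, 1 sum to 1, so the continuation errs by at most three times the error
  -- at -z plus the error at -2z. The latter is at most doubled (√2 ≤ 2 for the odd part), hence 3 +
  -- 2. The range 1/2 keeps -2z within [0, 1].
  refine ⟨5 * M, by positivity, fun z hz => ?_⟩
  by_cases h0 : 0 ≤ z
  · rw [abs_of_nonneg h0] at hz ⊢
    simp only [tildeV1, tildeV2, threePoint, if_pos h0]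
    have s := Real.sqrt_nonneg z
    exact ⟨(he z h0 (by linarith)).trans (by nlinarith),
      (ho z h0 (by linarith)).trans (by nlinarith)⟩
  · have h0' : z < 0 := not_le.1 h0
    rw [abs_of_neg h0'] at hz ⊢
    simp only [tildeV1, tildeV2, threePoint, if_neg h0, he0, ho0]
    constructor
    · refine (tri _ _ _).trans ?_
      have q1 := he (-z) (by linarith) (by linarith)
      have q2 := he (-2 * z) (by linarith) (by linarith)
      linarith
    · refine (tri _ _ _).trans ?_
      have q1 := ho (-z) (by linarith) (by linarith)
      have q2 := ho (-2 * z) (by linarith) (by linarith)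
      have q3 : Real.sqrt (-2 * z) ≤ 2 * Real.sqrt (-z) := by
        rw [show -2 * z = 2 * -z by ring, Real.sqrt_mul zero_le_two]
        gcongr
        exact Real.sqrt_le_iff.2 ⟨by norm_num, by norm_num⟩
      have q4 := mul_le_mul_of_nonneg_left q3 hM
      linarith

/-- The profile at the front `x = s c t`, for `s = ±1`, in the variable `ξ = s x - c t`. -/
def frontProfile (γ₁ γ₂ : ℝ) (W : SchwartzMap ℝ ℝ) (s μ ξ t : ℝ) : Fin 2 → ℝ :=
  let q := qDisp γ₁ γ₂
  let z := -(ξ / (q * t))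
  let y := ξ / (μ ^ (2 / 3 : ℝ) * (q * t) ^ (1 / 3 : ℝ))
  (matA γ₁ γ₂ 0).mulVec fun j =>
    (tildeV1 W z j * (airyAi y : ℂ)
      - Complex.I * (amp γ₁ γ₂ μ t : ℂ) * (s * tildeV2 W z j) * (airyAiDeriv y : ℂ)).re

section Front

variable {γ₁ γ₂ : ℝ}

theorem rightProfile_eq (W : SchwartzMap ℝ ℝ) (μ x t : ℝ) :
    rightProfile γ₁ γ₂ W μ x t =
      frontProfile γ₁ γ₂ W 1 μ (1 * x - cVel γ₁ γ₂ * t) t := by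
  simp [rightProfile, frontProfile]

theorem leftProfile_eq (W : SchwartzMap ℝ ℝ) (μ x t : ℝ) :
    leftProfile γ₁ γ₂ W μ x t =
      frontProfile γ₁ γ₂ W (-1) μ (-1 * x - cVel γ₁ γ₂ * t) t := by
  simp only [leftProfile, frontProfile]
  rw [show -1 * x - cVel γ₁ γ₂ * t = -(x + cVel γ₁ γ₂ * t) by ring]
  simp only [neg_div, neg_neg]
  congr 1
  ext j
  congr 1
  push_cast
  ring

/-- With z = O(μ^{2/3}), the even part moves by O(|z|), while the odd part moves only by O(√|z|) =
O(μ^{1/3}); the prefactor a supplies the missing μ^{1/3}. -/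
theorem exists_frontProfile_bound (hγ₁ : 0 < γ₁) (hγ : γ₁ < γ₂) (W : SchwartzMap ℝ ℝ)
    {K t₀ : ℝ} (hK : 0 < K) (ht₀ : 0 < t₀) (j : Fin 2) {s : ℝ} (hs : |s| = 1) :
    ∃ C : ℝ, 0 ≤ C ∧ ∀ μ t ξ y : ℝ, 0 < μ → K * μ ^ (2 / 3 : ℝ) ≤ qDisp γ₁ γ₂ * t₀ / 2 → t₀ ≤ t →
      |ξ| ≤ K * μ ^ (2 / 3 : ℝ) →
      y = ξ / (μ ^ (2 / 3 : ℝ) * (qDisp γ₁ γ₂ * t) ^ (1 / 3 : ℝ)) →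
      |(amplitude γ₁ γ₂ W j 0 * airyAi y - Complex.I * amp γ₁ γ₂ μ t *
        (s * deriv (amplitude γ₁ γ₂ W j) 0) * airyAiDeriv y).re
        - frontProfile γ₁ γ₂ W s μ ξ t j| ≤ C * μ ^ (2 / 3 : ℝ) := by
  have hq := qDisp_pos hγ₁ hγ
  choose M hM H using exists_tildeV_bounds W
  obtain ⟨B, hB, HB⟩ := exists_airy_bound (K / (qDisp γ₁ γ₂ * t₀) ^ (1 / 3 : ℝ))
  set n₀ := (qDisp γ₁ γ₂ * t₀) ^ (1 / 3 : ℝ) with hn₀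
  have hn₀p : 0 < n₀ := Real.rpow_pos_of_pos (by positivity) _
  set Z := K / (qDisp γ₁ γ₂ * t₀) with hZ
  have hZ0 : 0 < Z := by positivity
  refine ⟨∑ l, |matA γ₁ γ₂ 0 j l| * (M l * B * (Z + n₀⁻¹ * Real.sqrt Z)),
    Finset.sum_nonneg fun l _ => ?_, ?_⟩
  · have := hM l
    positivity
  intro μ t ξ y hμ hμ₁ ht hξ hy
  have ht0 : 0 < t := ht₀.trans_le ht
  have hm : 0 < μ ^ (1 / 3 : ℝ) := Real.rpow_pos_of_pos hμ _
  have hm2 := rpow_two_thirds hμ.le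
  have ha := amp_pos hγ₁ hγ hμ ht0
  have hale := amp_le hγ₁ hγ hμ ht₀ ht
  rw [← hn₀] at hale
  have hyb : |y| ≤ K / n₀ := by
    have hM : 0 < μ ^ (2 / 3 : ℝ) := Real.rpow_pos_of_pos hμ _
    have hn : 0 < (qDisp γ₁ γ₂ * t) ^ (1 / 3 : ℝ) := Real.rpow_pos_of_pos (by positivity) _
    rw [hy, abs_div, abs_of_pos (mul_pos hM hn), div_le_div_iff₀ (mul_pos hM hn) hn₀p]
    have : n₀ ≤ (qDisp γ₁ γ₂ * t) ^ (1 / 3 : ℝ) := by rw [hn₀]; gcongr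
    calc |ξ| * n₀ ≤ K * μ ^ (2 / 3 : ℝ) * (qDisp γ₁ γ₂ * t) ^ (1 / 3 : ℝ) := by gcongr
      _ = _ := by ring
  obtain ⟨hAi, hAi'⟩ := HB y hyb
  set z := -(ξ / (qDisp γ₁ γ₂ * t)) with hz
  have hzZ : |z| ≤ Z * μ ^ (2 / 3 : ℝ) := by
    rw [hz, abs_neg, abs_div, abs_of_pos (by positivity : 0 < qDisp γ₁ γ₂ * t), hZ]
    calc |ξ| / (qDisp γ₁ γ₂ * t) ≤ K * μ ^ (2 / 3 : ℝ) / (qDisp γ₁ γ₂ * t₀) := by gcongr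
      _ = _ := by ring
  have hz2 : |z| ≤ 1 / 2 := by
    refine hzZ.trans ?_
    rw [hZ, div_mul_eq_mul_div, div_le_iff₀ (by positivity)]
    linarith
  have hsq : Real.sqrt |z| ≤ Real.sqrt Z * μ ^ (1 / 3 : ℝ) := by
    refine (Real.sqrt_le_sqrt hzZ).trans (le_of_eq ?_)
    rw [Real.sqrt_mul hZ0.le, hm2, Real.sqrt_sq hm.le]
  set a := amp γ₁ γ₂ μ t
  have hdiff : (amplitude γ₁ γ₂ W j 0 * airyAi y - Complex.I * a *
        (s * deriv (amplitude γ₁ γ₂ W j) 0) * airyAiDeriv y).re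
        - frontProfile γ₁ γ₂ W s μ ξ t j =
      ∑ l, matA γ₁ γ₂ 0 j l * (-((tildeV1 W z l - tildeV W 0 l) * airyAi y
        - Complex.I * a * (s * (tildeV2 W z l - deriv (fun p => tildeV W p l) 0))
          * airyAiDeriv y).re) := by
    have e1 : amplitude γ₁ γ₂ W j 0 * airyAi y - Complex.I * a *
        (s * deriv (amplitude γ₁ γ₂ W j) 0) * airyAiDeriv y =
        ∑ l, (matA γ₁ γ₂ 0 j l : ℂ) * (tildeV W 0 l * airyAi y
          - Complex.I * a * (s * deriv (fun p => tildeV W p l) 0) * airyAiDeriv y) := by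
      rw [deriv_amplitude_zero W j hγ₁ hγ, amplitude_eq]
      simp only [Fin.sum_univ_two]
      ring
    have e2 : frontProfile γ₁ γ₂ W s μ ξ t j = ∑ l, matA γ₁ γ₂ 0 j l *
        (tildeV1 W z l * airyAi y
          - Complex.I * a * (s * tildeV2 W z l) * airyAiDeriv y).re := by
      simp only [frontProfile, Matrix.mulVec, dotProduct, ← hy, ← hz]
      rfl
    rw [e1, e2, Complex.re_sum, ← Finset.sum_sub_distrib]
    refine Finset.sum_congr rfl fun l _ => ?_
    rw [Complex.re_ofReal_mul, ← mul_sub, ← Complex.sub_re, ← Complex.neg_re]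
    congr 2
    ring
  rw [hdiff, Finset.sum_mul]
  refine (Finset.abs_sum_le_sum_abs _ _).trans (Finset.sum_le_sum fun l _ => ?_)
  obtain ⟨k1, k2⟩ := H l z hz2
  have hMl := hM l
  rw [abs_mul, abs_neg, mul_assoc |matA γ₁ γ₂ 0 j l|]
  refine mul_le_mul_of_nonneg_left ((Complex.abs_re_le_norm _).trans
    ((norm_sub_le _ _).trans ?_)) (abs_nonneg _)
  simp only [norm_mul, Complex.norm_I, Complex.norm_real, Real.norm_eq_abs, hs, one_mul,
    abs_of_pos ha]
  calc ‖tildeV1 W z l - tildeV W 0 l‖ * |airyAi y|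
        + a * ‖tildeV2 W z l - deriv (fun p => tildeV W p l) 0‖ * |airyAiDeriv y|
      ≤ M l * (Z * μ ^ (2 / 3 : ℝ)) * B
        + (n₀⁻¹ * μ ^ (1 / 3 : ℝ)) * (M l * (Real.sqrt Z * μ ^ (1 / 3 : ℝ))) * B := by
        have k1' := k1.trans (mul_le_mul_of_nonneg_left hzZ hMl)
        have k2' := k2.trans (mul_le_mul_of_nonneg_left hsq hMl)
        gcongr
    _ = _ := by rw [hm2]; ring

/-- For s = -1 the integral is taken at -x with amplitude F(-p), whose derivative at 0 changes sign;
this is the sign of the Ai' term in the left profile. -/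
theorem exists_front_estimate (hγ₁ : 0 < γ₁) (hγ : γ₁ < γ₂) (W : SchwartzMap ℝ ℝ)
    {K t₀ : ℝ} (hK : 0 < K) (ht₀ : 0 < t₀) (j : Fin 2) {s : ℝ} (hs : s = 1 ∨ s = -1) :
    ∃ C : ℝ, 0 ≤ C ∧ ∀ μ t x : ℝ, 0 < μ → μ ≤ qDisp γ₁ γ₂ * t₀ →
      K * μ ^ (2 / 3 : ℝ) ≤ cVel γ₁ γ₂ / 2 * t₀ → K * μ ^ (2 / 3 : ℝ) ≤ qDisp γ₁ γ₂ * t₀ / 2 →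
      t₀ ≤ t → |s * x - cVel γ₁ γ₂ * t| ≤ K * μ ^ (2 / 3 : ℝ) →
      |(Iac γ₁ γ₂ W μ x t j).re - amp γ₁ γ₂ μ t *
        frontProfile γ₁ γ₂ W s μ (s * x - cVel γ₁ γ₂ * t) t j| ≤
        C * μ ^ (2 / 3 : ℝ) * amp γ₁ γ₂ μ t := by
  have hq := qDisp_pos hγ₁ hγ
  have hs1 : |s| = 1 := by rcases hs with h | h <;> simp [h]
  have hF := contDiff_amplitude (γ₁ := γ₁) (γ₂ := γ₂) W j hγ₁ hγ
  have hFs : ContDiff ℝ ∞ fun p => amplitude γ₁ γ₂ W j (s * p) :=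
    hF.comp (contDiff_const.mul contDiff_id)
  have hder : deriv (fun p => amplitude γ₁ γ₂ W j (s * p)) 0 =
      s * deriv (amplitude γ₁ γ₂ W j) 0 := by
    rw [deriv_comp_mul_left, mul_zero, Complex.real_smul]
  have hI : ∀ μ x t : ℝ, Iac γ₁ γ₂ W μ x t j =
      acousticIntegral γ₁ γ₂ (fun p => amplitude γ₁ γ₂ W j (s * p)) μ (s * x) t := by
    intro μ x t
    rcases hs with h | h
    · simp only [h, one_mul]; rfl
    · simp only [h, neg_mul, one_mul]
      rw [acousticIntegral_neg hγ₁ hγ]; rfl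
  obtain ⟨C₁, hC₁, H₁⟩ := abs_re_acousticIntegral_sub_le hγ₁ hγ hFs
    (fun p => by rw [conj_amplitude, mul_neg]) hK ht₀
  obtain ⟨C₂, hC₂, H₂⟩ := exists_frontProfile_bound hγ₁ hγ W hK ht₀ j hs1
  set n₀ := (qDisp γ₁ γ₂ * t₀) ^ (1 / 3 : ℝ) with hn₀
  have hn₀p : 0 < n₀ := Real.rpow_pos_of_pos (by positivity) _
  refine ⟨C₁ * qDisp γ₁ γ₂ * (n₀⁻¹) ^ 2 + C₂, by positivity, ?_⟩
  intro μ t x hμ hμ₁ hμ₂ hμ₃ ht hx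
  have ht0 : 0 < t := ht₀.trans_le ht
  have ha := amp_pos hγ₁ hγ hμ ht0
  have ha3 := amp_pow_three hγ₁ hγ hμ ht0
  have hale := amp_le hγ₁ hγ hμ ht₀ ht
  rw [← hn₀] at hale
  have h1 := H₁ μ t (s * x) _ hμ hμ₁ hμ₂ ht hx rfl
  have h2 := H₂ μ t _ _ hμ hμ₃ ht hx rfl
  rw [hder, mul_zero, ← hI] at h1
  set a := amp γ₁ γ₂ μ t
  -- μ/t = q a³: one factor a stays as the order of the leading term, and a² is at most a constant
  -- times μ^{2/3} since t ≥ t₀.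
  have hμt : μ / t ≤ qDisp γ₁ γ₂ * (n₀⁻¹) ^ 2 * μ ^ (2 / 3 : ℝ) * a := by
    have e : μ / t = qDisp γ₁ γ₂ * (a ^ 2 * a) := by rw [← pow_succ, ha3]; field_simp
    have e2 : a ^ 2 ≤ (n₀⁻¹ * μ ^ (1 / 3 : ℝ)) ^ 2 := by gcongr
    rw [mul_pow, ← rpow_two_thirds hμ.le] at e2
    rw [e]
    calc qDisp γ₁ γ₂ * (a ^ 2 * a) ≤ qDisp γ₁ γ₂ * ((n₀⁻¹) ^ 2 * μ ^ (2 / 3 : ℝ) * a) := by gcongr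
      _ = _ := by ring
  have h2' := mul_le_mul_of_nonneg_left h2 ha.le
  rw [← abs_of_pos ha, ← abs_mul, abs_of_pos ha, mul_sub] at h2'
  refine (abs_sub_le _ _ _).trans ((add_le_add h1 h2').trans ?_)
  linarith [mul_le_mul_of_nonneg_left hμt hC₁]

end Front

/-! ### Relative error and final constants. -/

theorem LeadingOrder.of_abs_sub_le {C C' ε a P v : ℝ} (hC : C ≤ C') (hε : 0 ≤ ε) (ha : 0 < a)
    (h : |v - a * P| ≤ C * ε * a) : LeadingOrder C' ε a P v := by
  have h' : |v - a * P| ≤ C' * ε * a := h.trans (by gcongr)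
  -- r is the error divided by the leading term, which is nonzero because |P| ≥ κ.
  refine ⟨h', fun κ hκ hP => ⟨(v - a * P) / (a * P), ?_, ?_⟩⟩
  · have hP0 : 0 < |P| := hκ.trans_le hP
    rw [abs_div, abs_mul, abs_of_pos ha, div_le_iff₀ (by positivity)]
    have hnn : 0 ≤ C' * ε := by
      by_contra hneg
      have := mul_neg_of_neg_of_pos (not_le.1 hneg) ha
      linarith [abs_nonneg (v - a * P)]
    calc |v - a * P| ≤ C' * ε * a := h'
      _ = C' * ε / κ * (a * κ) := by field_simp
      _ ≤ C' * ε / κ * (a * |P|) := by gcongr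
      _ = _ := by ring
  · have hP0 : P ≠ 0 := abs_pos.1 (hκ.trans_le hP)
    have := ha.ne'
    field_simp
    ring

theorem rpow_two_thirds_le {μ X : ℝ} (hμ : 0 < μ) (hX : 0 < X) (h : μ ≤ X ^ (3 / 2 : ℝ)) :
    μ ^ (2 / 3 : ℝ) ≤ X := by
  calc μ ^ (2 / 3 : ℝ) ≤ (X ^ (3 / 2 : ℝ)) ^ (2 / 3 : ℝ) := by gcongr
    _ = X := by rw [← Real.rpow_mul hX.le]; norm_num

end DiatomicLattice
end

open DiatomicLattice

theorem mainTheorem8 (γ₁ γ₂ : ℝ) (hγ₁ : 0 < γ₁) (hγ : γ₁ < γ₂) (W : SchwartzMap ℝ ℝ)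
    (K t₀ : ℝ) (hK : 0 < K) (ht₀ : 0 < t₀) :
    ∃ C : ℝ, 0 < C ∧ ∃ μ₀ : ℝ, 0 < μ₀ ∧
      ∀ μ t x : ℝ, 0 < μ → μ ≤ μ₀ → t₀ ≤ t →
        (|x - DiatomicLattice.cVel γ₁ γ₂ * t| ≤ K * μ ^ (2 / 3 : ℝ) →
          ∀ j : Fin 2,
            DiatomicLattice.LeadingOrder C (μ ^ (2 / 3 : ℝ)) (DiatomicLattice.amp γ₁ γ₂ μ t)
              (DiatomicLattice.rightProfile γ₁ γ₂ W μ x t j)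
              (DiatomicLattice.Iac γ₁ γ₂ W μ x t j).re) ∧
        (|x + DiatomicLattice.cVel γ₁ γ₂ * t| ≤ K * μ ^ (2 / 3 : ℝ) →
          ∀ j : Fin 2,
            DiatomicLattice.LeadingOrder C (μ ^ (2 / 3 : ℝ)) (DiatomicLattice.amp γ₁ γ₂ μ t)
              (DiatomicLattice.leftProfile γ₁ γ₂ W μ x t j)
              (DiatomicLattice.Iac γ₁ γ₂ W μ x t j).re) := by
  have hq := qDisp_pos hγ₁ hγ
  have hc := cVel_pos hγ₁ hγ
  choose C₁ hC₁ H₁ using fun j =>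
    exists_front_estimate hγ₁ hγ W hK ht₀ j (s := 1) (Or.inl rfl)
  choose C₂ hC₂ H₂ using fun j =>
    exists_front_estimate hγ₁ hγ W hK ht₀ j (s := -1) (Or.inr rfl)
  have hle₁ : ∀ j, C₁ j ≤ 1 + ∑ l, (C₁ l + C₂ l) := fun j => by
    have := Finset.single_le_sum (f := fun l => C₁ l + C₂ l)
      (fun l _ => add_nonneg (hC₁ l) (hC₂ l)) (Finset.mem_univ j)
    linarith [hC₂ j]
  have hle₂ : ∀ j, C₂ j ≤ 1 + ∑ l, (C₁ l + C₂ l) := fun j => by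
    have := Finset.single_le_sum (f := fun l => C₁ l + C₂ l)
      (fun l _ => add_nonneg (hC₁ l) (hC₂ l)) (Finset.mem_univ j)
    linarith [hC₁ j]
  -- μ^{2/3} ≤ X ensures both x ≥ ct/2 in the reflected variable and |z| ≤ 1/2; the other bound in
  -- μ₀, μ ≤ q t₀, ensures a ≤ 1.
  set X := min (cVel γ₁ γ₂ / 2 * t₀) (qDisp γ₁ γ₂ * t₀ / 2) / K with hX
  have hX0 : 0 < X := div_pos (lt_min (by positivity) (by positivity)) hK
  refine ⟨1 + ∑ l, (C₁ l + C₂ l), ?_, min (qDisp γ₁ γ₂ * t₀) (X ^ (3 / 2 : ℝ)),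
    lt_min (by positivity) (Real.rpow_pos_of_pos hX0 _), ?_⟩
  · have := Finset.sum_nonneg fun l (_ : l ∈ Finset.univ) => add_nonneg (hC₁ l) (hC₂ l)
    linarith
  intro μ t x hμ hμ₀ ht
  have hμ₁ := hμ₀.trans (min_le_left _ _)
  have hμX := rpow_two_thirds_le hμ hX0 (hμ₀.trans (min_le_right _ _))
  have hKμ : K * μ ^ (2 / 3 : ℝ) ≤ min (cVel γ₁ γ₂ / 2 * t₀) (qDisp γ₁ γ₂ * t₀ / 2) := by
    rwa [hX, le_div_iff₀ hK, mul_comm] at hμX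
  have hμ₂ := hKμ.trans (min_le_left _ _)
  have hμ₃ := hKμ.trans (min_le_right _ _)
  have hε : 0 ≤ μ ^ (2 / 3 : ℝ) := Real.rpow_nonneg hμ.le _
  have ha := amp_pos hγ₁ hγ hμ (ht₀.trans_le ht)
  refine ⟨fun hx j => ?_, fun hx j => ?_⟩
  · rw [rightProfile_eq]
    exact LeadingOrder.of_abs_sub_le (hle₁ j) hε ha
      (H₁ j μ t x hμ hμ₁ hμ₂ hμ₃ ht (by rwa [one_mul]))
  · rw [leftProfile_eq]
    refine LeadingOrder.of_abs_sub_le (hle₂ j) hε ha (H₂ j μ t x hμ hμ₁ hμ₂ hμ₃ ht ?_)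
    rwa [show -1 * x - cVel γ₁ γ₂ * t = -(x + cVel γ₁ γ₂ * t) by ring, abs_neg]
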